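/- Let $\mathrm{Pol}(O_{-1}(2))$ be the universal unital complex $*$-algebra generated by self-adjoint elements $\tilde a_{ij}$, $1\le i,j\le 2$, such that the matrix $\tilde A=(\tilde a_{ij})$ is orthogonal ($\tilde A\tilde A^{\top}=\tilde A^{\top}\tilde A=1$), distinct entries in the same row or in the same column anticommute, and entries in distinct rows and distinct columns commute. Let $\mathrm{Pol}(SO_{-1}(3))$ be the universal unital complex $*$-algebra generated by self-adjoint elements $a_{ij}$, $1\le i,j\le 3$, such that $A=(a_{ij})$ satisfies the same relations and in addition $\sum_{\sigma\in S_3}a_{1\sigma(1)}a_{2\sigma(2)}a_{3\sigma(3)}=1$. Both are Hopf $*$-algebras with comultiplication determined by $\Delta(a_{ij})=\sum_k a_{ik}\otimes a_{kj}$ (and likewise for $\tilde a_{ij}$); they are the coordinate algebras of the compact quantum groups $O_{-1}(2)$ and $SO_{-1}(3)$. An embedding $O_{-1}(2)\subset SO_{-1}(3)$ is a surjective unital $*$-homomorphism $\mathrm{Pol}(SO_{-1}(3))\to\mathrm{Pol}(O_{-1}(2))$ that intertwines the comultiplications. Two embeddings define the same copy of $O_{-1}(2)$ in $SO_{-1}(3)$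 if their kernels are equal. Let $\rho\colon S_4\to O(3)$ be the restriction of the permutation representation of $S_4$ on $\mathbb R^4$ to $(1,1,1,1)^{\perp}$, written in the orthonormal basis $\tfrac12(1,-1,1,-1)$, $\tfrac12(1,1,-1,-1)$, $\tfrac12(1,-1,-1,1)$, and let $\mathrm{perm}(\tilde A)=\tilde a_{11}\tilde a_{22}+\tilde a_{12}\tilde a_{21}$. Theorem. There are exactly three copies of $O_{-1}(2)$ in $SO_{-1}(3)$. Any two of them are conjugate: for any two such kernels $I,J$ there is $x\in S_4$ such that $A\mapsto\rho(x)^{\top}A\,\rho(x)$ defines a Hopf $*$-algebra automorphism of $\mathrm{Pol}(SO_{-1}(3))$ that maps $I$ onto $J$. Explicitly, for every $x\in S_4$ the formula $$A\longmapsto \rho(x)\begin{pmatrix}\tilde A&0\\0&\mathrm{perm}(\tilde A)\end{pmatrix}\rho(x)^{\top}$$ defines an embedding $O_{-1}(2)\subset SO_{-1}(3)$, and every embedding is of this form for some $x\in S_4$. -/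

import Mathlib

open scoped TensorProduct

namespace MinusOne

/-! ### Universal *-algebras generated by the entries of a self-adjoint matrix -/

/-- The free complex algebra on the symbols `x i j`, `i, j : Fin n`. -/
abbrev FreeMat (n : ℕ) : Type := FreeAlgebra ℂ (Fin n × Fin n)

/-- The `(i, j)` generator of the free algebra. -/
noncomputable def FreeMat.x {n : ℕ} (i j : Fin n) : FreeMat n := FreeAlgebra.ι ℂ (i, j)

/-- The algebra homomorphism from the free algebra that sends `x i j` to `u i j`. -/
noncomputable def FreeMat.eval {n : ℕ} {B : Type} [Ring B] [Algebra ℂ B]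
    (u : Matrix (Fin n) (Fin n) B) : FreeMat n →ₐ[ℂ] B :=
  FreeAlgebra.lift ℂ fun p => u p.1 p.2

@[simp]
theorem FreeMat.eval_x {n : ℕ} {B : Type} [Ring B] [Algebra ℂ B]
    (u : Matrix (Fin n) (Fin n) B) (i j : Fin n) : FreeMat.eval u (FreeMat.x i j) = u i j := by
  simp [FreeMat.eval, FreeMat.x]

/-- The matrix `u` satisfies the relations `r`. -/
def Satisfies {n : ℕ} (r : FreeMat n → FreeMat n → Prop) {B : Type} [Ring B] [Algebra ℂ B]
    (u : Matrix (Fin n) (Fin n) B) : Prop :=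
  ∀ ⦃p q : FreeMat n⦄, r p q → FreeMat.eval u p = FreeMat.eval u q

/-- The universal unital complex algebra generated by the entries of an `n × n` matrix subject to
the relations `r`. -/
def Pol {n : ℕ} (r : FreeMat n → FreeMat n → Prop) : Type := RingQuot r

section Pol

variable {n : ℕ} (r : FreeMat n → FreeMat n → Prop)

noncomputable instance : Ring (Pol r) := inferInstanceAs (Ring (RingQuot r))

noncomputable instance : Algebra ℂ (Pol r) := inferInstanceAs (Algebra ℂ (RingQuot r))

/-- The quotient map from the free algebra. -/
noncomputable def Pol.mk : FreeMat n →ₐ[ℂ] Pol r := RingQuot.mkAlgHom ℂ r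

/-- The generic matrix, i.e. the matrix of generators of `Pol r`. -/
noncomputable def Pol.gen : Matrix (Fin n) (Fin n) (Pol r) :=
  Matrix.of fun i j => Pol.mk r (FreeMat.x i j)

theorem Pol.eval_gen : FreeMat.eval (Pol.gen r) = Pol.mk r := by
  apply FreeAlgebra.hom_ext
  funext p
  exact FreeMat.eval_x (Pol.gen r) p.1 p.2

theorem Pol.satisfies_gen : Satisfies r (Pol.gen r) := by
  intro p q h
  rw [Pol.eval_gen]
  exact RingQuot.mkAlgHom_rel ℂ h

variable {r}

/-- The universal property. -/
noncomputable def Pol.lift {B : Type} [Ring B] [Algebra ℂ B] (u : Matrix (Fin n) (Fin n) B)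
    (hu : Satisfies r u) : Pol r →ₐ[ℂ] B :=
  RingQuot.liftAlgHom ℂ ⟨FreeMat.eval u, hu⟩

theorem Pol.lift_mk {B : Type} [Ring B] [Algebra ℂ B] (u : Matrix (Fin n) (Fin n) B)
    (hu : Satisfies r u) (p : FreeMat n) : Pol.lift u hu (Pol.mk r p) = FreeMat.eval u p :=
  RingQuot.liftAlgHom_mkAlgHom_apply ℂ (FreeMat.eval u) hu p

@[simp]
theorem Pol.lift_gen {B : Type} [Ring B] [Algebra ℂ B] (u : Matrix (Fin n) (Fin n) B)
    (hu : Satisfies r u) (i j : Fin n) : Pol.lift u hu (Pol.gen r i j) = u i j := by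
  simp [Pol.gen, Pol.lift_mk]

theorem Pol.induction {motive : Pol r → Prop}
    (algebraMap : ∀ c : ℂ, motive (algebraMap ℂ (Pol r) c))
    (gen : ∀ i j, motive (Pol.gen r i j))
    (mul : ∀ a b, motive a → motive b → motive (a * b))
    (add : ∀ a b, motive a → motive b → motive (a + b)) (a : Pol r) : motive a := by
  obtain ⟨p, rfl⟩ := RingQuot.mkAlgHom_surjective ℂ r a
  change motive (Pol.mk r p)
  induction p using FreeAlgebra.induction with
  | grade0 c => rw [AlgHom.commutes]; exact algebraMap c
  | grade1 p => exact gen p.1 p.2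
  | mul a b ha hb => rw [map_mul]; exact mul _ _ ha hb
  | add a b ha hb => rw [map_add]; exact add _ _ ha hb

theorem Pol.hom_ext {B : Type} [Ring B] [Algebra ℂ B] {f g : Pol r →ₐ[ℂ] B}
    (h : ∀ i j, f (Pol.gen r i j) = g (Pol.gen r i j)) : f = g := by
  ext a
  induction a using Pol.induction with
  | algebraMap c => simp
  | gen i j => exact h i j
  | mul a b ha hb => simp [ha, hb]
  | add a b ha hb => simp [ha, hb]

end Pol

/-- The opposite algebra of `A` with the conjugate complex structure. A conjugate-linear
anti-endomorphism of `A` is a complex algebra homomorphism from `A` to `ConjOp A`. -/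
def ConjOp (A : Type) : Type := Aᵐᵒᵖ

section ConjOp

variable (A : Type) [Ring A] [Algebra ℂ A]

noncomputable instance : Ring (ConjOp A) := inferInstanceAs (Ring Aᵐᵒᵖ)

noncomputable instance : Algebra ℂ (ConjOp A) :=
  letI : Algebra ℂ Aᵐᵒᵖ := inferInstance
  Algebra.compHom Aᵐᵒᵖ (starRingEnd ℂ)

end ConjOp

/-- The underlying element of the opposite algebra. -/
def ConjOp.op {A : Type} (a : A) : ConjOp A := MulOpposite.op a

/-- The underlying element of the algebra. -/
def ConjOp.unop {A : Type} (a : ConjOp A) : A := MulOpposite.unop a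

@[simp] theorem ConjOp.unop_op {A : Type} (a : A) : (ConjOp.op a).unop = a := rfl

@[simp] theorem ConjOp.unop_mul {A : Type} [Ring A] (a b : ConjOp A) : (a * b).unop = b.unop * a.unop := rfl

@[simp] theorem ConjOp.unop_add {A : Type} [Ring A] (a b : ConjOp A) : (a + b).unop = a.unop + b.unop := rfl

@[simp] theorem ConjOp.unop_algebraMap {A : Type} [Ring A] [Algebra ℂ A] (c : ℂ) :
    (algebraMap ℂ (ConjOp A) c).unop = algebraMap ℂ A (starRingEnd ℂ c) := rfl

/-- The relations `r` define a Hopf *-algebra in which the generic matrix `A = (a i j)` is an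
orthogonal matrix with self-adjoint entries and is a corepresentation: the assignments
`a i j ↦ a i j` (conjugate-linear and anti-multiplicative), `a i j ↦ ∑ k, a i k ⊗ a k j`,
`a i j ↦ δ i j` and `a i j ↦ a j i` (linear and anti-multiplicative) respect the relations. -/
class IsHopfRel {n : ℕ} (r : FreeMat n → FreeMat n → Prop) : Prop where
  star : Satisfies r (Matrix.of fun i j => ConjOp.op (Pol.gen r i j))
  comul : Satisfies r (Matrix.of fun i j => ∑ k, Pol.gen r i k ⊗ₜ[ℂ] Pol.gen r k j)
  counit : Satisfies r (1 : Matrix (Fin n) (Fin n) ℂ)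
  antipode : Satisfies r (Matrix.of fun i j => MulOpposite.op (Pol.gen r j i))
  mul_transpose : Pol.gen r * (Pol.gen r).transpose = 1
  transpose_mul : (Pol.gen r).transpose * Pol.gen r = 1

section Hopf

variable {n : ℕ} {r : FreeMat n → FreeMat n → Prop} [hr : IsHopfRel r]

/-- The involution: the conjugate-linear anti-automorphism that fixes the generators. -/
noncomputable instance : Star (Pol r) where
  star a := (Pol.lift _ hr.star a).unop

theorem Pol.star_def (a : Pol r) : star a = (Pol.lift _ hr.star a).unop := rfl

@[simp] theorem Pol.star_gen (i j : Fin n) : star (Pol.gen r i j) = Pol.gen r i j := by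
  simp [Pol.star_def]

@[simp] theorem Pol.star_algebraMap (c : ℂ) :
    star (algebraMap ℂ (Pol r) c) = algebraMap ℂ (Pol r) (starRingEnd ℂ c) := by
  simp [Pol.star_def]

theorem Pol.star_add' (a b : Pol r) : star (a + b) = star a + star b := by
  simp [Pol.star_def]

theorem Pol.star_mul' (a b : Pol r) : star (a * b) = star b * star a := by
  simp [Pol.star_def]

noncomputable instance : StarRing (Pol r) where
  star_involutive a := by
    induction a using Pol.induction with
    | algebraMap c => simp
    | gen i j => simp
    | mul a b ha hb => simp only [Pol.star_mul', ha, hb]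
    | add a b ha hb => simp only [Pol.star_add', ha, hb]
  star_mul := Pol.star_mul'
  star_add := Pol.star_add'

instance : StarModule ℂ (Pol r) where
  star_smul c a := by
    rw [Algebra.smul_def, star_mul, Pol.star_algebraMap, ← Algebra.commutes, ← Algebra.smul_def]
    rfl

/-- The bialgebra structure: `Δ (a i j) = ∑ k, a i k ⊗ a k j` and `ε (a i j) = δ i j`. -/
noncomputable instance : Bialgebra ℂ (Pol r) :=
  Bialgebra.ofAlgHom (Pol.lift _ hr.comul) (Pol.lift _ hr.counit)
    (by
      apply Pol.hom_ext
      intro i j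
      simp only [AlgHom.comp_apply, Pol.lift_gen, Matrix.of_apply,
        map_sum, Algebra.TensorProduct.map_tmul, AlgHom.id_apply, TensorProduct.sum_tmul,
        TensorProduct.tmul_sum]
      exact Finset.sum_comm)
    (by
      apply Pol.hom_ext
      intro i j
      simp [Matrix.one_apply, TensorProduct.ite_tmul])
    (by
      apply Pol.hom_ext
      intro i j
      simp [Matrix.one_apply, TensorProduct.tmul_ite])

@[simp] theorem Pol.comul_gen (i j : Fin n) :
    Coalgebra.comul (R := ℂ) (Pol.gen r i j) = ∑ k, Pol.gen r i k ⊗ₜ[ℂ] Pol.gen r k j :=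
  Pol.lift_gen _ hr.comul i j

@[simp] theorem Pol.counit_gen (i j : Fin n) :
    Coalgebra.counit (R := ℂ) (Pol.gen r i j) = if i = j then 1 else 0 := by
  refine (Pol.lift_gen _ hr.counit i j).trans ?_
  simp [Matrix.one_apply]

/-- The antipode `S (a i j) = a j i`, as a homomorphism to the opposite algebra. -/
noncomputable def Pol.antipodeHom : Pol r →ₐ[ℂ] (Pol r)ᵐᵒᵖ := Pol.lift _ hr.antipode

/-- The antipode as a linear map. -/
noncomputable def Pol.antipodeLin : Pol r →ₗ[ℂ] Pol r :=
  (MulOpposite.opLinearEquiv ℂ).symm.toLinearMap ∘ₗ Pol.antipodeHom.toLinearMap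

theorem Pol.antipodeLin_apply (a : Pol r) :
    Pol.antipodeLin a = MulOpposite.unop (Pol.antipodeHom a) := rfl

theorem Pol.antipodeLin_gen (i j : Fin n) : Pol.antipodeLin (Pol.gen r i j) = Pol.gen r j i := by
  simp [Pol.antipodeLin_apply, Pol.antipodeHom]

theorem Pol.antipodeLin_mul (a b : Pol r) :
    Pol.antipodeLin (a * b) = Pol.antipodeLin b * Pol.antipodeLin a := by
  simp [Pol.antipodeLin_apply]

theorem Pol.antipodeLin_algebraMap (c : ℂ) :
    Pol.antipodeLin (algebraMap ℂ (Pol r) c) = algebraMap ℂ (Pol r) c := by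
  simp [Pol.antipodeLin_apply]

@[simp] theorem Pol.antipodeLin_one : Pol.antipodeLin (1 : Pol r) = 1 := by
  simp [Pol.antipodeLin_apply]

theorem Pol.antipode_left (a : Pol r) :
    LinearMap.mul' ℂ (Pol r) (Pol.antipodeLin.rTensor (Pol r) (Coalgebra.comul a)) =
      algebraMap ℂ (Pol r) (Coalgebra.counit a) := by
  have key : ∀ (s : Pol r ⊗[ℂ] Pol r) (u v : Pol r),
      LinearMap.mul' ℂ (Pol r) (Pol.antipodeLin.rTensor (Pol r) (s * (u ⊗ₜ v))) =
        Pol.antipodeLin u * LinearMap.mul' ℂ (Pol r) (Pol.antipodeLin.rTensor (Pol r) s) * v := by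
    intro s u v
    induction s with
    | zero => simp
    | tmul a b => simp [Pol.antipodeLin_mul, mul_assoc]
    | add s t hs ht => simp only [add_mul, map_add, hs, ht, mul_add]
  have key2 : ∀ (c : ℂ) (s t : Pol r ⊗[ℂ] Pol r),
      LinearMap.mul' ℂ (Pol r) (Pol.antipodeLin.rTensor (Pol r) s) = algebraMap ℂ (Pol r) c →
      LinearMap.mul' ℂ (Pol r) (Pol.antipodeLin.rTensor (Pol r) (s * t)) =
        algebraMap ℂ (Pol r) c *
          LinearMap.mul' ℂ (Pol r) (Pol.antipodeLin.rTensor (Pol r) t) := by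
    intro c s t hs
    induction t with
    | zero => simp
    | tmul a b =>
      rw [key, hs, ← Algebra.commutes]
      simp [mul_assoc]
    | add s t hs ht => simp only [mul_add, map_add, hs, ht]
  induction a using Pol.induction with
  | algebraMap c =>
    simp [Algebra.TensorProduct.algebraMap_apply, Pol.antipodeLin_algebraMap]
  | gen i j =>
    have h := congrFun (congrFun hr.transpose_mul i) j
    simp only [Matrix.mul_apply, Matrix.transpose_apply, Matrix.one_apply] at h
    simp only [Pol.comul_gen, map_sum, LinearMap.rTensor_tmul, LinearMap.mul'_apply,
      Pol.antipodeLin_gen, h, Pol.counit_gen]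
    split_ifs <;> simp
  | mul a b ha hb =>
    rw [Bialgebra.comul_mul, key2 _ _ _ ha, hb, Bialgebra.counit_mul, map_mul]
  | add a b ha hb => simp only [map_add, ha, hb]

theorem Pol.antipode_right (a : Pol r) :
    LinearMap.mul' ℂ (Pol r) (Pol.antipodeLin.lTensor (Pol r) (Coalgebra.comul a)) =
      algebraMap ℂ (Pol r) (Coalgebra.counit a) := by
  have key : ∀ (s : Pol r ⊗[ℂ] Pol r) (u v : Pol r),
      LinearMap.mul' ℂ (Pol r) (Pol.antipodeLin.lTensor (Pol r) ((u ⊗ₜ v) * s)) =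
        u * LinearMap.mul' ℂ (Pol r) (Pol.antipodeLin.lTensor (Pol r) s) * Pol.antipodeLin v := by
    intro s u v
    induction s with
    | zero => simp
    | tmul a b => simp [Pol.antipodeLin_mul, mul_assoc]
    | add s t hs ht => simp only [add_mul, map_add, hs, ht, mul_add]
  have key2 : ∀ (c : ℂ) (s t : Pol r ⊗[ℂ] Pol r),
      LinearMap.mul' ℂ (Pol r) (Pol.antipodeLin.lTensor (Pol r) s) = algebraMap ℂ (Pol r) c →
      LinearMap.mul' ℂ (Pol r) (Pol.antipodeLin.lTensor (Pol r) (t * s)) =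
        algebraMap ℂ (Pol r) c *
          LinearMap.mul' ℂ (Pol r) (Pol.antipodeLin.lTensor (Pol r) t) := by
    intro c s t hs
    induction t with
    | zero => simp
    | tmul a b =>
      rw [key, hs, ← Algebra.commutes]
      simp [mul_assoc]
    | add s t hs ht => simp only [mul_add, add_mul, map_add, hs, ht]
  induction a using Pol.induction with
  | algebraMap c =>
    simp [Algebra.TensorProduct.algebraMap_apply]
  | gen i j =>
    have h := congrFun (congrFun hr.mul_transpose i) j
    simp only [Matrix.mul_apply, Matrix.transpose_apply, Matrix.one_apply] at h
    simp only [Pol.comul_gen, map_sum, LinearMap.lTensor_tmul, LinearMap.mul'_apply,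
      Pol.antipodeLin_gen, h, Pol.counit_gen]
    split_ifs <;> simp
  | mul a b ha hb =>
    rw [Bialgebra.comul_mul, key2 _ _ _ hb, ha, Bialgebra.counit_mul, map_mul, Algebra.commutes]
  | add a b ha hb => simp only [map_add, ha, hb]

noncomputable instance : HopfAlgebra ℂ (Pol r) where
  antipode := Pol.antipodeLin
  mul_antipode_rTensor_comul := LinearMap.ext Pol.antipode_left
  mul_antipode_lTensor_comul := LinearMap.ext Pol.antipode_right

/-- The comultiplication is a *-homomorphism. -/
theorem Pol.comul_star (a : Pol r) :
    Coalgebra.comul (R := ℂ) (star a) = star (Coalgebra.comul (R := ℂ) a) := by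
  induction a using Pol.induction with
  | algebraMap c =>
    simp only [Pol.star_algebraMap, Bialgebra.comul_algebraMap,
      Algebra.TensorProduct.algebraMap_apply, TensorProduct.star_tmul, star_one]
  | gen i j => simp
  | mul a b ha hb => simp only [star_mul, Bialgebra.comul_mul, ha, hb]
  | add a b ha hb => simp only [star_add, map_add, ha, hb]

end Hopf

/-! ### The quantum groups `O₋₁(n)` and `SO₋₁(3)` -/

/-- The relations of `O₋₁(n)` for a matrix `u`, apart from self-adjointness: `u` is orthogonal,
distinct entries in one row or in one column anticommute, and entries in distinct rows and distinct
columns commute. -/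
structure IsMinusOneOrthogonal {n : ℕ} {B : Type} [Ring B] (u : Matrix (Fin n) (Fin n) B) :
    Prop where
  mul_transpose : u * u.transpose = 1
  transpose_mul : u.transpose * u = 1
  row : ∀ i j k, j ≠ k → u i j * u i k = -(u i k * u i j)
  col : ∀ i j k, i ≠ k → u i j * u k j = -(u k j * u i j)
  comm : ∀ i j k l, i ≠ k → j ≠ l → u i j * u k l = u k l * u i j

/-- The permanent of a `2 × 2` matrix. -/
def perm2 {B : Type} [Ring B] (u : Matrix (Fin 2) (Fin 2) B) : B :=
  u 0 0 * u 1 1 + u 0 1 * u 1 0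

/-- The permanent of a `3 × 3` matrix. -/
def perm3 {B : Type} [Ring B] (u : Matrix (Fin 3) (Fin 3) B) : B :=
  ∑ σ : Equiv.Perm (Fin 3), u 0 (σ 0) * u 1 (σ 1) * u 2 (σ 2)

/-- The defining relations of `O₋₁(n)` in the free algebra. -/
inductive ORel (n : ℕ) : FreeMat n → FreeMat n → Prop
  | mul_transpose (i j : Fin n) :
      ORel n (∑ k, FreeMat.x i k * FreeMat.x j k) (if i = j then 1 else 0)
  | transpose_mul (i j : Fin n) :
      ORel n (∑ k, FreeMat.x k i * FreeMat.x k j) (if i = j then 1 else 0)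
  | row (i j k : Fin n) (h : j ≠ k) :
      ORel n (FreeMat.x i j * FreeMat.x i k) (-(FreeMat.x i k * FreeMat.x i j))
  | col (i j k : Fin n) (h : i ≠ k) :
      ORel n (FreeMat.x i j * FreeMat.x k j) (-(FreeMat.x k j * FreeMat.x i j))
  | comm (i j k l : Fin n) (h : i ≠ k) (h' : j ≠ l) :
      ORel n (FreeMat.x i j * FreeMat.x k l) (FreeMat.x k l * FreeMat.x i j)

/-- The defining relations of `SO₋₁(3)` in the free algebra: those of `O₋₁(3)`, and the permanent
of the generic matrix is `1`. -/
inductive SORel : FreeMat 3 → FreeMat 3 → Prop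
  | orth (p q : FreeMat 3) (h : ORel 3 p q) : SORel p q
  | perm : SORel (perm3 (Matrix.of fun i j => FreeMat.x i j)) 1

theorem satisfies_ORel_iff {n : ℕ} {B : Type} [Ring B] [Algebra ℂ B]
    (u : Matrix (Fin n) (Fin n) B) : Satisfies (ORel n) u ↔ IsMinusOneOrthogonal u := by
  constructor
  · intro h
    refine ⟨?_, ?_, ?_, ?_, ?_⟩
    · ext i j
      have := h (.mul_transpose i j)
      simp only [map_sum, map_mul, FreeMat.eval_x, apply_ite (FreeMat.eval u), map_one,
        map_zero] at this
      simpa [Matrix.mul_apply, Matrix.one_apply] using this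
    · ext i j
      have := h (.transpose_mul i j)
      simp only [map_sum, map_mul, FreeMat.eval_x, apply_ite (FreeMat.eval u), map_one,
        map_zero] at this
      simpa [Matrix.mul_apply, Matrix.one_apply] using this
    · intro i j k hjk
      simpa using h (.row i j k hjk)
    · intro i j k hik
      simpa using h (.col i j k hik)
    · intro i j k l hik hjl
      simpa using h (.comm i j k l hik hjl)
  · rintro ⟨h1, h2, h3, h4, h5⟩ p q h
    cases h with
    | mul_transpose i j =>
      have := congrFun (congrFun h1 i) j
      simp only [Matrix.mul_apply, Matrix.transpose_apply, Matrix.one_apply] at this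
      simpa only [map_sum, map_mul, FreeMat.eval_x, apply_ite (FreeMat.eval u), map_one,
        map_zero] using this
    | transpose_mul i j =>
      have := congrFun (congrFun h2 i) j
      simp only [Matrix.mul_apply, Matrix.transpose_apply, Matrix.one_apply] at this
      simpa only [map_sum, map_mul, FreeMat.eval_x, apply_ite (FreeMat.eval u), map_one,
        map_zero] using this
    | row i j k h => simpa using h3 i j k h
    | col i j k h => simpa using h4 i j k h
    | comm i j k l h h' => simpa using h5 i j k l h h'

theorem satisfies_SORel_iff {B : Type} [Ring B] [Algebra ℂ B] (u : Matrix (Fin 3) (Fin 3) B) :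
    Satisfies SORel u ↔ IsMinusOneOrthogonal u ∧ perm3 u = 1 := by
  rw [← satisfies_ORel_iff]
  constructor
  · intro h
    refine ⟨fun p q hpq => h (.orth p q hpq), ?_⟩
    simpa [perm3] using h .perm
  · rintro ⟨h1, h2⟩ p q h
    cases h with
    | orth p q h => exact h1 h
    | perm => simpa [perm3] using h2

theorem IsMinusOneOrthogonal.one {n : ℕ} {B : Type} [Ring B] :
    IsMinusOneOrthogonal (1 : Matrix (Fin n) (Fin n) B) := by
  refine ⟨by simp, by simp, ?_, ?_, ?_⟩
  · intro i j k h
    rcases eq_or_ne i j with rfl | h1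
    · simp [Matrix.one_apply_ne h]
    · simp [Matrix.one_apply_ne h1]
  · intro i j k h
    rcases eq_or_ne i j with rfl | h1
    · simp [Matrix.one_apply_ne h.symm]
    · simp [Matrix.one_apply_ne h1]
  · intro i j k l h h'
    rcases eq_or_ne i j with rfl | h1
    · simp
    · simp [Matrix.one_apply_ne h1]

theorem IsMinusOneOrthogonal.op {n : ℕ} {B : Type} [Ring B] {u : Matrix (Fin n) (Fin n) B}
    (h : IsMinusOneOrthogonal u) :
    IsMinusOneOrthogonal (Matrix.of fun i j => MulOpposite.op (u i j)) := by
  refine ⟨?_, ?_, ?_, ?_, ?_⟩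
  · ext i j
    have := congrArg MulOpposite.op (congrFun (congrFun h.mul_transpose j) i)
    simp only [Matrix.mul_apply, Matrix.transpose_apply, Matrix.one_apply, Finset.op_sum,
      MulOpposite.op_mul] at this
    simp only [Matrix.mul_apply, Matrix.transpose_apply, Matrix.one_apply, Matrix.of_apply, this,
      eq_comm (a := i)]
    split_ifs <;> rfl
  · ext i j
    have := congrArg MulOpposite.op (congrFun (congrFun h.transpose_mul j) i)
    simp only [Matrix.mul_apply, Matrix.transpose_apply, Matrix.one_apply, Finset.op_sum,
      MulOpposite.op_mul] at this
    simp only [Matrix.mul_apply, Matrix.transpose_apply, Matrix.one_apply, Matrix.of_apply, this,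
      eq_comm (a := i)]
    split_ifs <;> rfl
  · intro i j k hjk
    exact congrArg MulOpposite.op (h.row i k j hjk.symm)
  · intro i j k hik
    exact congrArg MulOpposite.op (h.col k j i hik.symm)
  · intro i j k l hik hjl
    exact congrArg MulOpposite.op (h.comm k l i j hik.symm hjl.symm)

theorem IsMinusOneOrthogonal.transpose {n : ℕ} {B : Type} [Ring B]
    {u : Matrix (Fin n) (Fin n) B} (h : IsMinusOneOrthogonal u) :
    IsMinusOneOrthogonal u.transpose :=
  ⟨by simpa using h.transpose_mul, by simpa using h.mul_transpose,
    fun i j k hjk => h.col j i k hjk, fun i j k hik => h.row j i k hik,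
    fun i j k l hik hjl => h.comm j i l k hjl hik⟩

theorem IsMinusOneOrthogonal.mul {n : ℕ} {B : Type} [Ring B] {u w : Matrix (Fin n) (Fin n) B}
    (hu : IsMinusOneOrthogonal u) (hw : IsMinusOneOrthogonal w)
    (huw : ∀ i j k l, u i j * w k l = w k l * u i j) : IsMinusOneOrthogonal (u * w) := by
  have ht : (u * w).transpose = w.transpose * u.transpose := by
    ext i j
    simp [Matrix.mul_apply, huw]
  have swap : ∀ i p j k q l, u i p * w p j * (u k q * w q l) = u i p * u k q * (w p j * w q l) := by
    intro i p j k q l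
    rw [mul_assoc, ← mul_assoc (w p j), ← huw, mul_assoc, ← mul_assoc]
  refine ⟨?_, ?_, ?_, ?_, ?_⟩
  · rw [ht, Matrix.mul_assoc, ← Matrix.mul_assoc w, hw.mul_transpose, Matrix.one_mul,
      hu.mul_transpose]
  · rw [ht, Matrix.mul_assoc, ← Matrix.mul_assoc u.transpose, hu.transpose_mul, Matrix.one_mul,
      hw.transpose_mul]
  · intro i j k hjk
    simp only [Matrix.mul_apply, Finset.sum_mul_sum, swap, ← Finset.sum_neg_distrib]
    rw [Finset.sum_comm]
    refine Finset.sum_congr rfl fun p _ => Finset.sum_congr rfl fun q _ => ?_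
    rcases eq_or_ne p q with rfl | hpq
    · rw [hw.row p j k hjk, mul_neg]
    · rw [hu.row i q p hpq.symm, hw.comm q j p k hpq.symm hjk, neg_mul]
  · intro i j k hik
    simp only [Matrix.mul_apply, Finset.sum_mul_sum, swap, ← Finset.sum_neg_distrib]
    rw [Finset.sum_comm]
    refine Finset.sum_congr rfl fun p _ => Finset.sum_congr rfl fun q _ => ?_
    rcases eq_or_ne p q with rfl | hpq
    · rw [hu.col i p k hik, neg_mul]
    · rw [hu.comm i q k p hik hpq.symm, hw.col q j p hpq.symm, mul_neg]
  · intro i j k l hik hjl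
    simp only [Matrix.mul_apply, Finset.sum_mul_sum, swap]
    rw [Finset.sum_comm]
    refine Finset.sum_congr rfl fun p _ => Finset.sum_congr rfl fun q _ => ?_
    rcases eq_or_ne p q with rfl | hpq
    · rw [hu.col i p k hik, hw.row p j l hjl, neg_mul_neg]
    · rw [hu.comm i q k p hik hpq.symm, hw.comm q j p l hpq.symm hjl]

theorem perm3_eq {B : Type} [Ring B] (u : Matrix (Fin 3) (Fin 3) B) :
    perm3 u = u 0 0 * u 1 1 * u 2 2 + u 0 0 * u 1 2 * u 2 1 + u 0 1 * u 1 0 * u 2 2 +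
      u 0 1 * u 1 2 * u 2 0 + u 0 2 * u 1 0 * u 2 1 + u 0 2 * u 1 1 * u 2 0 := by
  have h : (Finset.univ : Finset (Equiv.Perm (Fin 3))) =
      {1, Equiv.swap 1 2, Equiv.swap 0 1, finRotate 3, (finRotate 3)⁻¹, Equiv.swap 0 2} := by
    decide
  rw [perm3, h, Finset.sum_insert (by decide), Finset.sum_insert (by decide),
    Finset.sum_insert (by decide), Finset.sum_insert (by decide), Finset.sum_insert (by decide),
    Finset.sum_singleton]
  have e1 : Equiv.swap (1 : Fin 3) 2 0 = 0 := by decide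
  have e2 : Equiv.swap (0 : Fin 3) 1 2 = 2 := by decide
  have e3 : Equiv.swap (0 : Fin 3) 2 1 = 1 := by decide
  have f0 : finRotate 3 0 = 1 := by decide
  have f1 : finRotate 3 1 = 2 := by decide
  have f2 : finRotate 3 2 = 0 := by decide
  have g0 : (finRotate 3)⁻¹ 0 = 2 := by decide
  have g1 : (finRotate 3)⁻¹ 1 = 0 := by decide
  have g2 : (finRotate 3)⁻¹ 2 = 1 := by decide
  simp only [e1, e2, e3, f0, f1, f2, g0, g1, g2, Equiv.swap_apply_left, Equiv.swap_apply_right,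
    Equiv.Perm.one_apply]
  abel

theorem perm3_one {B : Type} [Ring B] : perm3 (1 : Matrix (Fin 3) (Fin 3) B) = 1 := by
  simp [perm3_eq]

theorem perm3_transpose {B : Type} [Ring B] {u : Matrix (Fin 3) (Fin 3) B}
    (h : IsMinusOneOrthogonal u) : perm3 u.transpose = perm3 u := by
  have key : u 1 0 * u 2 1 * u 0 2 = u 0 2 * u 1 0 * u 2 1 := by
    rw [mul_assoc, h.comm 2 1 0 2 (by decide) (by decide), ← mul_assoc,
      h.comm 1 0 0 2 (by decide) (by decide)]
  have key2 : u 2 0 * u 0 1 * u 1 2 = u 0 1 * u 1 2 * u 2 0 := by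
    rw [h.comm 2 0 0 1 (by decide) (by decide), mul_assoc,
      h.comm 2 0 1 2 (by decide) (by decide), ← mul_assoc]
  have k3 : u 0 0 * u 2 1 * u 1 2 = u 0 0 * u 1 2 * u 2 1 := by
    rw [mul_assoc, h.comm 2 1 1 2 (by decide) (by decide), ← mul_assoc]
  have k4 : u 1 0 * u 0 1 * u 2 2 = u 0 1 * u 1 0 * u 2 2 := by
    rw [h.comm 1 0 0 1 (by decide) (by decide)]
  have k5 : u 2 0 * u 1 1 * u 0 2 = u 0 2 * u 1 1 * u 2 0 := by
    rw [h.comm 2 0 1 1 (by decide) (by decide), mul_assoc,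
      h.comm 2 0 0 2 (by decide) (by decide), ← mul_assoc,
      h.comm 1 1 0 2 (by decide) (by decide)]
  simp only [perm3_eq, Matrix.transpose_apply, key, key2, k3, k4, k5]
  abel

theorem perm3_op {B : Type} [Ring B] {u : Matrix (Fin 3) (Fin 3) B}
    (h : IsMinusOneOrthogonal u) :
    perm3 (Matrix.of fun i j => MulOpposite.op (u i j)) = MulOpposite.op (perm3 u) := by
  rw [perm3, perm3, ← MulOpposite.opAddEquiv_apply, map_sum]
  refine Finset.sum_congr rfl fun σ _ => ?_
  have hσ : ∀ i j, i ≠ j → σ i ≠ σ j := fun i j hij => σ.injective.ne hij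
  simp only [Matrix.of_apply, ← MulOpposite.op_mul, MulOpposite.opAddEquiv_apply]
  congr 1
  rw [← mul_assoc, h.comm 2 _ 1 _ (by decide) (hσ 2 1 (by decide)), mul_assoc,
    h.comm 2 _ 0 _ (by decide) (hσ 2 0 (by decide)), ← mul_assoc,
    h.comm 1 _ 0 _ (by decide) (hσ 1 0 (by decide))]

/-- The permanent with respect to a choice of rows. -/
def rowPerm {B : Type} [Ring B] (w : Matrix (Fin 3) (Fin 3) B) (p q s : Fin 3) : B :=
  ∑ σ : Equiv.Perm (Fin 3), w p (σ 0) * w q (σ 1) * w s (σ 2)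

theorem rowPerm_swap01 {B : Type} [Ring B] {w : Matrix (Fin 3) (Fin 3) B}
    (h : IsMinusOneOrthogonal w) (p q s : Fin 3) (hpq : p ≠ q) : rowPerm w q p s = rowPerm w p q s := by
  rw [rowPerm, rowPerm, ← Equiv.sum_comp (Equiv.mulRight (Equiv.swap (0 : Fin 3) 1))]
  refine Finset.sum_congr rfl fun σ _ => ?_
  have e : Equiv.swap (0 : Fin 3) 1 2 = 2 := by decide
  simp only [Equiv.coe_mulRight, Equiv.Perm.mul_apply, Equiv.swap_apply_left,
    Equiv.swap_apply_right, e]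
  rw [h.comm p _ q _ hpq (σ.injective.ne (by decide))]

theorem rowPerm_swap12 {B : Type} [Ring B] {w : Matrix (Fin 3) (Fin 3) B}
    (h : IsMinusOneOrthogonal w) (p q s : Fin 3) (hqs : q ≠ s) : rowPerm w p s q = rowPerm w p q s := by
  rw [rowPerm, rowPerm, ← Equiv.sum_comp (Equiv.mulRight (Equiv.swap (1 : Fin 3) 2))]
  refine Finset.sum_congr rfl fun σ _ => ?_
  have e : Equiv.swap (1 : Fin 3) 2 0 = 0 := by decide
  simp only [Equiv.coe_mulRight, Equiv.Perm.mul_apply, Equiv.swap_apply_left,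
    Equiv.swap_apply_right, e]
  rw [mul_assoc, mul_assoc, h.comm q _ s _ hqs (σ.injective.ne (by decide))]

theorem rowPerm_01 {B : Type} [Ring B] [Algebra ℂ B] {w : Matrix (Fin 3) (Fin 3) B}
    (h : IsMinusOneOrthogonal w) (p s : Fin 3) : rowPerm w p p s = 0 := by
  have : rowPerm w p p s = -rowPerm w p p s := by
    conv_lhs => rw [rowPerm, ← Equiv.sum_comp (Equiv.mulRight (Equiv.swap (0 : Fin 3) 1))]
    rw [rowPerm, ← Finset.sum_neg_distrib]
    refine Finset.sum_congr rfl fun σ _ => ?_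
    have e : Equiv.swap (0 : Fin 3) 1 2 = 2 := by decide
    simp only [Equiv.coe_mulRight, Equiv.Perm.mul_apply, Equiv.swap_apply_left,
      Equiv.swap_apply_right, e]
    rw [h.row p (σ 1) (σ 0) (σ.injective.ne (by decide)), neg_mul]
  have h2 : (2 : ℂ) • rowPerm w p p s = 0 := by
    rw [two_smul]
    nth_rewrite 1 [this]
    exact neg_add_cancel _
  exact (smul_eq_zero_iff_right two_ne_zero).mp h2

theorem rowPerm_12 {B : Type} [Ring B] [Algebra ℂ B] {w : Matrix (Fin 3) (Fin 3) B}
    (h : IsMinusOneOrthogonal w) (p s : Fin 3) : rowPerm w p s s = 0 := by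
  have : rowPerm w p s s = -rowPerm w p s s := by
    conv_lhs => rw [rowPerm, ← Equiv.sum_comp (Equiv.mulRight (Equiv.swap (1 : Fin 3) 2))]
    rw [rowPerm, ← Finset.sum_neg_distrib]
    refine Finset.sum_congr rfl fun σ _ => ?_
    have e : Equiv.swap (1 : Fin 3) 2 0 = 0 := by decide
    simp only [Equiv.coe_mulRight, Equiv.Perm.mul_apply, Equiv.swap_apply_left,
      Equiv.swap_apply_right, e]
    rw [mul_assoc, mul_assoc, h.row s (σ 2) (σ 1) (σ.injective.ne (by decide)), mul_neg]
  have h2 : (2 : ℂ) • rowPerm w p s s = 0 := by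
    rw [two_smul]
    nth_rewrite 1 [this]
    exact neg_add_cancel _
  exact (smul_eq_zero_iff_right two_ne_zero).mp h2

theorem rowPerm_02 {B : Type} [Ring B] [Algebra ℂ B] {w : Matrix (Fin 3) (Fin 3) B}
    (h : IsMinusOneOrthogonal w) (p s : Fin 3) : rowPerm w p s p = 0 := by
  rcases eq_or_ne p s with rfl | hps
  · exact rowPerm_01 h p p
  · rw [← rowPerm_swap01 h p s p hps, rowPerm_12 h]

theorem rowPerm_eq {B : Type} [Ring B] [Algebra ℂ B] {w : Matrix (Fin 3) (Fin 3) B}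
    (h : IsMinusOneOrthogonal w) (p q s : Fin 3) (hpq : p ≠ q) (hps : p ≠ s) (hqs : q ≠ s) :
    rowPerm w p q s = perm3 w := by
  have e : rowPerm w 0 1 2 = perm3 w := rfl
  have e1 : rowPerm w 0 2 1 = perm3 w := by rw [rowPerm_swap12 h 0 1 2 (by decide), e]
  have e2 : rowPerm w 1 0 2 = perm3 w := by rw [rowPerm_swap01 h 0 1 2 (by decide), e]
  have e3 : rowPerm w 1 2 0 = perm3 w := by rw [rowPerm_swap12 h 1 0 2 (by decide), e2]
  have e4 : rowPerm w 2 0 1 = perm3 w := by rw [rowPerm_swap01 h 0 2 1 (by decide), e1]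
  have e5 : rowPerm w 2 1 0 = perm3 w := by rw [rowPerm_swap01 h 1 2 0 (by decide), e3]
  fin_cases p <;> fin_cases q <;> fin_cases s <;>
    first | exact absurd rfl hpq | exact absurd rfl hps | exact absurd rfl hqs | exact e |
      exact e1 | exact e2 | exact e3 | exact e4 | exact e5

theorem perm3_mul {B : Type} [Ring B] [Algebra ℂ B] {w : Matrix (Fin 3) (Fin 3) B}
    (h : IsMinusOneOrthogonal w) {u : Matrix (Fin 3) (Fin 3) B}
    (huw : ∀ i j k l, u i j * w k l = w k l * u i j) : perm3 (u * w) = perm3 u * perm3 w := by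
  have step : perm3 (u * w) =
      ∑ p, ∑ q, ∑ s, u 0 p * u 1 q * u 2 s * rowPerm w p q s := by
    have e : ∀ a b c a' b' c' : B, a' * b = b * a' → a' * c = c * a' → b' * c = c * b' →
        a * a' * (b * b') * (c * c') = a * b * c * (a' * b' * c') := by
      intro a b c a' b' c' h1 h2 h3
      calc a * a' * (b * b') * (c * c') = a * (a' * b) * (b' * c) * c' := by
            simp only [mul_assoc]
        _ = a * b * (a' * c) * b' * c' := by rw [h1, h3]; simp only [mul_assoc]
        _ = a * b * c * (a' * b' * c') := by rw [h2]; simp only [mul_assoc]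
    have e1 : ∀ σ : Equiv.Perm (Fin 3), (u * w) 0 (σ 0) * (u * w) 1 (σ 1) * (u * w) 2 (σ 2) =
        ∑ p, ∑ q, ∑ s, u 0 p * u 1 q * u 2 s * (w p (σ 0) * w q (σ 1) * w s (σ 2)) := by
      intro σ
      simp only [Matrix.mul_apply]
      rw [Finset.sum_mul_sum, Finset.sum_mul]
      refine Finset.sum_congr rfl fun p _ => ?_
      rw [Finset.sum_mul]
      refine Finset.sum_congr rfl fun q _ => ?_
      rw [Finset.mul_sum]
      exact Finset.sum_congr rfl fun s _ =>
        e _ _ _ _ _ _ (huw _ _ _ _).symm (huw _ _ _ _).symm (huw _ _ _ _).symm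
    rw [perm3, Finset.sum_congr rfl fun σ _ => e1 σ, Finset.sum_comm]
    refine Finset.sum_congr rfl fun p _ => ?_
    rw [Finset.sum_comm]
    refine Finset.sum_congr rfl fun q _ => ?_
    rw [Finset.sum_comm]
    exact Finset.sum_congr rfl fun s _ => by rw [rowPerm, Finset.mul_sum]
  rw [step, perm3_eq u]
  simp only [Fin.sum_univ_three, rowPerm_01 h, rowPerm_12 h, rowPerm_02 h]
  rw [rowPerm_eq h 0 1 2, rowPerm_eq h 0 2 1, rowPerm_eq h 1 0 2, rowPerm_eq h 1 2 0,
    rowPerm_eq h 2 0 1, rowPerm_eq h 2 1 0]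
  · simp only [mul_zero, add_zero, zero_add, add_mul]
    abel
  all_goals decide

/-! ### The Hopf *-algebras -/

theorem IsMinusOneOrthogonal.tensor {n : ℕ} {A : Type} [Ring A] [Algebra ℂ A]
    {u : Matrix (Fin n) (Fin n) A} (h : IsMinusOneOrthogonal u) :
    IsMinusOneOrthogonal (Matrix.of fun i j => u i j ⊗ₜ[ℂ] (1 : A)) ∧
      IsMinusOneOrthogonal (Matrix.of fun i j => (1 : A) ⊗ₜ[ℂ] u i j) := by
  have map : ∀ f : A →ₐ[ℂ] A ⊗[ℂ] A, IsMinusOneOrthogonal (Matrix.of fun i j => f (u i j)) := by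
    intro f
    refine ⟨?_, ?_, ?_, ?_, ?_⟩
    · ext i j
      have := congrArg f (congrFun (congrFun h.mul_transpose i) j)
      simp only [Matrix.mul_apply, Matrix.transpose_apply, Matrix.one_apply, map_sum, map_mul,
        apply_ite f, map_one, map_zero] at this
      simpa only [Matrix.mul_apply, Matrix.transpose_apply, Matrix.one_apply, Matrix.of_apply]
        using this
    · ext i j
      have := congrArg f (congrFun (congrFun h.transpose_mul i) j)
      simp only [Matrix.mul_apply, Matrix.transpose_apply, Matrix.one_apply, map_sum, map_mul,
        apply_ite f, map_one, map_zero] at this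
      simpa only [Matrix.mul_apply, Matrix.transpose_apply, Matrix.one_apply, Matrix.of_apply]
        using this
    · intro i j k hjk
      simpa using congrArg f (h.row i j k hjk)
    · intro i j k hik
      simpa using congrArg f (h.col i j k hik)
    · intro i j k l hik hjl
      simpa using congrArg f (h.comm i j k l hik hjl)
  exact ⟨map Algebra.TensorProduct.includeLeft, map Algebra.TensorProduct.includeRight⟩

theorem tensor_mul_eq {n : ℕ} {A : Type} [Ring A] [Algebra ℂ A] (u : Matrix (Fin n) (Fin n) A) :
    (Matrix.of fun i j => ∑ k, u i k ⊗ₜ[ℂ] u k j) =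
      (Matrix.of fun i j => u i j ⊗ₜ[ℂ] (1 : A)) * Matrix.of fun i j => (1 : A) ⊗ₜ[ℂ] u i j := by
  ext i j
  simp [Matrix.mul_apply]

theorem ORel.isMinusOneOrthogonal (n : ℕ) : IsMinusOneOrthogonal (Pol.gen (ORel n)) :=
  (satisfies_ORel_iff _).1 (Pol.satisfies_gen _)

theorem SORel.isMinusOneOrthogonal : IsMinusOneOrthogonal (Pol.gen SORel) :=
  ((satisfies_SORel_iff _).1 (Pol.satisfies_gen _)).1

theorem SORel.perm3_gen : perm3 (Pol.gen SORel) = 1 :=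
  ((satisfies_SORel_iff _).1 (Pol.satisfies_gen _)).2

instance (n : ℕ) : IsHopfRel (ORel n) where
  star := (satisfies_ORel_iff _).2 (ORel.isMinusOneOrthogonal n).op
  comul := by
    rw [satisfies_ORel_iff, tensor_mul_eq]
    obtain ⟨h1, h2⟩ := (ORel.isMinusOneOrthogonal n).tensor
    exact h1.mul h2 fun i j k l => by simp
  counit := (satisfies_ORel_iff _).2 .one
  antipode := (satisfies_ORel_iff _).2 (ORel.isMinusOneOrthogonal n).transpose.op
  mul_transpose := (ORel.isMinusOneOrthogonal n).mul_transpose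
  transpose_mul := (ORel.isMinusOneOrthogonal n).transpose_mul

instance : IsHopfRel SORel where
  star := (satisfies_SORel_iff _).2 ⟨SORel.isMinusOneOrthogonal.op,
    (perm3_op SORel.isMinusOneOrthogonal).trans (congrArg MulOpposite.op SORel.perm3_gen)⟩
  comul := by
    rw [satisfies_SORel_iff, tensor_mul_eq]
    obtain ⟨h1, h2⟩ := SORel.isMinusOneOrthogonal.tensor
    refine ⟨h1.mul h2 fun i j k l => by simp, ?_⟩
    have e1 : perm3 (Matrix.of fun i j => Pol.gen SORel i j ⊗ₜ[ℂ] (1 : Pol SORel)) = 1 := by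
      have := congrArg (fun a => a ⊗ₜ[ℂ] (1 : Pol SORel)) SORel.perm3_gen
      simpa [perm3, TensorProduct.sum_tmul, Algebra.TensorProduct.one_def] using this
    have e2 : perm3 (Matrix.of fun i j => (1 : Pol SORel) ⊗ₜ[ℂ] Pol.gen SORel i j) = 1 := by
      have := congrArg (fun a => (1 : Pol SORel) ⊗ₜ[ℂ] a) SORel.perm3_gen
      simpa [perm3, TensorProduct.tmul_sum, Algebra.TensorProduct.one_def] using this
    rw [perm3_mul h2 fun i j k l => by simp, e1, e2, mul_one]
  counit := (satisfies_SORel_iff _).2 ⟨.one, perm3_one⟩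
  antipode := (satisfies_SORel_iff _).2 ⟨SORel.isMinusOneOrthogonal.transpose.op,
    (perm3_op SORel.isMinusOneOrthogonal.transpose).trans (congrArg MulOpposite.op
      ((perm3_transpose SORel.isMinusOneOrthogonal).trans SORel.perm3_gen))⟩
  mul_transpose := SORel.isMinusOneOrthogonal.mul_transpose
  transpose_mul := SORel.isMinusOneOrthogonal.transpose_mul

/-- The coordinate Hopf *-algebra of the quantum group `O₋₁(2)`. -/
abbrev PolO2 : Type := Pol (ORel 2)

/-- The coordinate Hopf *-algebra of the quantum group `SO₋₁(3)`. -/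
abbrev PolSO3 : Type := Pol SORel

/-! ### Quantum subgroups -/

/-- A *-homomorphism of coordinate Hopf *-algebras that intertwines the comultiplications
(it then also intertwines counits and antipodes): a Hopf *-homomorphism. -/
def IsHopfHom {m n : ℕ} {r : FreeMat m → FreeMat m → Prop} {s : FreeMat n → FreeMat n → Prop}
    [IsHopfRel r] [IsHopfRel s] (f : Pol r →⋆ₐ[ℂ] Pol s) : Prop :=
  ∀ a : Pol r, Coalgebra.comul (R := ℂ) (f a) =
    TensorProduct.map f.toAlgHom.toLinearMap f.toAlgHom.toLinearMap (Coalgebra.comul (R := ℂ) a)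

/-- An embedding `O₋₁(2) ⊂ SO₋₁(3)` of quantum groups: a surjective Hopf *-homomorphism
`Pol(SO₋₁(3)) → Pol(O₋₁(2))`. -/
structure IsEmbedding (f : PolSO3 →⋆ₐ[ℂ] PolO2) : Prop where
  surjective : Function.Surjective f
  isHopfHom : IsHopfHom f

/-- The copies of `O₋₁(2)` in `SO₋₁(3)`. Two embeddings have the same image as quantum subgroups
(that is, they differ by an automorphism of `O₋₁(2)`) exactly if their kernels, as homomorphisms
of coordinate algebras, are equal; a copy is represented by this kernel. -/
def copies : Set (Ideal PolSO3) :=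
  {I | ∃ f : PolSO3 →⋆ₐ[ℂ] PolO2, IsEmbedding f ∧ I = RingHom.ker f}

/-- An orthonormal basis of the orthogonal complement of `(1, 1, 1, 1)` (the rows), in which the
Klein group of double transpositions acts by diagonal matrices. -/
noncomputable def kleinBasis : Matrix (Fin 3) (Fin 4) ℂ :=
  (1 / 2 : ℂ) • !![1, -1, 1, -1; 1, 1, -1, -1; 1, -1, -1, 1]

/-- The embedding `ρ` of `S₄` in `O(3)`: the permutation representation on the orthogonal
complement of `(1, 1, 1, 1)`. The `(i, j)` entry is the inner product of the `i`-th basis vector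
and of `x` applied to the `j`-th, where `x` sends the `k`-th standard vector to the `x k`-th. -/
noncomputable def rho (x : Equiv.Perm (Fin 4)) : Matrix (Fin 3) (Fin 3) ℂ :=
  Matrix.of fun i j => ∑ k, kleinBasis i (x k) * kleinBasis j k

/-- The matrix `ρ(x)` with entries regarded as scalars in the algebra `B`. -/
noncomputable def rhoIn (B : Type) [Ring B] [Algebra ℂ B] (x : Equiv.Perm (Fin 4)) :
    Matrix (Fin 3) (Fin 3) B :=
  (rho x).map (algebraMap ℂ B)

/-- The block diagonal matrix with blocks `u` and the permanent of `u`. -/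
def blockPerm {B : Type} [Ring B] (u : Matrix (Fin 2) (Fin 2) B) : Matrix (Fin 3) (Fin 3) B :=
  !![u 0 0, u 0 1, 0; u 1 0, u 1 1, 0; 0, 0, perm2 u]

/-- On generators, `f` is `A ↦ ρ(x) diag(Ã, perm(Ã)) ρ(x)ᵀ`. -/
def IsStandard (x : Equiv.Perm (Fin 4)) (f : PolSO3 →⋆ₐ[ℂ] PolO2) : Prop :=
  (Pol.gen SORel).map f =
    rhoIn PolO2 x * blockPerm (Pol.gen (ORel 2)) * (rhoIn PolO2 x).transpose

/-- `θ` is the automorphism `A ↦ ρ(x)ᵀ A ρ(x)` of `SO₋₁(3)`. -/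
structure IsInnerAut (x : Equiv.Perm (Fin 4)) (θ : PolSO3 ≃⋆ₐ[ℂ] PolSO3) : Prop where
  isHopfHom : IsHopfHom (θ : PolSO3 →⋆ₐ[ℂ] PolSO3)
  map_gen : (Pol.gen SORel).map θ =
    (rhoIn PolSO3 x).transpose * Pol.gen SORel * rhoIn PolSO3 x

end MinusOne

/-! The matrices `ρ(x)` are the signed permutation matrices of permanent one. They are scalar
solutions of the relations of `SO₋₁(3)`, so conjugation by them preserves all relations. In
`Pol(O₋₁(2))` the element `p = perm(Ã)` is central, group-like and satisfies `p² = 1`, so `diag(Ã,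
p)` is a corepresentation with the required relations and permanent `p² = 1`. This yields the
standard embeddings, which form one orbit under the inner automorphisms. The kernel of the embedding
for `x` depends only on the coordinate axis to which `ρ(x)` moves the third axis, and distinct axes
give distinct kernels (`ker_standardHom_eq`, `ker_standardHom_ne`); hence three copies.

The hard part is that every embedding is standard. The central idempotents `(1 ± p)/2` split
`Pol(O₋₁(2))` into two copies of the group algebra of the infinite dihedral group, with `s, t` the
sum and difference of the entries of the first row of `Ã`; only joint injectivity of the two
projections is used (`GrpAlg.hom_ext`). Let `u` be the image of the generic matrix, with coefficient
matrices `P g` and `Q g` at a group element `g` in the two copies. Since the comultiplication mixes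
the copies through the automorphism `τ` that exchanges `s` and `t`, the corepresentation condition
says that the `P g` are mutually orthogonal idempotents with sum one and that the involution `T = ∑
Q g` carries `P g` to `P (τ g)` (`coeffMat_mul`, `CoeffTable`).

As `τ` fixes only the identity and the matrices have size three, either only `P 1` is nonzero or the
support is `{g, τ g, 1}` with rank one each (`CoeffTable.support`). Surjectivity, tested in dihedral
quotients, excludes the first case and forces `{g, τ g} = {s, t}` (`twist_eq_of_commute`).
Orthogonality makes the three idempotents symmetric, hence of the form `vvᵀ, wwᵀ, nnᵀ`; the
relations then force `n` to be a coordinate vector and `v, w` to be `(1, ±1)/√2` in the other two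
coordinates, up to signs (`exists_perm_vectors`). Finally `T` is diagonal, the permanent fixes its
last sign, and `u` is `diag(Ã, p)` conjugated by a signed permutation matrix of permanent one. -/

namespace MinusOne

/-! ### The matrices `ρ(x)` -/

/-- Twice the matrix `kleinBasis`, with integer entries. -/
def kleinInt : Matrix (Fin 3) (Fin 4) ℤ := !![1, -1, 1, -1; 1, 1, -1, -1; 1, -1, -1, 1]

/-- Four times the matrix `ρ(x)`, with integer entries. -/
def rhoInt (x : Equiv.Perm (Fin 4)) : Matrix (Fin 3) (Fin 3) ℤ :=
  Matrix.of fun i j => ∑ k, kleinInt i (x k) * kleinInt j k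

theorem kleinBasis_apply (i : Fin 3) (k : Fin 4) : kleinBasis i k = (kleinInt i k : ℂ) / 2 := by
  fin_cases i <;> fin_cases k <;> simp [kleinBasis, kleinInt, neg_div]

theorem rho_apply (x : Equiv.Perm (Fin 4)) (i j : Fin 3) : rho x i j = (rhoInt x i j : ℂ) / 4 := by
  simp only [rho, rhoInt, Matrix.of_apply, kleinBasis_apply, Int.cast_sum, Int.cast_mul,
    Finset.sum_div]
  exact Finset.sum_congr rfl fun k _ => by ring

/-- The basis vectors are eigenvectors for the three nontrivial characters of the Klein group, which
is normal in `S₄`; so `ρ(x)` permutes the three lines. Scaling by four makes this a finite check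
over the integers. -/
theorem rhoInt_row : ∀ (x : Equiv.Perm (Fin 4)) (i j k : Fin 3), j ≠ k →
    rhoInt x i j * rhoInt x i k = 0 := by
  decide +kernel

/-- The permanent of a signed permutation matrix is the product of its signs; `64 = 4³` comes from
the scaling. -/
theorem perm3_rhoInt : ∀ x : Equiv.Perm (Fin 4), perm3 (rhoInt x) = 64 := by
  simp only [perm3_eq]
  decide +kernel

/-- Every signed permutation matrix with signs `1, 1, 1` or `1, -1, -1` is one of the matrices
`ρ(x)`. -/
theorem exists_rhoInt_eq : ∀ (σ : Equiv.Perm (Fin 3)) (b : Bool), ∃ x : Equiv.Perm (Fin 4),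
    rhoInt x = Matrix.of fun i j => if i = σ j then (bif b || j == 0 then 4 else -4) else 0 := by
  decide +kernel

/-- Source of the index `m` that tells the three kernels apart; `16` is the square of the scaling
factor. -/
theorem rhoInt_last : ∀ x : Equiv.Perm (Fin 4), ∃ m : Fin 3, ∀ i : Fin 3,
    (i = m → rhoInt x i 2 * rhoInt x i 2 = 16) ∧ (i ≠ m → rhoInt x i 2 = 0) := by
  decide +kernel

theorem rho_row (x : Equiv.Perm (Fin 4)) {i j k : Fin 3} (h : j ≠ k) :
    rho x i j * rho x i k = 0 := by
  have := congrArg (Int.cast : ℤ → ℂ) (rhoInt_row x i j k h)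
  push_cast at this
  rw [rho_apply, rho_apply, div_mul_div_comm, this, zero_div]

theorem perm3_rho (x : Equiv.Perm (Fin 4)) : perm3 (rho x) = 1 := by
  have := congrArg (Int.cast : ℤ → ℂ) (perm3_rhoInt x)
  rw [perm3_eq] at this ⊢
  push_cast at this
  simp only [rho_apply]
  linear_combination this / 64

theorem rho_transpose (x : Equiv.Perm (Fin 4)) : (rho x).transpose = rho x⁻¹ := by
  ext i j
  simp only [rho, Matrix.transpose_apply, Matrix.of_apply]
  rw [← Equiv.sum_comp x⁻¹]
  simp [mul_comm]

theorem rho_col (x : Equiv.Perm (Fin 4)) {i j k : Fin 3} (h : j ≠ k) :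
    rho x j i * rho x k i = 0 := by
  have := rho_row x⁻¹ (i := i) h
  rwa [← rho_transpose] at this

/-- The rows are an orthonormal basis of the complement of `(1,1,1,1)`, so the sum is the projection
`1 - J/4`, with `J` the all-ones matrix. -/
theorem sum_kleinBasis_mul_kleinBasis (k l : Fin 4) :
    ∑ j, kleinBasis j k * kleinBasis j l = (if k = l then 1 else 0) - 1 / 4 := by
  fin_cases k <;> fin_cases l <;>
    (simp [kleinBasis_apply, kleinInt, Fin.sum_univ_three]; norm_num)

theorem sum_kleinBasis (i : Fin 3) : ∑ k, kleinBasis i k = 0 := by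
  fin_cases i <;> simp [kleinBasis_apply, kleinInt, Fin.sum_univ_four] <;> norm_num

/-- The sum over the inner index inserts the projection `1 - J/4`; the `J` term dies because each
basis vector has coordinate sum zero. -/
theorem rho_mul (x y : Equiv.Perm (Fin 4)) : rho (x * y) = rho x * rho y := by
  ext i j
  have h : ∀ k l, ∑ p, kleinBasis i (x k) * kleinBasis p k * (kleinBasis p (y l) * kleinBasis j l) =
      kleinBasis i (x k) * kleinBasis j l * ((if k = y l then 1 else 0) - 1 / 4) := by
    intro k l
    rw [← sum_kleinBasis_mul_kleinBasis, Finset.mul_sum]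
    exact Finset.sum_congr rfl fun p _ => by ring
  simp only [rho, Matrix.mul_apply, Matrix.of_apply, Finset.sum_mul_sum]
  rw [Finset.sum_comm]
  simp_rw [Finset.sum_comm (s := Finset.univ (α := Fin 3)), h, mul_sub, Finset.sum_sub_distrib,
    ← Finset.sum_mul, ← Finset.mul_sum, sum_kleinBasis]
  rw [Finset.sum_comm]
  simp

theorem rho_one : rho 1 = 1 := by
  ext i j
  fin_cases i <;> fin_cases j <;>
    simp [rho, kleinBasis_apply, kleinInt, Fin.sum_univ_four] <;> norm_num

theorem rho_mul_transpose (x : Equiv.Perm (Fin 4)) : rho x * (rho x).transpose = 1 := by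
  rw [rho_transpose, ← rho_mul, mul_inv_cancel, rho_one]

theorem rho_transpose_mul (x : Equiv.Perm (Fin 4)) : (rho x).transpose * rho x = 1 := by
  rw [rho_transpose, ← rho_mul, inv_mul_cancel, rho_one]

/-- For a monomial matrix, anticommutation within a row or column holds because the products vanish.
-/
theorem isMinusOneOrthogonal_rho (x : Equiv.Perm (Fin 4)) : IsMinusOneOrthogonal (rho x) where
  mul_transpose := rho_mul_transpose x
  transpose_mul := rho_transpose_mul x
  row i j k h := by rw [rho_row x h, rho_row x h.symm, neg_zero]
  col i j k h := by rw [rho_col x h, rho_col x h.symm, neg_zero]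
  comm i j k l _ _ := mul_comm _ _

theorem IsMinusOneOrthogonal.map {n : ℕ} {B C : Type} [Ring B] [Ring C] (f : B →+* C)
    {u : Matrix (Fin n) (Fin n) B} (h : IsMinusOneOrthogonal u) :
    IsMinusOneOrthogonal (u.map f) where
  mul_transpose := by
    rw [← Matrix.transpose_map, ← Matrix.map_mul, h.mul_transpose, Matrix.map_one _ f.map_zero f.map_one]
  transpose_mul := by
    rw [← Matrix.transpose_map, ← Matrix.map_mul, h.transpose_mul, Matrix.map_one _ f.map_zero f.map_one]
  row i j k hjk := by simpa using congrArg f (h.row i j k hjk)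
  col i j k hik := by simpa using congrArg f (h.col i j k hik)
  comm i j k l hik hjl := by simpa using congrArg f (h.comm i j k l hik hjl)

theorem perm3_map {B C : Type} [Ring B] [Ring C] (f : B →+* C) (u : Matrix (Fin 3) (Fin 3) B) :
    perm3 (u.map f) = f (perm3 u) := by
  simp [perm3]

section rhoIn

variable (B : Type) [Ring B] [Algebra ℂ B] (x y : Equiv.Perm (Fin 4))

theorem rhoIn_mul : rhoIn B (x * y) = rhoIn B x * rhoIn B y := by
  rw [rhoIn, rho_mul, Matrix.map_mul]
  rfl

theorem rhoIn_one : rhoIn B 1 = 1 := by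
  rw [rhoIn, rho_one, Matrix.map_one _ (map_zero _) (map_one _)]

theorem rhoIn_transpose : (rhoIn B x).transpose = rhoIn B x⁻¹ := by
  rw [rhoIn, ← Matrix.transpose_map, rho_transpose]
  rfl

theorem isMinusOneOrthogonal_rhoIn : IsMinusOneOrthogonal (rhoIn B x) :=
  (isMinusOneOrthogonal_rho x).map (algebraMap ℂ B)

theorem perm3_rhoIn : perm3 (rhoIn B x) = 1 := by
  rw [← map_one (algebraMap ℂ B), ← perm3_rho x]
  exact perm3_map (algebraMap ℂ B) _

variable {B}

theorem rhoIn_commutes (i j : Fin 3) (b : B) : rhoIn B x i j * b = b * rhoIn B x i j :=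
  Algebra.commutes _ _

theorem rhoIn_map {C : Type} [Ring C] [Algebra ℂ C] (f : B →ₐ[ℂ] C) :
    (rhoIn B x).map f = rhoIn C x := by
  ext i j
  simp [rhoIn]

theorem conj_rhoIn_apply (u : Matrix (Fin 3) (Fin 3) B) (i j : Fin 3) :
    (rhoIn B x * u * (rhoIn B x).transpose) i j =
      ∑ l, ∑ k, (rho x i k * rho x j l) • u k l := by
  simp only [Matrix.mul_apply, Finset.sum_mul, Matrix.transpose_apply]
  refine Finset.sum_congr rfl fun l _ => Finset.sum_congr rfl fun k _ => ?_
  rw [mul_assoc, ← rhoIn_commutes, ← mul_assoc]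
  simp [rhoIn, ← map_mul, Algebra.smul_def]

variable {u : Matrix (Fin 3) (Fin 3) B}

/-- Solutions with mutually commuting entries can be multiplied, and the entries of `ρ(x)` are
central scalars. -/
theorem IsMinusOneOrthogonal.conj_rhoIn (h : IsMinusOneOrthogonal u) :
    IsMinusOneOrthogonal (rhoIn B x * u * (rhoIn B x).transpose) := by
  refine IsMinusOneOrthogonal.mul
    ((isMinusOneOrthogonal_rhoIn B x).mul h fun i j _ _ => rhoIn_commutes x i j _)
    (isMinusOneOrthogonal_rhoIn B x).transpose fun _ _ k l => (rhoIn_commutes x l k _).symm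

theorem perm3_conj_rhoIn (h : IsMinusOneOrthogonal u) :
    perm3 (rhoIn B x * u * (rhoIn B x).transpose) = perm3 u := by
  rw [perm3_mul (isMinusOneOrthogonal_rhoIn B x).transpose fun _ _ k l => (rhoIn_commutes x l k _).symm,
    perm3_mul h fun i j _ _ => rhoIn_commutes x i j _, perm3_rhoIn, rhoIn_transpose, perm3_rhoIn,
    one_mul, mul_one]

theorem satisfies_SORel_conj_rhoIn (h : Satisfies SORel u) :
    Satisfies SORel (rhoIn B x * u * (rhoIn B x).transpose) := by
  rw [satisfies_SORel_iff] at h ⊢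
  exact ⟨h.1.conj_rhoIn x, (perm3_conj_rhoIn x h.1).trans h.2⟩

end rhoIn

/-! ### Hopf *-homomorphisms -/

section Lift

variable {m n : ℕ} {r : FreeMat m → FreeMat m → Prop} {s : FreeMat n → FreeMat n → Prop}
  [IsHopfRel r] [IsHopfRel s]

/-- The *-homomorphism given by a matrix with self-adjoint entries that satisfies the relations. -/
noncomputable def Pol.liftStar (u : Matrix (Fin m) (Fin m) (Pol s)) (hu : Satisfies r u)
    (hs : ∀ i j, star (u i j) = u i j) : Pol r →⋆ₐ[ℂ] Pol s where
  __ := Pol.lift u hu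
  map_star' a := by
    change Pol.lift u hu (star a) = star (Pol.lift u hu a)
    induction a using Pol.induction with
    | algebraMap c => simp
    | gen i j => simp [hs]
    | mul a b ha hb => simp [ha, hb]
    | add a b ha hb => simp [ha, hb]

@[simp]
theorem Pol.liftStar_gen (u : Matrix (Fin m) (Fin m) (Pol s)) (hu : Satisfies r u)
    (hs : ∀ i j, star (u i j) = u i j) (i j : Fin m) :
    Pol.liftStar u hu hs (Pol.gen r i j) = u i j :=
  Pol.lift_gen u hu i j

theorem Pol.starHom_ext {f g : Pol r →⋆ₐ[ℂ] Pol s}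
    (h : (Pol.gen r).map f = (Pol.gen r).map g) : f = g := by
  have : f.toAlgHom = g.toAlgHom := Pol.hom_ext fun i j => congrFun (congrFun h i) j
  ext a
  exact DFunLike.congr_fun this a

/-- The entries of `u` form a corepresentation. -/
def IsCorep (u : Matrix (Fin m) (Fin m) (Pol s)) : Prop :=
  ∀ i j, Coalgebra.comul (R := ℂ) (u i j) = ∑ k, u i k ⊗ₜ[ℂ] u k j

theorem isHopfHom_iff (f : Pol r →⋆ₐ[ℂ] Pol s) :
    IsHopfHom f ↔ IsCorep ((Pol.gen r).map f) := by
  constructor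
  · intro h i j
    have := h (Pol.gen r i j)
    rw [Pol.comul_gen, map_sum] at this
    exact this
  · intro h
    have : (Bialgebra.comulAlgHom ℂ (Pol s)).comp f.toAlgHom =
        (Algebra.TensorProduct.map f.toAlgHom f.toAlgHom).comp (Bialgebra.comulAlgHom ℂ (Pol r)) := by
      apply Pol.hom_ext
      intro i j
      have := h i j
      simp only [AlgHom.comp_apply, Bialgebra.comulAlgHom_apply, Pol.comul_gen, map_sum,
        Algebra.TensorProduct.map_tmul]
      exact this
    intro a
    exact DFunLike.congr_fun this a

/-- In this matrix form the factor `ρᵀρ = 1` cancels between the two legs when `u` is conjugated by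
a scalar orthogonal matrix. -/
theorem isCorep_iff (u : Matrix (Fin m) (Fin m) (Pol s)) :
    IsCorep u ↔ u.map (Bialgebra.comulAlgHom ℂ (Pol s)) =
      u.map (Algebra.TensorProduct.includeLeft : Pol s →ₐ[ℂ] Pol s ⊗[ℂ] Pol s) *
        u.map (Algebra.TensorProduct.includeRight : Pol s →ₐ[ℂ] Pol s ⊗[ℂ] Pol s) := by
  simp [IsCorep, ← Matrix.ext_iff, Matrix.mul_apply]

theorem map_conj_rhoIn {B C : Type} [Ring B] [Algebra ℂ B] [Ring C] [Algebra ℂ C] (f : B →ₐ[ℂ] C)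
    (x : Equiv.Perm (Fin 4)) (u : Matrix (Fin 3) (Fin 3) B) :
    (rhoIn B x * u * (rhoIn B x).transpose).map f =
      rhoIn C x * u.map f * (rhoIn C x).transpose := by
  rw [Matrix.map_mul, Matrix.map_mul, ← rhoIn_map x f]
  rfl

theorem IsCorep.conj_rhoIn {u : Matrix (Fin 3) (Fin 3) (Pol s)} (h : IsCorep u)
    (x : Equiv.Perm (Fin 4)) : IsCorep (rhoIn _ x * u * (rhoIn _ x).transpose) := by
  rw [isCorep_iff] at h ⊢
  simp only [map_conj_rhoIn, h]
  simp only [Matrix.mul_assoc]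
  rw [← Matrix.mul_assoc _ (rhoIn _ x) (_ * _), (isMinusOneOrthogonal_rhoIn _ x).transpose_mul,
    Matrix.one_mul]

end Lift

end MinusOne

namespace MinusOne

/-! ### The permanent of a `2 × 2` matrix -/

section TwoByTwo

variable {B : Type} [Ring B] {u : Matrix (Fin 2) (Fin 2) B}

theorem IsMinusOneOrthogonal.relations (h : IsMinusOneOrthogonal u) :
    (u 0 0 * u 0 0 + u 0 1 * u 0 1 = 1 ∧ u 0 0 * u 1 0 + u 0 1 * u 1 1 = 0 ∧
      u 1 0 * u 0 0 + u 1 1 * u 0 1 = 0 ∧ u 1 0 * u 1 0 + u 1 1 * u 1 1 = 1) ∧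
    (u 0 0 * u 0 0 + u 1 0 * u 1 0 = 1 ∧ u 0 0 * u 0 1 + u 1 0 * u 1 1 = 0 ∧
      u 0 1 * u 0 0 + u 1 1 * u 1 0 = 0 ∧ u 0 1 * u 0 1 + u 1 1 * u 1 1 = 1) := by
  have h1 := h.mul_transpose
  have h2 := h.transpose_mul
  simp only [← Matrix.ext_iff, Matrix.mul_apply, Fin.forall_fin_two, Fin.sum_univ_two,
    Matrix.transpose_apply, Matrix.one_apply] at h1 h2
  simp at h1 h2
  tauto

/-- Orthogonality of the rows and anticommutation in a column turn `u₀₁u₁₀u₀₀` into `u₁₁u₀₁²`; the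
other term is `u₁₁u₀₀²`, and the first row has norm one. -/
theorem IsMinusOneOrthogonal.perm2_mul_00 (h : IsMinusOneOrthogonal u) :
    perm2 u * u 0 0 = u 1 1 := by
  have h1 : u 0 0 * u 1 1 = u 1 1 * u 0 0 := h.comm 0 0 1 1 (by decide) (by decide)
  have h2 : u 1 0 * u 0 0 = -(u 1 1 * u 0 1) := eq_neg_of_add_eq_zero_left h.relations.1.2.2.1
  have h3 : u 0 1 * u 1 1 = -(u 1 1 * u 0 1) := h.col 0 1 1 (by decide)
  rw [perm2, add_mul, h1, mul_assoc, mul_assoc, h2, mul_neg, ← mul_assoc (u 0 1), h3, neg_mul,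
    neg_neg, mul_assoc, ← mul_add, h.relations.1.1, mul_one]

theorem IsMinusOneOrthogonal.perm2_mul_01 (h : IsMinusOneOrthogonal u) :
    perm2 u * u 0 1 = u 1 0 := by
  have h1 : u 0 1 * u 1 0 = u 1 0 * u 0 1 := h.comm 0 1 1 0 (by decide) (by decide)
  have h2 : u 1 1 * u 0 1 = -(u 1 0 * u 0 0) := eq_neg_of_add_eq_zero_right h.relations.1.2.2.1
  have h3 : u 0 0 * u 1 0 = -(u 1 0 * u 0 0) := h.col 0 0 1 (by decide)
  rw [perm2, add_mul, h1, mul_assoc, mul_assoc, h2, mul_neg, ← mul_assoc, h3, neg_mul, neg_neg,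
    mul_assoc, ← mul_add, h.relations.1.1, mul_one]

theorem IsMinusOneOrthogonal.mul_perm2_00 (h : IsMinusOneOrthogonal u) :
    u 0 0 * perm2 u = u 1 1 := by
  have h1 : u 0 1 * u 1 0 = u 1 0 * u 0 1 := h.comm 0 1 1 0 (by decide) (by decide)
  have h2 : u 0 0 * u 1 0 = -(u 0 1 * u 1 1) := eq_neg_of_add_eq_zero_left h.relations.1.2.1
  have h3 : u 1 1 * u 0 1 = -(u 0 1 * u 1 1) := h.col 1 1 0 (by decide)
  rw [perm2, mul_add, h1, ← mul_assoc, ← mul_assoc, h2, neg_mul, mul_assoc (u 0 1), h3, mul_neg,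
    neg_neg, ← mul_assoc, ← add_mul, h.relations.1.1, one_mul]

theorem IsMinusOneOrthogonal.mul_perm2_01 (h : IsMinusOneOrthogonal u) :
    u 0 1 * perm2 u = u 1 0 := by
  have h1 : u 0 0 * u 1 1 = u 1 1 * u 0 0 := h.comm 0 0 1 1 (by decide) (by decide)
  have h2 : u 0 1 * u 1 1 = -(u 0 0 * u 1 0) := eq_neg_of_add_eq_zero_right h.relations.1.2.1
  have h3 : u 1 0 * u 0 0 = -(u 0 0 * u 1 0) := h.col 1 0 0 (by decide)
  rw [perm2, mul_add, h1, ← mul_assoc, ← mul_assoc, h2, neg_mul, mul_assoc, h3, mul_neg, neg_neg,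
    ← mul_assoc, ← add_mul, h.relations.1.1, one_mul]

/-- Multiplying `u₀₀u₁₁ + u₀₁u₁₀` by the permanent replaces each left factor by the diagonally
opposite entry, which leaves the norm of the second row. -/
theorem IsMinusOneOrthogonal.perm2_mul_self (h : IsMinusOneOrthogonal u) :
    perm2 u * perm2 u = 1 := by
  conv_lhs => rw [perm2.eq_def u, mul_add, ← mul_assoc, ← mul_assoc]
  rw [← perm2, h.perm2_mul_00, h.perm2_mul_01, add_comm, h.relations.1.2.2.2]

theorem IsMinusOneOrthogonal.perm2_mul (h : IsMinusOneOrthogonal u) (i j : Fin 2) :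
    perm2 u * u i j = u (1 - i) (1 - j) ∧ u i j * perm2 u = u (1 - i) (1 - j) := by
  have e : ∀ x y : B, perm2 u * x = y → perm2 u * y = x := fun x y hxy => by
    rw [← hxy, ← mul_assoc, h.perm2_mul_self, one_mul]
  have e' : ∀ x y : B, x * perm2 u = y → y * perm2 u = x := fun x y hxy => by
    rw [← hxy, mul_assoc, h.perm2_mul_self, mul_one]
  fin_cases i <;> fin_cases j
  exacts [⟨h.perm2_mul_00, h.mul_perm2_00⟩, ⟨h.perm2_mul_01, h.mul_perm2_01⟩,
    ⟨e _ _ h.perm2_mul_01, e' _ _ h.mul_perm2_01⟩, ⟨e _ _ h.perm2_mul_00, e' _ _ h.mul_perm2_00⟩]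

theorem IsMinusOneOrthogonal.perm2_commute (h : IsMinusOneOrthogonal u) (i j : Fin 2) :
    perm2 u * u i j = u i j * perm2 u :=
  (h.perm2_mul i j).1.trans (h.perm2_mul i j).2.symm

theorem IsMinusOneOrthogonal.blockPerm (h : IsMinusOneOrthogonal u) :
    IsMinusOneOrthogonal (blockPerm u) := by
  have hp := h.perm2_mul_self
  obtain ⟨⟨a1, a2, a3, a4⟩, b1, b2, b3, b4⟩ := h.relations
  refine ⟨?_, ?_, ?_, ?_, ?_⟩
  · ext i j
    fin_cases i <;> fin_cases j <;>
      simp [MinusOne.blockPerm, Matrix.mul_apply, Fin.sum_univ_three, *]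
  · ext i j
    fin_cases i <;> fin_cases j <;>
      simp [MinusOne.blockPerm, Matrix.mul_apply, Fin.sum_univ_three, *]
  · have r := fun i => h.row i 0 1 (by decide)
    have r' := fun i => h.row i 1 0 (by decide)
    intro i j k hjk
    fin_cases i <;> fin_cases j <;> fin_cases k <;>
      first | exact absurd rfl hjk | simp [MinusOne.blockPerm] <;> first | exact r _ | exact r' _
  · have r := fun i => h.col 0 i 1 (by decide)
    have r' := fun i => h.col 1 i 0 (by decide)
    intro i j k hik
    fin_cases i <;> fin_cases j <;> fin_cases k <;>
      first | exact absurd rfl hik | simp [MinusOne.blockPerm] <;> first | exact r _ | exact r' _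
  · intro i j k l hik hjl
    fin_cases i <;> fin_cases k <;> first | exact absurd rfl hik | skip
    all_goals fin_cases j <;> fin_cases l <;> first | exact absurd rfl hjl | skip
    all_goals first
      | exact h.comm _ _ _ _ (by decide) (by decide)
      | exact h.perm2_commute _ _
      | exact (h.perm2_commute _ _).symm
      | simp [MinusOne.blockPerm]

/-- Expansion along the last row gives the square of the `2 × 2` permanent. -/
theorem IsMinusOneOrthogonal.satisfies_blockPerm [Algebra ℂ B] (h : IsMinusOneOrthogonal u) :
    Satisfies SORel (MinusOne.blockPerm u) := by
  rw [satisfies_SORel_iff]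
  refine ⟨h.blockPerm, ?_⟩
  rw [perm3_eq, ← h.perm2_mul_self]
  conv_rhs => rw [perm2.eq_def u, ← perm2.eq_def u]
  simp [MinusOne.blockPerm]
  rw [← add_mul, ← perm2]

end TwoByTwo

/-! ### The standard embeddings -/

theorem blockPerm_map {B C : Type} [Ring B] [Ring C] (f : B →+* C) (u : Matrix (Fin 2) (Fin 2) B) :
    (blockPerm u).map f = blockPerm (u.map f) := by
  ext i j
  fin_cases i <;> fin_cases j <;> simp [blockPerm, perm2]

/-- In `∑ ã₀ₖã₁ₗ ⊗ (ãₖ₀ãₗ₁ + ãₖ₁ãₗ₀)` the terms with `k = l` vanish by anticommutation in row `k`;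
the others factor. -/
theorem comul_perm2_gen : Coalgebra.comul (R := ℂ) (perm2 (Pol.gen (ORel 2))) =
    perm2 (Pol.gen (ORel 2)) ⊗ₜ[ℂ] perm2 (Pol.gen (ORel 2)) := by
  have h := ORel.isMinusOneOrthogonal 2
  have h1 := h.row 0 0 1 (by decide)
  have h2 := h.row 1 0 1 (by decide)
  have h3 := h.comm 0 0 1 1 (by decide) (by decide)
  have h4 := h.comm 0 1 1 0 (by decide) (by decide)
  simp only [perm2, map_add, Bialgebra.comul_mul, Pol.comul_gen, Fin.sum_univ_two, add_mul, mul_add,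
    Algebra.TensorProduct.tmul_mul_tmul, h1, h2, ← h3, ← h4, TensorProduct.tmul_neg,
    TensorProduct.tmul_add, TensorProduct.add_tmul]
  abel

theorem isCorep_blockPerm : IsCorep (blockPerm (Pol.gen (ORel 2))) := by
  intro i j
  fin_cases i <;> fin_cases j <;>
    simp [blockPerm, Fin.sum_univ_three, Fin.sum_univ_two, comul_perm2_gen]

theorem star_perm2_gen : star (perm2 (Pol.gen (ORel 2))) = perm2 (Pol.gen (ORel 2)) := by
  have h := ORel.isMinusOneOrthogonal 2
  simp [perm2, h.comm 1 1 0 0 (by decide) (by decide), h.comm 1 0 0 1 (by decide) (by decide)]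

theorem star_blockPerm (i j : Fin 3) :
    star (blockPerm (Pol.gen (ORel 2)) i j) = blockPerm (Pol.gen (ORel 2)) i j := by
  fin_cases i <;> fin_cases j <;> simp [blockPerm, star_perm2_gen]

theorem star_rho (x : Equiv.Perm (Fin 4)) (i j : Fin 3) : star (rho x i j) = rho x i j := by
  simp [rho_apply]

theorem star_conj_rhoIn {n : ℕ} {s : FreeMat n → FreeMat n → Prop} [IsHopfRel s]
    {u : Matrix (Fin 3) (Fin 3) (Pol s)} (hu : ∀ i j, star (u i j) = u i j)
    (x : Equiv.Perm (Fin 4)) (i j : Fin 3) :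
    star ((rhoIn (Pol s) x * u * (rhoIn (Pol s) x).transpose) i j) =
      (rhoIn (Pol s) x * u * (rhoIn (Pol s) x).transpose) i j := by
  simp only [conj_rhoIn_apply, star_sum, star_smul, hu, star_mul', star_rho]

/-- The embedding `A ↦ ρ(x) diag(Ã, perm(Ã)) ρ(x)ᵀ`. -/
noncomputable def standardHom (x : Equiv.Perm (Fin 4)) : PolSO3 →⋆ₐ[ℂ] PolO2 :=
  Pol.liftStar _ (satisfies_SORel_conj_rhoIn x (ORel.isMinusOneOrthogonal 2).satisfies_blockPerm)
    (star_conj_rhoIn star_blockPerm x)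

theorem isStandard_standardHom (x : Equiv.Perm (Fin 4)) : IsStandard x (standardHom x) := by
  ext i j
  exact Pol.liftStar_gen _ _ _ i j

theorem IsStandard.eq_standardHom {x : Equiv.Perm (Fin 4)} {f : PolSO3 →⋆ₐ[ℂ] PolO2}
    (h : IsStandard x f) : f = standardHom x :=
  Pol.starHom_ext (h.trans (isStandard_standardHom x).symm)

theorem Pol.surjective_of_gen {m n : ℕ} {r : FreeMat m → FreeMat m → Prop}
    {s : FreeMat n → FreeMat n → Prop} (f : Pol r →ₐ[ℂ] Pol s)
    (h : ∀ i j, Pol.gen s i j ∈ f.range) : Function.Surjective f := by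
  intro b
  change b ∈ f.range
  induction b using Pol.induction with
  | algebraMap c => exact Subalgebra.algebraMap_mem _ c
  | gen i j => exact h i j
  | mul a b ha hb => exact mul_mem ha hb
  | add a b ha hb => exact add_mem ha hb

theorem isEmbedding_standardHom (x : Equiv.Perm (Fin 4)) : IsEmbedding (standardHom x) where
  surjective := by
    apply Pol.surjective_of_gen (standardHom x).toAlgHom
    -- Undoing the conjugation inside `Pol(SO₋₁(3))` gives preimages of all entries of `diag(Ã, p)`.
    have h : (rhoIn PolSO3 x⁻¹ * Pol.gen SORel * (rhoIn PolSO3 x⁻¹).transpose).map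
        (standardHom x).toAlgHom = blockPerm (Pol.gen (ORel 2)) := by
      rw [map_conj_rhoIn, ← rhoIn_transpose, Matrix.transpose_transpose]
      have hx := (isMinusOneOrthogonal_rhoIn PolO2 x).transpose_mul
      have : (Pol.gen SORel).map (standardHom x).toAlgHom = _ := isStandard_standardHom x
      rw [this, Matrix.mul_assoc, Matrix.mul_assoc, Matrix.mul_assoc, hx, Matrix.mul_one,
        ← Matrix.mul_assoc, hx, Matrix.one_mul]
    have h' : ∀ i j, blockPerm (Pol.gen (ORel 2)) i j ∈ (standardHom x).toAlgHom.range := by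
      intro i j
      rw [← h]
      exact ⟨_, rfl⟩
    intro i j
    fin_cases i <;> fin_cases j
    exacts [h' 0 0, h' 0 1, h' 1 0, h' 1 1]
  isHopfHom := by
    rw [isHopfHom_iff, isStandard_standardHom x]
    exact isCorep_blockPerm.conj_rhoIn x

/-! ### Inner automorphisms -/

/-- The endomorphism `A ↦ ρ(x)ᵀ A ρ(x)`. -/
noncomputable def innerHom (x : Equiv.Perm (Fin 4)) : PolSO3 →⋆ₐ[ℂ] PolSO3 :=
  -- Since `ρ(x)ᵀ = ρ(x⁻¹)`, this is conjugation by `ρ(x⁻¹)`.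
  Pol.liftStar _ (satisfies_SORel_conj_rhoIn x⁻¹ (Pol.satisfies_gen SORel))
    (star_conj_rhoIn Pol.star_gen x⁻¹)

theorem innerHom_map_gen (x : Equiv.Perm (Fin 4)) : (Pol.gen SORel).map (innerHom x) =
    (rhoIn PolSO3 x).transpose * Pol.gen SORel * rhoIn PolSO3 x := by
  have h : rhoIn PolSO3 x = (rhoIn PolSO3 x⁻¹).transpose := by
    rw [rhoIn_transpose, inv_inv]
  rw [rhoIn_transpose]
  conv_rhs => rw [h]
  ext i j
  exact Pol.liftStar_gen _ _ _ i j

theorem map_innerHom {B : Type} [Ring B] [Algebra ℂ B] (f : PolSO3 →ₐ[ℂ] B)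
    (x : Equiv.Perm (Fin 4)) : (Pol.gen SORel).map (fun a => f (innerHom x a)) =
      (rhoIn B x).transpose * (Pol.gen SORel).map f * rhoIn B x := by
  have : (Pol.gen SORel).map (fun a => f (innerHom x a)) =
      ((Pol.gen SORel).map (innerHom x)).map f := by
    rw [Matrix.map_map]; rfl
  rw [this, innerHom_map_gen, Matrix.map_mul, Matrix.map_mul, ← rhoIn_map x f]
  rfl

theorem innerHom_comp (x y : Equiv.Perm (Fin 4)) :
    (innerHom x).comp (innerHom y) = innerHom (x * y) := by
  apply Pol.starHom_ext
  refine (map_innerHom (innerHom x).toAlgHom y).trans ?_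
  have h : (Pol.gen SORel).map (innerHom x).toAlgHom = _ := innerHom_map_gen x
  rw [h, innerHom_map_gen]
  simp only [rhoIn_transpose]
  simp only [rhoIn_mul, mul_inv_rev, Matrix.mul_assoc]

theorem innerHom_one : innerHom 1 = StarAlgHom.id ℂ PolSO3 := by
  apply Pol.starHom_ext
  rw [innerHom_map_gen, rhoIn_one]
  simp

/-- The automorphism `A ↦ ρ(x)ᵀ A ρ(x)`. -/
noncomputable def innerAut (x : Equiv.Perm (Fin 4)) : PolSO3 ≃⋆ₐ[ℂ] PolSO3 :=
  StarAlgEquiv.ofStarAlgHom (innerHom x) (innerHom x⁻¹)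
    (by rw [innerHom_comp, inv_mul_cancel, innerHom_one])
    (by rw [innerHom_comp, mul_inv_cancel, innerHom_one])

theorem isInnerAut_innerAut (x : Equiv.Perm (Fin 4)) : IsInnerAut x (innerAut x) where
  isHopfHom := by
    have : ((innerAut x : PolSO3 ≃⋆ₐ[ℂ] PolSO3) : PolSO3 →⋆ₐ[ℂ] PolSO3) = innerHom x := rfl
    rw [this, isHopfHom_iff, innerHom_map_gen]
    have h : IsCorep (Pol.gen SORel) := Pol.comul_gen
    have h' := h.conj_rhoIn x⁻¹
    rwa [← rhoIn_transpose, Matrix.transpose_transpose] at h'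
  map_gen := innerHom_map_gen x

theorem standardHom_comp_innerHom (x y : Equiv.Perm (Fin 4)) :
    (standardHom y).comp (innerHom x) = standardHom (x⁻¹ * y) := by
  apply Pol.starHom_ext
  refine (map_innerHom (standardHom y).toAlgHom x).trans ?_
  have h : (Pol.gen SORel).map (standardHom y).toAlgHom = _ := isStandard_standardHom y
  rw [h, isStandard_standardHom, rhoIn_transpose, rhoIn_transpose, rhoIn_transpose, mul_inv_rev,
    inv_inv, rhoIn_mul, rhoIn_mul]
  simp only [Matrix.mul_assoc]

/-- Composing `standardHom y` with this automorphism gives `standardHom x`, because `(y x⁻¹)⁻¹ y =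
x`. -/
theorem innerAut_image_ker (x y : Equiv.Perm (Fin 4)) :
    innerAut (y * x⁻¹) '' (RingHom.ker (standardHom x) : Set PolSO3) =
      (RingHom.ker (standardHom y) : Set PolSO3) := by
  have h : ∀ a, standardHom y (innerAut (y * x⁻¹) a) = standardHom x a := fun a => by
    have := DFunLike.congr_fun (standardHom_comp_innerHom (y * x⁻¹) y) a
    rwa [mul_inv_rev, inv_inv, inv_mul_cancel_right] at this
  ext b
  simp only [Set.mem_image, SetLike.mem_coe, RingHom.mem_ker]
  constructor
  · rintro ⟨a, ha, rfl⟩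
    rw [h, ha]
  · intro hb
    obtain ⟨a, rfl⟩ := (innerAut (y * x⁻¹)).surjective b
    exact ⟨a, (h a).symm.trans hb, rfl⟩

/-! ### Equality of kernels -/

/-- The third column of `ρ(x)` is supported in the row `m`. -/
def IsIndex (x : Equiv.Perm (Fin 4)) (m : Fin 3) : Prop :=
  rho x m 2 * rho x m 2 = 1 ∧ ∀ i, i ≠ m → rho x i 2 = 0

theorem exists_isIndex (x : Equiv.Perm (Fin 4)) : ∃ m, IsIndex x m := by
  obtain ⟨m, hm⟩ := rhoInt_last x
  refine ⟨m, ?_, fun i hi => ?_⟩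
  · have := congrArg (Int.cast : ℤ → ℂ) ((hm m).1 rfl)
    push_cast at this
    rw [rho_apply]
    linear_combination this / 16
  · rw [rho_apply, (hm i).2 hi, Int.cast_zero, zero_div]

theorem exists_isIndex_eq (m : Fin 3) : ∃ x, IsIndex x m := by
  obtain ⟨x, hx⟩ := exists_rhoInt_eq (Equiv.swap 2 m) true
  refine ⟨x, ?_, fun i hi => ?_⟩
  · simp [rho_apply, hx]
  · simp [rho_apply, hx, hi]

theorem IsIndex.ne_zero {x : Equiv.Perm (Fin 4)} {m : Fin 3} (h : IsIndex x m) : rho x m 2 ≠ 0 := by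
  intro h0
  have := h.1
  simp [h0] at this

theorem IsIndex.row {x : Equiv.Perm (Fin 4)} {m : Fin 3} (h : IsIndex x m) {i : Fin 3}
    (hi : i ≠ 2) : rho x m i = 0 :=
  (mul_eq_zero.1 (rho_row x hi)).resolve_right h.ne_zero

/-- An orthogonal matrix that satisfies the relations and whose third row and column vanish off
the diagonal restricts to one of size two. -/
theorem IsMinusOneOrthogonal.restrict {B : Type} [Ring B] {w : Matrix (Fin 3) (Fin 3) B}
    (h : IsMinusOneOrthogonal w) (h1 : ∀ i, i ≠ 2 → w i 2 = 0) (h2 : ∀ i, i ≠ 2 → w 2 i = 0) :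
    IsMinusOneOrthogonal (w.submatrix (Fin.castSucc (n := 2)) Fin.castSucc) where
  mul_transpose := by
    ext i j
    have := congrFun (congrFun h.mul_transpose i.castSucc) j.castSucc
    rw [Matrix.mul_apply, Fin.sum_univ_castSucc] at this
    rw [show w i.castSucc (Fin.last 2) = 0 from h1 _ (Fin.castSucc_lt_last i).ne, zero_mul,
      add_zero] at this
    simpa [Matrix.mul_apply, Matrix.one_apply] using this
  transpose_mul := by
    ext i j
    have := congrFun (congrFun h.transpose_mul i.castSucc) j.castSucc
    rw [Matrix.mul_apply, Fin.sum_univ_castSucc, Matrix.transpose_apply] at this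
    rw [show w (Fin.last 2) i.castSucc = 0 from h2 _ (Fin.castSucc_lt_last i).ne, zero_mul,
      add_zero] at this
    simpa [Matrix.mul_apply, Matrix.one_apply] using this
  row i j k hjk := h.row _ _ _ ((Fin.castSucc_injective 2).ne hjk)
  col i j k hik := h.col _ _ _ ((Fin.castSucc_injective 2).ne hik)
  comm i j k l hik hjl := h.comm _ _ _ _ ((Fin.castSucc_injective 2).ne hik)
    ((Fin.castSucc_injective 2).ne hjl)

theorem perm3_eq_perm2_mul {B : Type} [Ring B] {w : Matrix (Fin 3) (Fin 3) B}
    (h1 : ∀ i, i ≠ 2 → w i 2 = 0) (h2 : ∀ i, i ≠ 2 → w 2 i = 0) :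
    perm3 w = perm2 (w.submatrix (Fin.castSucc (n := 2)) Fin.castSucc) * w 2 2 := by
  rw [perm3_eq, h1 0 (by decide), h1 1 (by decide), h2 0 (by decide), h2 1 (by decide)]
  simp [perm2, add_mul]

/-- The matrix `ρ(x⁻¹y)` preserves the third axis up to sign, so it conjugates `diag(Ã, p)` into
`diag(v, p)` for another solution `v` of the relations of `O₋₁(2)`. The endomorphism `Ã ↦ v` carries
`standardHom x` to `standardHom y`. It need not be shown bijective, since `x` and `y` may be
exchanged. -/
theorem ker_standardHom_le {x y : Equiv.Perm (Fin 4)} {m : Fin 3} (hx : IsIndex x m)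
    (hy : IsIndex y m) : RingHom.ker (standardHom x) ≤ RingHom.ker (standardHom y) := by
  have hB := (ORel.isMinusOneOrthogonal 2).satisfies_blockPerm
  have hD : ∀ z i j, rho (z⁻¹ * y) i j = ∑ k, rho z k i * rho y k j := by
    intro z i j
    rw [rho_mul, ← rho_transpose, Matrix.mul_apply]
    rfl
  have d1 : ∀ i, i ≠ 2 → rho (x⁻¹ * y) i 2 = 0 := fun i hi => by
    rw [hD, Finset.sum_eq_single m, hx.row hi, zero_mul]
    · intro k _ hk
      rw [hy.2 k hk, mul_zero]
    · simp
  have d2 : ∀ i, i ≠ 2 → rho (x⁻¹ * y) 2 i = 0 := fun i hi => by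
    rw [hD, Finset.sum_eq_single m, hy.row hi, mul_zero]
    · intro k _ hk
      rw [hx.2 k hk, zero_mul]
    · simp
  have d3 : rho (x⁻¹ * y) 2 2 * rho (x⁻¹ * y) 2 2 = 1 := by
    rw [hD, Finset.sum_eq_single m, mul_mul_mul_comm, hx.1, hy.1, one_mul]
    · intro k _ hk
      rw [hx.2 k hk, zero_mul]
    · simp
  set D := rho (x⁻¹ * y)
  set w := rhoIn PolO2 (x⁻¹ * y) * blockPerm (Pol.gen (ORel 2)) *
    (rhoIn PolO2 (x⁻¹ * y)).transpose with hw
  have hwa : ∀ i j, w i j = ∑ l, ∑ k, (D i k * D j l) • blockPerm (Pol.gen (ORel 2)) k l :=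
    conj_rhoIn_apply _ _
  have hws := (satisfies_SORel_iff _).1 (satisfies_SORel_conj_rhoIn (x⁻¹ * y) hB)
  have b1 : blockPerm (Pol.gen (ORel 2)) 0 2 = 0 := rfl
  have b2 : blockPerm (Pol.gen (ORel 2)) 1 2 = 0 := rfl
  have b3 : blockPerm (Pol.gen (ORel 2)) 2 0 = 0 := rfl
  have b4 : blockPerm (Pol.gen (ORel 2)) 2 1 = 0 := rfl
  have b5 : blockPerm (Pol.gen (ORel 2)) 2 2 = perm2 (Pol.gen (ORel 2)) := rfl
  have w1 : ∀ i, i ≠ 2 → w i 2 = 0 := fun i hi => by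
    simp [hwa, Fin.sum_univ_three, d1 i hi, d2 0, d2 1, b1, b2]
  have w2 : ∀ i, i ≠ 2 → w 2 i = 0 := fun i hi => by
    simp [hwa, Fin.sum_univ_three, d1 i hi, d2 0, d2 1, b3, b4]
  have w3 : w 2 2 = perm2 (Pol.gen (ORel 2)) := by
    simp [hwa, Fin.sum_univ_three, d2 0, d2 1, b5, d3]
  set v := w.submatrix (Fin.castSucc (n := 2)) Fin.castSucc
  have hv : IsMinusOneOrthogonal v := hws.1.restrict w1 w2
  have hvw : blockPerm v = w := by
    -- Both sides are inverse to `w 2 2`: the full permanent of `w` is one, and `w 2 2 = p` squares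
    -- to one.
    have hp : perm2 v = w 2 2 := by
      have h1 := (perm3_eq_perm2_mul w1 w2).symm.trans hws.2
      have h2 := (ORel.isMinusOneOrthogonal 2).perm2_mul_self
      rw [← w3] at h2
      calc perm2 v = perm2 v * (w 2 2 * w 2 2) := by rw [h2, mul_one]
        _ = w 2 2 := by rw [← mul_assoc, h1, one_mul]
    ext i j
    fin_cases i <;> fin_cases j
    exacts [rfl, rfl, (w1 0 (by decide)).symm, rfl, rfl, (w1 1 (by decide)).symm,
      (w2 0 (by decide)).symm, (w2 1 (by decide)).symm, hp]
  have key : (Pol.lift v ((satisfies_ORel_iff v).2 hv)).comp (standardHom x).toAlgHom =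
      (standardHom y).toAlgHom := by
    set α := Pol.lift v ((satisfies_ORel_iff v).2 hv)
    have hα : (Pol.gen (ORel 2)).map α = v := by
      ext i j
      exact Pol.lift_gen _ _ i j
    have e : (Pol.gen SORel).map (α.comp (standardHom x).toAlgHom) =
        ((Pol.gen SORel).map (standardHom x)).map α := by
      rw [Matrix.map_map]; rfl
    have e2 : (blockPerm (Pol.gen (ORel 2))).map α = w := by
      have := blockPerm_map α.toRingHom (Pol.gen (ORel 2))
      exact this.trans ((congrArg blockPerm hα).trans hvw)
    have e3 : (Pol.gen SORel).map (α.comp (standardHom x).toAlgHom) =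
        (Pol.gen SORel).map (standardHom y) := by
      rw [e, isStandard_standardHom, isStandard_standardHom, map_conj_rhoIn, e2, hw, rhoIn_transpose,
        rhoIn_transpose, rhoIn_transpose, Matrix.mul_assoc, Matrix.mul_assoc, ← rhoIn_mul,
        ← Matrix.mul_assoc, ← Matrix.mul_assoc, ← rhoIn_mul, mul_inv_cancel_left, mul_inv_rev,
        inv_inv, mul_inv_cancel_right, Matrix.mul_assoc]
    exact Pol.hom_ext fun i j => congrFun (congrFun e3 i) j
  intro a ha
  rw [RingHom.mem_ker] at ha ⊢
  refine (DFunLike.congr_fun key a).symm.trans ?_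
  exact (congrArg (Pol.lift v _) ha).trans (map_zero (Pol.lift v _))

theorem ker_standardHom_eq {x y : Equiv.Perm (Fin 4)} {m : Fin 3} (hx : IsIndex x m)
    (hy : IsIndex y m) : RingHom.ker (standardHom x) = RingHom.ker (standardHom y) :=
  le_antisymm (ker_standardHom_le hx hy) (ker_standardHom_le hy hx)

/-- The flip matrix is a scalar solution whose off-diagonal entries are nonzero. -/
theorem gen_offDiag_ne_zero :
    Pol.gen (ORel 2) 0 1 ≠ 0 ∧ Pol.gen (ORel 2) 1 0 ≠ 0 := by
  have h : IsMinusOneOrthogonal (!![0, 1; 1, 0] : Matrix (Fin 2) (Fin 2) ℂ) := by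
    refine ⟨?_, ?_, ?_, ?_, ?_⟩
    · ext i j; fin_cases i <;> fin_cases j <;> simp [Matrix.mul_apply]
    · ext i j; fin_cases i <;> fin_cases j <;> simp [Matrix.mul_apply]
    · simp [Fin.forall_fin_two]
    · simp [Fin.forall_fin_two]
    · intros; exact mul_comm _ _
  have h1 := Pol.lift_gen _ ((satisfies_ORel_iff _).2 h)
  constructor
  · intro h0
    have := h1 0 1
    rw [h0] at this
    simp at this
  · intro h0
    have := h1 1 0
    rw [h0] at this
    simp at this

/-- Under `standardHom x`, row `m` of the generic matrix vanishes off the diagonal. With equal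
kernels this would hold for `y` too, making row `m` of `ρ(y)` a left eigenvector of `diag(Ã, p)`
with eigenvalue in the algebra. As `m ≠ m'`, that row is the first or second coordinate vector up to
sign, and an off-diagonal generator would vanish. -/
theorem ker_standardHom_ne {x y : Equiv.Perm (Fin 4)} {m m' : Fin 3} (hx : IsIndex x m)
    (hy : IsIndex y m') (hm : m ≠ m') :
    RingHom.ker (standardHom x) ≠ RingHom.ker (standardHom y) := by
  intro h
  have hg : ∀ z i j, standardHom z (Pol.gen SORel i j) =
      ∑ l, ∑ k, (rho z i k * rho z j l) • blockPerm (Pol.gen (ORel 2)) k l := fun z i j =>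
    (congrFun (congrFun (isStandard_standardHom z) i) j).trans (conj_rhoIn_apply _ _ _ _)
  have h0 : ∀ j, j ≠ m → standardHom y (Pol.gen SORel m j) = 0 := by
    intro j hj
    rw [← RingHom.mem_ker, ← h, RingHom.mem_ker, hg]
    simp [Fin.sum_univ_three, hx.row, hx.2 j hj, blockPerm]
  have hm2 : rho y m 2 = 0 := hy.2 m hm
  have hr : ∀ l, ∑ k, rho y m k • blockPerm (Pol.gen (ORel 2)) k l =
      rho y m l • standardHom y (Pol.gen SORel m m) := by
    have e : (Pol.gen SORel).map (standardHom y) * rhoIn PolO2 y =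
        rhoIn PolO2 y * blockPerm (Pol.gen (ORel 2)) := by
      rw [isStandard_standardHom y, Matrix.mul_assoc,
        (isMinusOneOrthogonal_rhoIn PolO2 y).transpose_mul, Matrix.mul_one]
    intro l
    have e' := congrFun (congrFun e m) l
    simp only [Matrix.mul_apply, Matrix.map_apply] at e'
    rw [Finset.sum_eq_single m (fun j _ hj => by rw [h0 j hj, zero_mul]) (by simp),
      ← rhoIn_commutes] at e'
    simpa [rhoIn, Algebra.smul_def] using e'.symm
  have hn : rho y m 0 * rho y m 0 + rho y m 1 * rho y m 1 = 1 := by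
    have := congrFun (congrFun (rho_mul_transpose y) m) m
    simpa [Matrix.mul_apply, Fin.sum_univ_three, hm2] using this
  have hr0 := hr 0
  have hr1 := hr 1
  rcases mul_eq_zero.1 (rho_row y (i := m) (j := 0) (k := 1) (by decide)) with h' | h'
  · have h1 : rho y m 1 ≠ 0 := fun h1 => by simp [h', h1] at hn
    simp [Fin.sum_univ_three, h', hm2, blockPerm, h1] at hr0
    exact gen_offDiag_ne_zero.2 hr0
  · have h1 : rho y m 0 ≠ 0 := fun h1 => by simp [h', h1] at hn
    simp [Fin.sum_univ_three, h', hm2, blockPerm, h1] at hr1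
    exact gen_offDiag_ne_zero.1 hr1

/-! ### Counting and conjugating the copies, given the classification of embeddings. -/

theorem copies_of_classification
    (hmain : ∀ f : PolSO3 →⋆ₐ[ℂ] PolO2, IsEmbedding f → ∃ x, IsStandard x f) :
    copies.encard = 3 ∧
      (∀ I ∈ copies, ∀ J ∈ copies,
        ∃ (x : Equiv.Perm (Fin 4)) (θ : PolSO3 ≃⋆ₐ[ℂ] PolSO3),
          IsInnerAut x θ ∧ θ '' (I : Set PolSO3) = (J : Set PolSO3)) ∧
      (∀ f : PolSO3 →⋆ₐ[ℂ] PolO2,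
        IsEmbedding f ↔ ∃ x : Equiv.Perm (Fin 4), IsStandard x f) ∧
      (∀ x : Equiv.Perm (Fin 4), ∃ f : PolSO3 →⋆ₐ[ℂ] PolO2,
        IsEmbedding f ∧ IsStandard x f) := by
  have hcopies : ∀ I, I ∈ copies ↔ ∃ x, I = RingHom.ker (standardHom x) := by
    intro I
    constructor
    · rintro ⟨f, hf, rfl⟩
      obtain ⟨x, hx⟩ := hmain f hf
      exact ⟨x, by rw [hx.eq_standardHom]⟩
    · rintro ⟨x, rfl⟩
      exact ⟨_, isEmbedding_standardHom x, rfl⟩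
  refine ⟨?_, ?_, ?_, fun x => ⟨_, isEmbedding_standardHom x, isStandard_standardHom x⟩⟩
  · choose x hx using exists_isIndex_eq
    have hr : copies = Set.range fun m => RingHom.ker (standardHom (x m)) := by
      ext I
      rw [hcopies, Set.mem_range]
      constructor
      · rintro ⟨y, rfl⟩
        obtain ⟨m, hm⟩ := exists_isIndex y
        exact ⟨m, ker_standardHom_eq (hx m) hm⟩
      · rintro ⟨m, rfl⟩
        exact ⟨x m, rfl⟩
    have hi : Function.Injective fun m => RingHom.ker (standardHom (x m)) := by
      intro m m' h
      by_contra hm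
      exact ker_standardHom_ne (hx m) (hx m') hm h
    rw [hr, ← Set.image_univ, hi.encard_image]
    simp
  · intro I hI J hJ
    obtain ⟨x, rfl⟩ := (hcopies I).1 hI
    obtain ⟨y, rfl⟩ := (hcopies J).1 hJ
    exact ⟨y * x⁻¹, innerAut _, isInnerAut_innerAut _, innerAut_image_ker x y⟩
  · intro f
    refine ⟨hmain f, ?_⟩
    rintro ⟨x, hx⟩
    rw [hx.eq_standardHom]
    exact isEmbedding_standardHom x

end MinusOne

namespace MinusOne

/-! ### The infinite dihedral group -/

/-- The infinite dihedral group. -/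
abbrev DInf : Type := DihedralGroup 0

namespace DInf

/-- The automorphism that exchanges the reflections `sr 0` and `sr 1`. -/
def twist : DInf →* DInf where
  toFun
    | .r i => .r (-i)
    | .sr i => .sr (1 - i)
  map_one' := congrArg DihedralGroup.r neg_zero
  map_mul' := by
    rintro (i | i) (j | j)
    · exact congrArg DihedralGroup.r (by ring)
    · exact congrArg DihedralGroup.sr (by ring)
    · exact congrArg DihedralGroup.sr (by ring)
    · exact congrArg DihedralGroup.r (by ring)

theorem twist_r (i : ZMod 0) : twist (.r i) = .r (-i) := rfl

theorem twist_sr (i : ZMod 0) : twist (.sr i) = .sr (1 - i) := rfl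

@[simp]
theorem twist_twist (g : DInf) : twist (twist g) = g := by
  rcases g with i | i
  · exact congrArg DihedralGroup.r (neg_neg i)
  · exact congrArg DihedralGroup.sr (sub_sub_cancel 1 i)

/-- A fixed rotation needs `2k = 0` and a fixed reflection `2k = 1`. This absence of fixed points
drives the rank count for the coefficient matrices. -/
theorem twist_ne {g : DInf} (hg : g ≠ 1) : twist g ≠ g := by
  have h1 : ∀ k : ℤ, -k = k → k = 0 := by omega
  have h2 : ∀ k : ℤ, 1 - k ≠ k := by omega
  rcases g with i | i
  · exact fun h => hg (congrArg DihedralGroup.r (h1 i (DihedralGroup.r.inj h)))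
  · exact fun h => h2 i (DihedralGroup.sr.inj h)

/-- The homomorphism to a group given by two involutions. -/
def lift {G : Type} [Group G] (s t : G) (hs : s * s = 1) (ht : t * t = 1) : DInf →* G where
  toFun
    | .r i => (s * t) ^ (show ℤ from i)
    | .sr i => s * (s * t) ^ (show ℤ from i)
  map_one' := zpow_zero (s * t)
  map_mul' := by
    have hst : ∀ i : ℤ, (s * t) ^ i * s = s * (s * t) ^ (-i) := by
      intro i
      have hs' : s⁻¹ = s := inv_eq_of_mul_eq_one_left hs
      have ht' : t⁻¹ = t := inv_eq_of_mul_eq_one_left ht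
      have h : s⁻¹ * (s * t) * s⁻¹⁻¹ = (s * t)⁻¹ := by
        rw [mul_inv_rev, hs', ht', hs', ← mul_assoc, hs, one_mul]
      have := conj_zpow (i := i) (a := s⁻¹) (b := s * t)
      rw [h, inv_zpow', inv_inv] at this
      rw [this, mul_assoc, ← mul_assoc s, mul_inv_cancel, one_mul]
    rintro (i | i) (j | j)
    · exact zpow_add (s * t) (show ℤ from i) (show ℤ from j)
    · change s * (s * t) ^ ((show ℤ from j) - (show ℤ from i)) =
        (s * t) ^ (show ℤ from i) * (s * (s * t) ^ (show ℤ from j))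
      rw [← mul_assoc, hst, mul_assoc, ← zpow_add, neg_add_eq_sub]
    · change s * (s * t) ^ ((show ℤ from i) + (show ℤ from j)) = _
      rw [zpow_add, ← mul_assoc]
    · change (s * t) ^ ((show ℤ from j) - (show ℤ from i)) =
        s * (s * t) ^ (show ℤ from i) * (s * (s * t) ^ (show ℤ from j))
      rw [mul_assoc, ← mul_assoc _ s, hst, mul_assoc, ← mul_assoc, hs, one_mul, ← zpow_add,
        neg_add_eq_sub]

theorem lift_sr_zero {G : Type} [Group G] (s t : G) (hs : s * s = 1) (ht : t * t = 1) :
    lift s t hs ht (.sr 0) = s := by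
  change s * (s * t) ^ (0 : ℤ) = s
  simp

theorem lift_sr_one {G : Type} [Group G] (s t : G) (hs : s * s = 1) (ht : t * t = 1) :
    lift s t hs ht (.sr 1) = t := by
  change s * (s * t) ^ (1 : ℤ) = t
  rw [zpow_one, ← mul_assoc, hs, one_mul]

/-- The reduction of the infinite dihedral group. -/
def reduce (m : ℕ) : DInf →* DihedralGroup m where
  toFun
    | .r i => .r ((show ℤ from i) : ℤ)
    | .sr i => .sr ((show ℤ from i) : ℤ)
  map_one' := congrArg DihedralGroup.r Int.cast_zero
  map_mul' := by
    rintro (i | i) (j | j)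
    · exact congrArg DihedralGroup.r (Int.cast_add _ _)
    · exact congrArg DihedralGroup.sr (Int.cast_sub _ _)
    · exact congrArg DihedralGroup.sr (Int.cast_add _ _)
    · exact congrArg DihedralGroup.r (Int.cast_sub _ _)

end DInf

/-! ### The homomorphisms to the group algebra of the infinite dihedral group -/

/-- The group algebra of the infinite dihedral group. -/
abbrev GrpAlg : Type := MonoidAlgebra ℂ DInf

namespace GrpAlg

/-- The first generating reflection. -/
noncomputable def s : GrpAlg := MonoidAlgebra.single (.sr 0) 1

/-- The second generating reflection. -/
noncomputable def t : GrpAlg := MonoidAlgebra.single (.sr 1) 1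

theorem s_mul_s : s * s = 1 := by
  rw [s, MonoidAlgebra.single_mul_single, MonoidAlgebra.one_def]
  simp

theorem t_mul_t : t * t = 1 := by
  rw [t, MonoidAlgebra.single_mul_single, MonoidAlgebra.one_def]
  simp

/-- The half sum of the generating reflections. -/
noncomputable def a : GrpAlg := (1 / 2 : ℂ) • (s + t)

/-- The half difference of the generating reflections. -/
noncomputable def b : GrpAlg := (1 / 2 : ℂ) • (s - t)

theorem a_mul_b : a * b = -(b * a) := by
  simp only [a, b, smul_mul_smul_comm, add_mul, mul_add, sub_mul, mul_sub, s_mul_s, t_mul_t]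
  rw [← smul_neg]
  congr 1
  abel

theorem a_sq_add_b_sq : a * a + b * b = 1 := by
  simp only [a, b, smul_mul_smul_comm, add_mul, mul_add, sub_mul, mul_sub, s_mul_s, t_mul_t,
    ← smul_add]
  rw [show 1 + t * s + (s * t + 1) + (1 - t * s - (s * t - 1)) = (4 : ℂ) • (1 : GrpAlg) by
    rw [show (4 : ℂ) = 1 + 1 + 1 + 1 by norm_num]; simp only [add_smul, one_smul]; abel]
  rw [smul_smul]
  norm_num

/-- Multiplication by the permanent maps `ã₀ⱼ` to the opposite entry, so specialising the permanent
to `e` forces the second row to be `e (b, a)`. -/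
theorem isMinusOneOrthogonal {e : ℂ} (he : e * e = 1) :
    IsMinusOneOrthogonal !![a, b; e • b, e • a] := by
  have h1 := a_sq_add_b_sq
  have h1' : b * b + a * a = 1 := by rw [add_comm, h1]
  have h2 := a_mul_b
  refine ⟨?_, ?_, ?_, ?_, ?_⟩
  · ext i j
    fin_cases i <;> fin_cases j <;>
      simp [Matrix.mul_apply, smul_smul, he, h1, h1', h2]
  · ext i j
    fin_cases i <;> fin_cases j <;>
      simp [Matrix.mul_apply, smul_smul, he, h1, h1', h2]
  · intro i j k hjk
    fin_cases i <;> fin_cases j <;> fin_cases k <;> first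
      | exact absurd rfl hjk
      | simp [h2]
  · intro i j k hik
    fin_cases i <;> fin_cases j <;> fin_cases k <;> first
      | exact absurd rfl hik
      | simp [h2]
  · intro i j k l hik hjl
    fin_cases i <;> fin_cases j <;> fin_cases k <;> fin_cases l <;> first
      | exact absurd rfl hik
      | exact absurd rfl hjl
      | simp

/-- The homomorphism `Pol(O₋₁(2)) → ℂ[D∞]` that sends the permanent to `e = ±1`. -/
noncomputable def hom (e : ℂ) (he : e * e = 1) : PolO2 →ₐ[ℂ] GrpAlg :=
  Pol.lift _ ((satisfies_ORel_iff _).2 (isMinusOneOrthogonal he))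

theorem hom_gen (e : ℂ) (he : e * e = 1) :
    (Pol.gen (ORel 2)).map (hom e he) = !![a, b; e • b, e • a] := by
  ext1 i j
  exact Pol.lift_gen _ _ i j

theorem hom_perm2 (e : ℂ) (he : e * e = 1) : hom e he (perm2 (Pol.gen (ORel 2))) = e • 1 := by
  have h : perm2 ((Pol.gen (ORel 2)).map (hom e he)) = hom e he (perm2 (Pol.gen (ORel 2))) := by
    simp [perm2]
  rw [← h, hom_gen, ← a_sq_add_b_sq]
  simp [perm2]

end GrpAlg

end MinusOne

/-! ### Joint injectivity of the two homomorphisms, and their twisted comultiplication. -/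

namespace MinusOne

namespace GrpAlg

theorem perm2_gen_commute (z : PolO2) :
    perm2 (Pol.gen (ORel 2)) * z = z * perm2 (Pol.gen (ORel 2)) := by
  induction z using Pol.induction with
  | algebraMap c => exact (Algebra.commutes _ _).symm
  | gen i j => exact (ORel.isMinusOneOrthogonal 2).perm2_commute i j
  | mul x y hx hy => rw [← mul_assoc, hx, mul_assoc, hy, mul_assoc]
  | add x y hx hy => rw [mul_add, hx, hy, add_mul]

/-- There is a section on `ℂ[D∞]` of the homomorphisms to `ℂ[D∞]`, up to the sign of the
permanent. -/
theorem exists_section : ∃ ψ : GrpAlg →ₐ[ℂ] PolO2,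
    ψ a = Pol.gen (ORel 2) 0 0 ∧ ψ b = Pol.gen (ORel 2) 0 1 := by
  have h := ORel.isMinusOneOrthogonal 2
  set x := Pol.gen (ORel 2) 0 0
  set y := Pol.gen (ORel 2) 0 1
  have h1 : x * x + y * y = 1 := h.relations.1.1
  have h2 : x * y = -(y * x) := h.row 0 0 1 (by decide)
  -- As `x` and `y` anticommute and their squares sum to one, `x ± y` are involutions and define a
  -- homomorphism from the infinite dihedral group.
  have hs : (x + y) * (x + y) = 1 := by
    rw [← h1, add_mul, mul_add, mul_add, h2]
    abel
  have ht : (x - y) * (x - y) = 1 := by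
    rw [← h1, sub_mul, mul_sub, mul_sub, h2]
    abel
  let S : PolO2ˣ := ⟨x + y, x + y, hs, hs⟩
  let T : PolO2ˣ := ⟨x - y, x - y, ht, ht⟩
  let F : DInf →* PolO2 := (Units.coeHom PolO2).comp (DInf.lift S T (Units.ext hs) (Units.ext ht))
  have hFs : MonoidAlgebra.lift ℂ PolO2 DInf F s = x + y := by
    rw [s, MonoidAlgebra.lift_single, one_smul]
    exact congrArg Units.val (DInf.lift_sr_zero S T (Units.ext hs) (Units.ext ht))
  have hFt : MonoidAlgebra.lift ℂ PolO2 DInf F t = x - y := by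
    rw [t, MonoidAlgebra.lift_single, one_smul]
    exact congrArg Units.val (DInf.lift_sr_one S T (Units.ext hs) (Units.ext ht))
  have e : ∀ z : PolO2, (1 / 2 : ℂ) • (z + z) = z := fun z => by
    rw [← two_smul ℂ, smul_smul]; norm_num
  refine ⟨MonoidAlgebra.lift ℂ PolO2 DInf F, ?_, ?_⟩
  · rw [a, map_smul, map_add, hFs, hFt, add_add_sub_cancel, e]
  · rw [b, map_smul, map_sub, hFs, hFt, add_sub_sub_cancel, e]

theorem neg_one_mul_self : (-1 : ℂ) * -1 = 1 := by norm_num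

/-- The two homomorphisms to `ℂ[D∞]` are jointly injective. -/
theorem hom_ext {z w : PolO2} (h1 : hom 1 (one_mul 1) z = hom 1 (one_mul 1) w)
    (h2 : hom (-1) neg_one_mul_self z = hom (-1) neg_one_mul_self w) : z = w := by
  obtain ⟨ψ, ha, hb⟩ := exists_section
  have h := ORel.isMinusOneOrthogonal 2
  set p := perm2 (Pol.gen (ORel 2)) with hp
  have hpp : p * p = 1 := h.perm2_mul_self
  have hpc : ∀ z, p * z = z * p := perm2_gen_commute
  -- The elements `(1 ± p)/2` are complementary central idempotents. On their ranges `p` acts as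
  -- `±1` and `ψ` inverts the corresponding homomorphism, so `z` is recovered from its two images.
  have key : ∀ z : PolO2, (2 : ℂ) • z = (1 + p) * ψ (hom 1 (one_mul 1) z) +
      (1 - p) * ψ (hom (-1) neg_one_mul_self z) := by
    intro z
    induction z using Pol.induction with
    | algebraMap c =>
      simp only [AlgHom.commutes, ← add_mul]
      rw [add_add_sub_cancel, one_add_one_eq_two, Algebra.smul_def, map_ofNat]
    | gen i j =>
      have e1 := congrFun (congrFun (hom_gen 1 (one_mul 1)) i) j
      have e2 := congrFun (congrFun (hom_gen (-1) neg_one_mul_self) i) j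
      rw [Matrix.map_apply] at e1 e2
      rw [e1, e2]
      have p0 : p * Pol.gen (ORel 2) 0 0 = Pol.gen (ORel 2) 1 1 := h.perm2_mul_00
      have p1 : p * Pol.gen (ORel 2) 0 1 = Pol.gen (ORel 2) 1 0 := h.perm2_mul_01
      fin_cases i <;> fin_cases j <;>
        simp [ha, hb, add_mul, sub_mul, p0, p1, two_smul] <;> abel
    | mul x y hx hy =>
      -- Multiplying two instances of the doubled formula gives four times the product; a factor two
      -- is cancelled afterwards.
      have e : (4 : ℂ) • (x * y) = (2 : ℂ) • ((1 + p) * ψ (hom 1 (one_mul 1) (x * y)) +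
          (1 - p) * ψ (hom (-1) neg_one_mul_self (x * y))) := by
        have e1 : (4 : ℂ) • (x * y) = ((2 : ℂ) • x) * ((2 : ℂ) • y) := by
          rw [smul_mul_smul_comm]; norm_num
        have e2 : ∀ q c d : PolO2, q * c = c * q → q * q = (2 : ℂ) • q →
            q * c * (q * d) = (2 : ℂ) • (q * (c * d)) := by
          intro q c d hq hqq
          rw [hq, mul_assoc, ← mul_assoc q, hqq, smul_mul_assoc, mul_smul_comm, ← mul_assoc,
            ← hq, mul_assoc]
        have e3 : ∀ q q' c d : PolO2, q' * c = c * q' → q' * q = 0 → q * q' = 0 →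
            q * c * (q' * d) = 0 := by
          intro q q' c d hq _ hqq
          rw [mul_assoc, ← mul_assoc c, ← hq, mul_assoc, ← mul_assoc, hqq, zero_mul]
        have c1 : ∀ z, (1 + p) * z = z * (1 + p) := fun z => by
          rw [add_mul, mul_add, hpc, one_mul, mul_one]
        have c2 : ∀ z, (1 - p) * z = z * (1 - p) := fun z => by
          rw [sub_mul, mul_sub, hpc, one_mul, mul_one]
        have q1 : (1 + p) * (1 + p) = (2 : ℂ) • (1 + p) := by
          rw [add_mul, mul_add, mul_add, hpp, two_smul]; simp only [one_mul, mul_one]; abel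
        have q2 : (1 - p) * (1 - p) = (2 : ℂ) • (1 - p) := by
          rw [sub_mul, mul_sub, mul_sub, hpp, two_smul]; simp only [one_mul, mul_one]; abel
        have q3 : (1 + p) * (1 - p) = 0 := by
          rw [add_mul, mul_sub, mul_sub, hpp]; simp
        have q4 : (1 - p) * (1 + p) = 0 := by
          rw [sub_mul, mul_add, mul_add, hpp]; simp [add_comm]
        rw [e1, hx, hy, add_mul, mul_add, mul_add, e2 _ _ _ (c1 _) q1, e2 _ _ _ (c2 _) q2,
          e3 _ _ _ _ (c2 _) q4 q3, e3 _ _ _ _ (c1 _) q3 q4]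
        simp
      rw [show (4 : ℂ) = 2 * 2 by norm_num, mul_smul] at e
      exact smul_right_injective _ (two_ne_zero (α := ℂ)) e
    | add x y hx hy => simp only [smul_add, hx, hy, map_add, mul_add]; abel
  refine smul_right_injective _ (two_ne_zero (α := ℂ)) ?_
  simp only [key, h1, h2]

/-- The endomorphism of the group algebra given by an endomorphism of the group. -/
noncomputable abbrev mapHom (τ : DInf →* DInf) : GrpAlg →ₐ[ℂ] GrpAlg :=
  MonoidAlgebra.mapDomainAlgHom ℂ ℂ τ

theorem comul_a : Coalgebra.comul (R := ℂ) a = a ⊗ₜ[ℂ] a + b ⊗ₜ[ℂ] b := by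
  have hs : Coalgebra.comul (R := ℂ) s = s ⊗ₜ[ℂ] s := by simp [s]
  have ht : Coalgebra.comul (R := ℂ) t = t ⊗ₜ[ℂ] t := by simp [t]
  simp only [a, b, map_smul, map_add, hs, ht, TensorProduct.smul_tmul_smul, TensorProduct.add_tmul,
    TensorProduct.tmul_add, TensorProduct.sub_tmul, TensorProduct.tmul_sub, ← smul_add]
  rw [show s ⊗ₜ[ℂ] s + t ⊗ₜ[ℂ] s + (s ⊗ₜ[ℂ] t + t ⊗ₜ[ℂ] t) +
    (s ⊗ₜ[ℂ] s - t ⊗ₜ[ℂ] s - (s ⊗ₜ[ℂ] t - t ⊗ₜ[ℂ] t)) = (2 : ℂ) • (s ⊗ₜ[ℂ] s + t ⊗ₜ[ℂ] t) by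
      rw [two_smul]; abel, smul_smul]
  norm_num

theorem comul_b : Coalgebra.comul (R := ℂ) b = a ⊗ₜ[ℂ] b + b ⊗ₜ[ℂ] a := by
  have hs : Coalgebra.comul (R := ℂ) s = s ⊗ₜ[ℂ] s := by simp [s]
  have ht : Coalgebra.comul (R := ℂ) t = t ⊗ₜ[ℂ] t := by simp [t]
  simp only [a, b, map_smul, map_sub, hs, ht, TensorProduct.smul_tmul_smul, TensorProduct.add_tmul,
    TensorProduct.tmul_add, TensorProduct.sub_tmul, TensorProduct.tmul_sub, ← smul_add]
  rw [show s ⊗ₜ[ℂ] s + t ⊗ₜ[ℂ] s - (s ⊗ₜ[ℂ] t + t ⊗ₜ[ℂ] t) +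
    (s ⊗ₜ[ℂ] s - t ⊗ₜ[ℂ] s + (s ⊗ₜ[ℂ] t - t ⊗ₜ[ℂ] t)) = (2 : ℂ) • (s ⊗ₜ[ℂ] s - t ⊗ₜ[ℂ] t) by
      rw [two_smul]; abel, smul_smul]
  norm_num

/-- The permanent is group-like, so the signs multiply. The sign `e'` of the second leg can be moved
to `b` in the first leg, where it is effected by `τ`: the identity for `e' = 1` and the twist for
`e' = -1`. -/
theorem map_hom_comul {e e' : ℂ} (he : e * e = 1) (he' : e' * e' = 1)
    (hee : (e * e') * (e * e') = 1) {τ : DInf →* DInf}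
    (ha : mapHom τ a = a) (hb : mapHom τ b = e' • b) (z : PolO2) :
    TensorProduct.map (hom e he).toLinearMap (hom e' he').toLinearMap
      (Coalgebra.comul (R := ℂ) z) =
    TensorProduct.map (mapHom τ).toLinearMap LinearMap.id
      (Coalgebra.comul (R := ℂ) (hom (e * e') hee z)) := by
  have h : (Algebra.TensorProduct.map (hom e he) (hom e' he')).comp
      (Bialgebra.comulAlgHom ℂ PolO2) =
      ((Algebra.TensorProduct.map (mapHom τ) (AlgHom.id ℂ _)).comp
        (Bialgebra.comulAlgHom ℂ GrpAlg)).comp (hom (e * e') hee) := by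
    apply Pol.hom_ext
    intro i j
    have e1 := fun i j => congrFun (congrFun (hom_gen e he) i) j
    have e2 := fun i j => congrFun (congrFun (hom_gen e' he') i) j
    have e3 := fun i j => congrFun (congrFun (hom_gen (e * e') hee) i) j
    simp only [Matrix.map_apply] at e1 e2 e3
    simp only [AlgHom.comp_apply, Bialgebra.comulAlgHom_apply, Pol.comul_gen, e3, Fin.sum_univ_two]
    fin_cases i <;> fin_cases j <;>
      simp [comul_a, comul_b, ha, hb, e1, e2, TensorProduct.smul_tmul', smul_smul, he', mul_assoc,
        add_comm, mul_comm e' e]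
  exact DFunLike.congr_fun h z

/-- The coefficient of a group element. -/
noncomputable def coeffLin (g : DInf) : GrpAlg →ₗ[ℂ] ℂ where
  toFun x := x.coeff g
  map_add' _ _ := rfl
  map_smul' _ _ := rfl

theorem coeffLin_single (g h : DInf) (c : ℂ) :
    coeffLin g (MonoidAlgebra.single h c) = if h = g then c else 0 :=
  Finsupp.single_apply

/-- A group element `k` contributes `τ k ⊗ k`, whose coefficient at `(g, h)` is seen only for `k =
h` and `g = τ h`. -/
theorem coeffLin_comul (τ : DInf →* DInf) (g h : DInf) (x : GrpAlg) :
    LinearMap.mul' ℂ ℂ (TensorProduct.map (coeffLin g) (coeffLin h)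
      (TensorProduct.map (mapHom τ).toLinearMap LinearMap.id (Coalgebra.comul (R := ℂ) x))) =
      if g = τ h then coeffLin h x else 0 := by
  induction x using MonoidAlgebra.induction_linear with
  | zero => simp
  | add x y hx hy =>
    simp only [map_add, hx, hy]
    split_ifs <;> simp
  | single k c =>
    simp [coeffLin_single]
    by_cases hk : k = h
    · subst hk
      simp [eq_comm (a := g)]
    · simp [hk]

end GrpAlg

end MinusOne

namespace MinusOne

/-! ### Idempotent matrices -/

theorem IsIdempotentElem.matrix_trace_eq_rank {n : ℕ} {M : Matrix (Fin n) (Fin n) ℂ}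
    (h : M * M = M) : M.trace = M.rank := by
  have h1 : IsIdempotentElem (Matrix.toLin' M) := by
    rw [IsIdempotentElem, Module.End.mul_eq_comp, ← Matrix.toLin'_mul, h]
  have := (LinearMap.IsIdempotentElem.isProj_range _ h1).trace
  rw [Matrix.trace_toLin'_eq] at this
  exact this

theorem exists_eq_vecMulVec {n : ℕ} {M : Matrix (Fin n) (Fin n) ℂ} (h : M.rank = 1) :
    ∃ x y : Fin n → ℂ, ∀ i j, M i j = x i * y j := by
  obtain ⟨v, -, hv⟩ := finrank_eq_one_iff'.1 h
  have : ∀ j, ∃ c : ℂ, ∀ i, M i j = v.1 i * c := by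
    intro j
    obtain ⟨c, hc⟩ := hv ⟨M.mulVecLin (Pi.single j 1), LinearMap.mem_range_self _ _⟩
    refine ⟨c, fun i => ?_⟩
    have := congrFun (congrArg Subtype.val hc) i
    simp at this
    rw [← this, mul_comm]
  choose y hy using this
  exact ⟨v.1, y, fun i j => hy j i⟩

/-- A symmetric idempotent matrix of trace one. -/
theorem exists_eq_mul_self {n : ℕ} {M : Matrix (Fin n) (Fin n) ℂ} (h : M * M = M)
    (ht : M.transpose = M) (hr : M.rank = 1) : ∃ v : Fin n → ℂ, (∀ i j, M i j = v i * v j) ∧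
      ∑ i, v i * v i = 1 := by
  obtain ⟨x, y, hxy⟩ := exists_eq_vecMulVec hr
  have h1 : ∑ i, x i * y i = 1 := by
    have := IsIdempotentElem.matrix_trace_eq_rank h
    rw [hr, Matrix.trace] at this
    simpa [hxy] using this
  have h2 : ∀ i j, x i * y j = x j * y i := fun i j => by
    rw [← hxy, ← hxy]
    exact congrFun (congrFun ht j) i
  set q := ∑ i, x i * x i
  have h3 : ∀ j, x j = q * y j := by
    intro j
    calc x j = x j * ∑ i, x i * y i := by rw [h1, mul_one]
      _ = ∑ i, x i * (x j * y i) := by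
          rw [Finset.mul_sum]
          exact Finset.sum_congr rfl fun i _ => by ring
      _ = q * y j := by
          rw [Finset.sum_mul]
          exact Finset.sum_congr rfl fun i _ => by rw [← h2, mul_assoc]
  have hq : q ≠ 0 := by
    intro hq
    simp [h3, hq] at h1
  -- Since `x = q y`, the matrix is `x xᵀ / q`; a square root of `q` splits the scalar evenly.
  obtain ⟨w, hw⟩ := IsAlgClosed.exists_pow_nat_eq q (n := 2) two_pos
  have hw0 : w ≠ 0 := by
    rintro rfl
    exact hq (by rw [← hw]; simp)
  have hv : ∀ i j, M i j = x i / w * (x j / w) := by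
    intro i j
    rw [hxy, h3 j, div_mul_div_comm, ← sq, hw]
    field_simp
  refine ⟨fun i => x i / w, hv, ?_⟩
  rw [← h1]
  exact Finset.sum_congr rfl fun i _ => by rw [← hv, hxy]

/-! ### Matrix coefficients of corepresentations -/

section Coefficients

open GrpAlg

theorem mapHom_id (x : GrpAlg) : mapHom (MonoidHom.id DInf) x = x := by
  induction x using MonoidAlgebra.induction_linear with
  | zero => simp
  | add x y hx hy => rw [map_add, hx, hy]
  | single g c => simp

theorem mapHom_twist_s : mapHom DInf.twist s = t := by
  simp [s, t, DInf.twist_sr]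

theorem mapHom_twist_t : mapHom DInf.twist t = s := by
  simp [s, t, DInf.twist_sr]

theorem mapHom_twist_a : mapHom DInf.twist a = a := by
  rw [a, map_smul, map_add, mapHom_twist_s, mapHom_twist_t, add_comm]

theorem mapHom_twist_b : mapHom DInf.twist b = (-1 : ℂ) • b := by
  rw [b, map_smul, map_sub, mapHom_twist_s, mapHom_twist_t, neg_one_smul, ← smul_neg, neg_sub]

/-- The matrix of coefficients at a group element. -/
noncomputable def coeffMat {n : ℕ} (e : ℂ) (he : e * e = 1) (u : Matrix (Fin n) (Fin n) PolO2)
    (g : DInf) : Matrix (Fin n) (Fin n) ℂ :=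
  Matrix.of fun i j => coeffLin g (hom e he (u i j))

variable {n : ℕ} {u : Matrix (Fin n) (Fin n) PolO2}

/-- Apply the two homomorphisms and then the coefficient functionals at `g` and `h` to `Δ(uᵢⱼ) = ∑
uᵢₖ ⊗ uₖⱼ`: one side is the matrix product, the other is evaluated by the twisted comultiplication.
-/
theorem coeffMat_mul (hc : IsCorep u) {e e' e'' : ℂ} (he : e * e = 1) (he' : e' * e' = 1)
    (he'' : e'' * e'' = 1) (hee : e * e' = e'') {τ : DInf →* DInf}
    (ha : mapHom τ a = a) (hb : mapHom τ b = e' • b) (g h : DInf) :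
    coeffMat e he u g * coeffMat e' he' u h =
      if g = τ h then coeffMat e'' he'' u h else 0 := by
  subst hee
  ext i j
  have := coeffLin_comul τ g h (hom (e * e') he'' (u i j))
  rw [← map_hom_comul he he' he'' ha hb, hc i j] at this
  simp only [map_sum, TensorProduct.map_tmul, LinearMap.mul'_apply, AlgHom.toLinearMap_apply]
    at this
  rw [Matrix.mul_apply]
  refine this.trans ?_
  split_ifs <;> rfl

theorem coeffMat_one_mul (hc : IsCorep u) {e : ℂ} (he : e * e = 1) (g h : DInf) :
    coeffMat e he u g * coeffMat 1 (one_mul 1) u h =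
      if g = h then coeffMat e he u h else 0 :=
  coeffMat_mul hc he (one_mul 1) he (mul_one e) (τ := MonoidHom.id DInf) (mapHom_id _)
    ((mapHom_id _).trans (one_smul ℂ b).symm) g h

theorem coeffMat_neg_one_mul (hc : IsCorep u) {e e' : ℂ} (he : e * e = 1) (he' : e' * e' = 1)
    (hee : -e = e') (g h : DInf) :
    coeffMat e he u g * coeffMat (-1) neg_one_mul_self u h =
      if g = DInf.twist h then coeffMat e' he' u h else 0 :=
  coeffMat_mul hc he neg_one_mul_self he' (by rw [← hee, mul_neg_one]) mapHom_twist_a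
    mapHom_twist_b g h

/-- `F` collects the supports of all entries in both group algebras. The augmentation sends every
group element to one, hence sums the coefficient matrices. -/
theorem exists_finset_coeffMat (u : Matrix (Fin n) (Fin n) PolO2) : ∃ F : Finset DInf,
    (∀ g, g ∉ F → coeffMat 1 (one_mul 1) u g = 0 ∧ coeffMat (-1) neg_one_mul_self u g = 0) ∧
    (∀ (e : ℂ) (he : e * e = 1), e = 1 ∨ e = -1 →
      u.map (((MonoidAlgebra.lift ℂ ℂ DInf) 1).comp (hom e he)) = ∑ g ∈ F, coeffMat e he u g) := by
  let F : Finset DInf := Finset.univ.biUnion fun p : Fin n × Fin n =>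
    (hom 1 (one_mul 1) (u p.1 p.2)).coeff.support ∪
      (hom (-1) neg_one_mul_self (u p.1 p.2)).coeff.support
  have hF : ∀ g, g ∉ F → ∀ i j, coeffLin g (hom 1 (one_mul 1) (u i j)) = 0 ∧
      coeffLin g (hom (-1) neg_one_mul_self (u i j)) = 0 := by
    intro g hg i j
    simp only [F, Finset.mem_biUnion, Finset.mem_univ, true_and, not_exists, Finset.mem_union,
      not_or, Finsupp.mem_support_iff, not_not] at hg
    exact hg (i, j)
  refine ⟨F, fun g hg => ⟨?_, ?_⟩, ?_⟩
  · ext i j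
    exact (hF g hg i j).1
  · ext i j
    exact (hF g hg i j).2
  · intro e he hee
    ext i j
    rw [Matrix.sum_apply, Matrix.map_apply, AlgHom.comp_apply, MonoidAlgebra.lift_apply,
      Finsupp.sum_of_support_subset (s := F)]
    · simp [coeffMat]
      rfl
    · intro g hg
      by_contra hgF
      rcases hee with rfl | rfl
      · exact Finsupp.mem_support_iff.1 hg (hF g hgF i j).1
      · exact Finsupp.mem_support_iff.1 hg (hF g hgF i j).2
    · simp

end Coefficients

end MinusOne

/-! ### Rank count for the coefficient matrices. -/

namespace MinusOne

open GrpAlg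

/-- The multiplication table of the coefficient matrices of a corepresentation. -/
structure CoeffTable (P Q : DInf → Matrix (Fin 3) (Fin 3) ℂ) (F : Finset DInf) : Prop where
  zero : ∀ g, g ∉ F → P g = 0 ∧ Q g = 0
  pp : ∀ g h, P g * P h = if g = h then P h else 0
  qp : ∀ g h, Q g * P h = if g = h then Q h else 0
  pq : ∀ g h, P g * Q h = if g = DInf.twist h then Q h else 0
  qq : ∀ g h, Q g * Q h = if g = DInf.twist h then P h else 0
  orth : (∑ g ∈ F, P g) * (∑ g ∈ F, P g).transpose = 1

namespace CoeffTable

variable {P Q : DInf → Matrix (Fin 3) (Fin 3) ℂ} {F : Finset DInf}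

/-- The sum is idempotent by `pp` and invertible on the right by `orth`. -/
theorem sum_eq_one (h : CoeffTable P Q F) : ∑ g ∈ F, P g = 1 := by
  have h1 : (∑ g ∈ F, P g) * ∑ g ∈ F, P g = ∑ g ∈ F, P g := by
    simp only [Finset.sum_mul_sum, h.pp]
    refine Finset.sum_congr rfl fun g hg => ?_
    rw [Finset.sum_ite_eq, if_pos hg]
  calc ∑ g ∈ F, P g = (∑ g ∈ F, P g) * ((∑ g ∈ F, P g) * (∑ g ∈ F, P g).transpose) := by
        rw [h.orth, Matrix.mul_one]
    _ = 1 := by rw [← Matrix.mul_assoc, h1, h.orth]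

theorem mul_p (h : CoeffTable P Q F) (g : DInf) : (∑ k ∈ F, Q k) * P g = Q g := by
  simp only [Finset.sum_mul, h.qp, Finset.sum_ite_eq']
  split_ifs with hg
  · rfl
  · exact (h.zero g hg).2.symm

theorem mul_q (h : CoeffTable P Q F) (g : DInf) : (∑ k ∈ F, Q k) * Q g = P g := by
  simp only [Finset.sum_mul, h.qq, Finset.sum_ite_eq']
  split_ifs with hg
  · rfl
  -- `F` is not assumed stable under the twist. If the twist of `g` lies outside, its `Q` vanishes,
  -- and `qq` shows that `P g` vanishes too.
  · have := h.qq (DInf.twist g) g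
    rw [if_pos rfl, (h.zero _ hg).2, Matrix.zero_mul] at this
    exact this

theorem p_mul (h : CoeffTable P Q F) (g : DInf) : P (DInf.twist g) * (∑ k ∈ F, Q k) = Q g := by
  have : ∀ k, P (DInf.twist g) * Q k = if g = k then Q k else 0 := by
    intro k
    rw [h.pq]
    congr 1
    exact propext ⟨fun hk => by simpa using congrArg DInf.twist hk, fun hk => by rw [hk]⟩
  simp only [Finset.mul_sum, this, Finset.sum_ite_eq]
  split_ifs with hg
  · rfl
  · exact (h.zero g hg).2.symm

theorem mul_self (h : CoeffTable P Q F) : (∑ k ∈ F, Q k) * (∑ k ∈ F, Q k) = 1 := by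
  conv_lhs => rw [Finset.mul_sum]
  simp only [h.mul_q, h.sum_eq_one]

theorem idem (h : CoeffTable P Q F) (g : DInf) : P g * P g = P g := by
  rw [h.pp, if_pos rfl]

/-- Conjugation by the involution `∑ Q k` carries `P g` to `P (twist g)`; for idempotents the rank
is the trace. -/
theorem rank_twist (h : CoeffTable P Q F) (g : DInf) : (P (DInf.twist g)).rank = (P g).rank := by
  have h1 : P (DInf.twist g) = (∑ k ∈ F, Q k) * P g * (∑ k ∈ F, Q k) := by
    rw [h.mul_p, ← h.p_mul g, Matrix.mul_assoc, h.mul_self, Matrix.mul_one]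
  have h2 : (P (DInf.twist g)).trace = (P g).trace := by
    rw [h1, Matrix.trace_mul_comm, ← Matrix.mul_assoc, h.mul_self, Matrix.one_mul]
  rw [IsIdempotentElem.matrix_trace_eq_rank (h.idem _),
    IsIdempotentElem.matrix_trace_eq_rank (h.idem _)] at h2
  exact_mod_cast h2

theorem _root_.Matrix.eq_zero_of_rank_eq_zero {n : ℕ} {M : Matrix (Fin n) (Fin n) ℂ}
    (hM : M.rank = 0) : M = 0 := by
  have : M.mulVecLin.range = ⊥ := Submodule.finrank_eq_zero.1 hM
  rw [LinearMap.range_eq_bot] at this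
  ext i j
  simpa using congrFun (LinearMap.congr_fun this (Pi.single j 1)) i

theorem sum_rank (h : CoeffTable P Q F) : ∑ g ∈ F, (P g).rank = 3 := by
  have h1 : ((∑ g ∈ F, (P g).rank : ℕ) : ℂ) = 3 := by
    push_cast
    simp only [← IsIdempotentElem.matrix_trace_eq_rank (h.idem _), ← Matrix.trace_sum,
      h.sum_eq_one, Matrix.trace_one, Fintype.card_fin, Nat.cast_ofNat]
  exact_mod_cast h1

theorem sum_rank_le (h : CoeffTable P Q F) (G : Finset DInf) : ∑ g ∈ G, (P g).rank ≤ 3 := by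
  refine le_of_le_of_eq ?_ h.sum_rank
  rw [← Finset.sum_filter_of_ne (s := G) (p := (· ∈ F))]
  · exact Finset.sum_le_sum_of_subset fun g hg => (Finset.mem_filter.1 hg).2
  · intro g _ hg
    by_contra hgF
    exact hg (by rw [(h.zero g hgF).1, Matrix.rank_zero])

/-- The total rank is three, and away from the identity it comes in pairs `{g, twist g}` of equal
rank. A second pair, or rank two on the first, would need four dimensions; the one dimension left
over sits at the identity. -/
theorem support (h : CoeffTable P Q F) {g : DInf} (hg1 : g ≠ 1) (hg : P g ≠ 0) :
    (P 1).rank = 1 ∧ (P g).rank = 1 ∧ (P (DInf.twist g)).rank = 1 ∧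
      (∀ k, k ≠ 1 → k ≠ g → k ≠ DInf.twist g → P k = 0) ∧
      P g + P (DInf.twist g) + P 1 = 1 := by
  have hr : 1 ≤ (P g).rank := Nat.one_le_iff_ne_zero.2 fun h0 => hg (Matrix.eq_zero_of_rank_eq_zero h0)
  have htg := h.rank_twist g
  have hgt : g ≠ DInf.twist g := (DInf.twist_ne hg1).symm
  have h1t : DInf.twist g ≠ 1 := fun h0 => hg1 (by rw [← DInf.twist_twist g, h0, map_one])
  have h0 : ∀ k, k ≠ 1 → k ≠ g → k ≠ DInf.twist g → P k = 0 := by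
    intro k hk1 hkg hkt
    apply Matrix.eq_zero_of_rank_eq_zero
    have htk := h.rank_twist k
    have hkk : k ≠ DInf.twist k := (DInf.twist_ne hk1).symm
    have e1 : g ≠ DInf.twist k := fun e => hkt (by rw [e, DInf.twist_twist])
    have e2 : DInf.twist g ≠ DInf.twist k := fun e => hkg (by
      rw [← DInf.twist_twist g, e, DInf.twist_twist])
    have := h.sum_rank_le {g, DInf.twist g, k, DInf.twist k}
    rw [Finset.sum_insert (by simp [hgt, hkg.symm, e1]),
      Finset.sum_insert (by simp [hkt.symm, e2]),
      Finset.sum_insert (by simp [hkk]), Finset.sum_singleton] at this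
    omega
  have hsum : ∀ {M : Type} [AddCommMonoid M] (φ : DInf → M), (∀ k, P k = 0 → φ k = 0) →
      ∑ k ∈ F, φ k = φ g + φ (DInf.twist g) + φ 1 := by
    intro M _ φ hφ
    have : ∑ k ∈ F, φ k = ∑ k ∈ ({g, DInf.twist g, 1} : Finset DInf), φ k := by
      refine (Finset.sum_subset (Finset.subset_union_left (s₂ := {g, DInf.twist g, 1}))
        fun k _ hk => hφ k (h.zero k hk).1).trans
        (Finset.sum_subset Finset.subset_union_right fun k _ hk => ?_).symm
      simp only [Finset.mem_insert, Finset.mem_singleton, not_or] at hk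
      exact hφ k (h0 k hk.2.2 hk.1 hk.2.1)
    rw [this, Finset.sum_insert (by simp [hgt, hg1]), Finset.sum_insert (by simp [h1t]),
      Finset.sum_singleton, add_assoc]
  have h3 := h.sum_rank
  rw [hsum (fun k => (P k).rank) fun k hk => by rw [hk, Matrix.rank_zero]] at h3
  refine ⟨by omega, by omega, by omega, h0, ?_⟩
  rw [← h.sum_eq_one, hsum P fun _ => id]

end CoeffTable

/-- Besides the products, the augmentation of each image of `u` is an orthogonal scalar matrix; for
the sign `-1` this is the orthogonality of `∑ Q g`. -/
theorem exists_coeffTable {u : Matrix (Fin 3) (Fin 3) PolO2} (hc : IsCorep u)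
    (ho : IsMinusOneOrthogonal u) : ∃ F : Finset DInf,
      CoeffTable (coeffMat 1 (one_mul 1) u) (coeffMat (-1) neg_one_mul_self u) F ∧
      (∑ g ∈ F, coeffMat (-1) neg_one_mul_self u g) *
        (∑ g ∈ F, coeffMat (-1) neg_one_mul_self u g).transpose = 1 := by
  obtain ⟨F, hF, hE⟩ := exists_finset_coeffMat u
  have h1 := fun (e : ℂ) (he : e * e = 1) (hee : e = 1 ∨ e = -1) =>
    (hE e he hee) ▸ (ho.map (((MonoidAlgebra.lift ℂ ℂ DInf) 1).comp (hom e he)).toRingHom).mul_transpose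
  exact ⟨F, ⟨hF, coeffMat_one_mul hc _, coeffMat_one_mul hc _,
    coeffMat_neg_one_mul hc _ _ rfl, coeffMat_neg_one_mul hc _ _ (neg_neg 1),
    h1 1 _ (Or.inl rfl)⟩, h1 (-1) _ (Or.inr rfl)⟩

end MinusOne

/-! ### Surjectivity singles out the two generating reflections. -/

namespace MinusOne

open GrpAlg

theorem hom_add_gen : hom 1 (one_mul 1) (Pol.gen (ORel 2) 0 0 + Pol.gen (ORel 2) 0 1) = s ∧
    hom 1 (one_mul 1) (Pol.gen (ORel 2) 0 0 - Pol.gen (ORel 2) 0 1) = t := by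
  have e0 : hom 1 (one_mul 1) (Pol.gen (ORel 2) 0 0) = a :=
    congrFun (congrFun (hom_gen 1 (one_mul 1)) 0) 0
  have e1 : hom 1 (one_mul 1) (Pol.gen (ORel 2) 0 1) = b :=
    congrFun (congrFun (hom_gen 1 (one_mul 1)) 0) 1
  rw [map_add, map_sub, e0, e1, a, b, ← smul_add, ← smul_sub, add_add_sub_cancel,
    add_sub_sub_cancel, ← two_smul ℂ s, ← two_smul ℂ t, smul_smul, smul_smul]
  norm_num

theorem Pol.commute_of_gen {n : ℕ} {r : FreeMat n → FreeMat n → Prop} {C : Type} [Ring C]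
    [Algebra ℂ C] (χ : Pol r →ₐ[ℂ] C)
    (h : ∀ i j k l, Commute (χ (Pol.gen r i j)) (χ (Pol.gen r k l))) (x y : Pol r) :
    Commute (χ x) (χ y) := by
  induction x using Pol.induction with
  | algebraMap c => rw [AlgHom.commutes]; exact Algebra.commute_algebraMap_left _ _
  | gen i j =>
    induction y using Pol.induction with
    | algebraMap c => rw [AlgHom.commutes]; exact Algebra.commute_algebraMap_right _ _
    | gen k l => exact h i j k l
    | mul a b ha hb => rw [map_mul]; exact ha.mul_right hb
    | add a b ha hb => rw [map_add]; exact ha.add_right hb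
  | mul a b ha hb => rw [map_mul]; exact ha.mul_left hb
  | add a b ha hb => rw [map_add]; exact ha.add_left hb

/-- If the images of the entries in the group algebra of a finite dihedral group commute, then this
dihedral group is abelian. -/
theorem two_eq_zero_of_commute {f : PolSO3 →⋆ₐ[ℂ] PolO2} (hf : Function.Surjective f) (m : ℕ)
    (h : ∀ i j k l, Commute
      (MonoidAlgebra.mapDomainAlgHom ℂ ℂ (DInf.reduce m)
        (hom 1 (one_mul 1) (f (Pol.gen SORel i j))))
      (MonoidAlgebra.mapDomainAlgHom ℂ ℂ (DInf.reduce m)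
        (hom 1 (one_mul 1) (f (Pol.gen SORel k l))))) : (2 : ZMod m) = 0 := by
  obtain ⟨x, hx⟩ := hf (Pol.gen (ORel 2) 0 0 + Pol.gen (ORel 2) 0 1)
  obtain ⟨y, hy⟩ := hf (Pol.gen (ORel 2) 0 0 - Pol.gen (ORel 2) 0 1)
  have key := Pol.commute_of_gen (((MonoidAlgebra.mapDomainAlgHom ℂ ℂ (DInf.reduce m)).comp
    (hom 1 (one_mul 1))).comp f.toAlgHom) h x y
  have hx' : hom 1 (one_mul 1) (f x) = s := by rw [hx, hom_add_gen.1]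
  have hy' : hom 1 (one_mul 1) (f y) = t := by rw [hy, hom_add_gen.2]
  change Commute (MonoidAlgebra.mapDomainAlgHom ℂ ℂ (DInf.reduce m) (hom 1 (one_mul 1) (f x)))
    (MonoidAlgebra.mapDomainAlgHom ℂ ℂ (DInf.reduce m) (hom 1 (one_mul 1) (f y))) at key
  rw [hx', hy', s, t] at key
  have e0 : DInf.reduce m (.sr 0) = .sr 0 := congrArg DihedralGroup.sr Int.cast_zero
  have e1 : DInf.reduce m (.sr 1) = .sr 1 := congrArg DihedralGroup.sr Int.cast_one
  simp only [MonoidAlgebra.mapDomainAlgHom_apply, MonoidAlgebra.mapDomain_single, e0, e1] at key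
  have key2 := key.eq
  rw [MonoidAlgebra.single_mul_single, MonoidAlgebra.single_mul_single,
    MonoidAlgebra.single_left_inj (by norm_num)] at key2
  have key3 := DihedralGroup.r.inj key2
  rw [sub_zero, zero_sub] at key3
  rw [← one_add_one_eq_two]
  nth_rewrite 1 [key3]
  exact neg_add_cancel 1

theorem eq_single_add {x : GrpAlg} {g h k : DInf} (hgh : g ≠ h) (hgk : g ≠ k) (hhk : h ≠ k)
    (hx : ∀ l, l ≠ k → l ≠ g → l ≠ h → coeffLin l x = 0) :
    x = MonoidAlgebra.single g (coeffLin g x) + MonoidAlgebra.single h (coeffLin h x) +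
      MonoidAlgebra.single k (coeffLin k x) := by
  ext l
  change coeffLin l x = coeffLin l (_ + _ + _)
  rw [map_add, map_add, coeffLin_single, coeffLin_single, coeffLin_single]
  by_cases h1 : l = g
  · subst h1; simp [hgh.symm, hgk.symm]
  by_cases h2 : l = h
  · subst h2; simp [hgh, hhk.symm]
  by_cases h3 : l = k
  · subst h3; simp [hgk, hhk]
  rw [hx l h3 h1 h2]
  simp [Ne.symm h1, Ne.symm h2, Ne.symm h3]

theorem commute_single_add {G : Type} [Group G] {g h : G} (hgh : Commute g h) (c d : Fin 3 → ℂ) :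
    Commute (MonoidAlgebra.single g (c 0) + MonoidAlgebra.single h (c 1) +
        MonoidAlgebra.single 1 (c 2))
      (MonoidAlgebra.single g (d 0) + MonoidAlgebra.single h (d 1) +
        MonoidAlgebra.single 1 (d 2)) := by
  have e : ∀ {g h : G} (_ : Commute g h) (c d : ℂ),
      Commute (MonoidAlgebra.single g c) (MonoidAlgebra.single h d) := fun hgh c d =>
    MonoidAlgebra.single_commute_single hgh (mul_comm c d)
  refine Commute.add_left (Commute.add_left ?_ ?_) ?_ <;>
    refine Commute.add_right (Commute.add_right ?_ ?_) ?_ <;> apply e <;>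
    first | exact Commute.refl _ | exact hgh | exact hgh.symm | exact Commute.one_left _ |
      exact Commute.one_right _

/-- All entries lie in the span of `1`, `g` and `twist g`. In a dihedral quotient where the images
of `g` and `twist g` commute, surjectivity would make the quotient abelian. A rotation commutes with
its twist already in the infinite group (`m = 0`), which is absurd. The reflections `sr i` and `sr
(1 - i)` agree modulo `2i - 1`, which must therefore divide `2`; being odd, it is `±1`. -/
theorem twist_eq_of_commute {f : PolSO3 →⋆ₐ[ℂ] PolO2} (hf : Function.Surjective f) {g : DInf}
    (hg1 : g ≠ 1) (hg : ∀ k, k ≠ 1 → k ≠ g → k ≠ DInf.twist g →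
      coeffMat 1 (one_mul 1) ((Pol.gen SORel).map f) k = 0) :
    g = .sr 0 ∨ g = .sr 1 := by
  have h1t : DInf.twist g ≠ 1 := fun h0 => hg1 (by rw [← DInf.twist_twist g, h0, map_one])
  have hx : ∀ i j, hom 1 (one_mul 1) (f (Pol.gen SORel i j)) = _ := fun i j =>
    eq_single_add (DInf.twist_ne hg1).symm hg1 h1t fun l h1 h2 h3 =>
      congrFun (congrFun (hg l h1 h2 h3) i) j
  have key : ∀ m, Commute (DInf.reduce m g) (DInf.reduce m (DInf.twist g)) → (2 : ZMod m) = 0 := by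
    intro m hm
    refine two_eq_zero_of_commute hf m fun i j k l => ?_
    rw [hx i j, hx k l]
    simp only [MonoidAlgebra.mapDomainAlgHom_apply, map_add,
      MonoidAlgebra.mapDomain_single, map_one]
    exact commute_single_add hm ![_, _, _] ![_, _, _]
  rcases g with i | i
  · have := key 0 (by
      change _ * _ = _ * _
      rw [← map_mul, ← map_mul, DInf.twist_r, DihedralGroup.r_mul_r, DihedralGroup.r_mul_r,
        add_comm])
    exact absurd (show (2 : ℤ) = 0 from this) (by norm_num)
  · have h2 := key (2 * (show ℤ from i) - 1).natAbs (by
      have : DInf.reduce (2 * (show ℤ from i) - 1).natAbs (DInf.twist (.sr i)) =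
          DInf.reduce (2 * (show ℤ from i) - 1).natAbs (.sr i) := by
        refine congrArg DihedralGroup.sr ?_
        refine (ZMod.intCast_eq_intCast_iff_dvd_sub _ _ _).2 ?_
        rw [Int.natAbs_dvd]
        exact ⟨1, by change (show ℤ from i) - (1 - (show ℤ from i)) = _; ring⟩
      rw [this])
    have h3 : (2 * (show ℤ from i) - 1).natAbs ∣ 2 := by
      rw [← ZMod.natCast_eq_zero_iff]
      exact_mod_cast h2
    have h4 := Nat.le_of_dvd two_pos h3
    have h5 : ∀ k : ℤ, (2 * k - 1).natAbs ≤ 2 → k = 0 ∨ k = 1 := by omega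
    exact (h5 _ h4).imp (congrArg DihedralGroup.sr) (congrArg DihedralGroup.sr)

end MinusOne

/-! ### The relations of `u` in terms of three idempotent matrices. -/

namespace MinusOne

open GrpAlg

/-- A linear combination of the two generating reflections and the identity. -/
noncomputable def GrpAlg.lin (p r n : ℂ) : GrpAlg :=
  MonoidAlgebra.single (.sr 0) p + MonoidAlgebra.single (.sr 1) r + MonoidAlgebra.single 1 n

/-- The group elements that can occur are `1`, `s`, `t`, `st = r 1` and `ts = r (-1)`. -/
theorem GrpAlg.coeffLin_lin_mul_lin (p r n p' r' n' : ℂ) :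
    coeffLin 1 (lin p r n * lin p' r' n') = p * p' + r * r' + n * n' ∧
    coeffLin (.sr 0) (lin p r n * lin p' r' n') = p * n' + n * p' ∧
    coeffLin (.sr 1) (lin p r n * lin p' r' n') = r * n' + n * r' ∧
    coeffLin (.r 1) (lin p r n * lin p' r' n') = p * r' ∧
    coeffLin (.r (-1)) (lin p r n * lin p' r' n') = r * p' := by
  have e1 : (DihedralGroup.r 1 : DInf) ≠ 1 := by decide
  have e2 : (DihedralGroup.r (-1) : DInf) ≠ 1 := by decide
  have e3 : (-1 : ZMod 0) ≠ 1 := by decide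
  have e4 : ∀ i, (DihedralGroup.sr i : DInf) ≠ 1 := fun i h => by cases h
  simp only [lin, add_mul, mul_add, MonoidAlgebra.single_mul_single, map_add, coeffLin_single,
    DihedralGroup.sr_mul_sr, mul_one, one_mul, sub_self, sub_zero, zero_sub]
  simp [e1, e2, e3, e4, e1.symm, e2.symm, e3.symm, fun i => (e4 i).symm]
  ring_nf
  simp

/-- A decomposition of a corepresentation along the two homomorphisms to `ℂ[D∞]`. -/
structure Decomposition (u : Matrix (Fin 3) (Fin 3) PolO2) (P R N T : Matrix (Fin 3) (Fin 3) ℂ) :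
    Prop where
  hom_one : ∀ i j, hom 1 (one_mul 1) (u i j) = lin (P i j) (R i j) (N i j)
  hom_neg_one : ∀ i j, hom (-1) neg_one_mul_self (u i j) =
    lin ((T * P) i j) ((T * R) i j) ((T * N) i j)
  pp : P * P = P
  rr : R * R = R
  nn : N * N = N
  np : N * P = 0
  nr : N * R = 0
  sum : P + R + N = 1
  rank_p : P.rank = 1
  rank_r : R.rank = 1
  rank_n : N.rank = 1
  tt : T * T = 1
  t_orth : T * T.transpose = 1
  tp : T * P = R * T
  tn : T * N = N * T

theorem IsEmbedding.exists_decomposition {f : PolSO3 →⋆ₐ[ℂ] PolO2} (hf : IsEmbedding f) :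
    ∃ P R N T, Decomposition ((Pol.gen SORel).map f) P R N T := by
  have ho : IsMinusOneOrthogonal ((Pol.gen SORel).map f) :=
    SORel.isMinusOneOrthogonal.map (f : PolSO3 →+* PolO2)
  obtain ⟨F, h, hT⟩ := exists_coeffTable ((isHopfHom_iff f).1 hf.isHopfHom) ho
  set u := (Pol.gen SORel).map f
  set P := coeffMat 1 (one_mul 1) u
  set Q := coeffMat (-1) neg_one_mul_self u
  set T := ∑ g ∈ F, Q g
  -- If only the identity occurred, the support criterion would apply to the rotation `r 1` and make
  -- it a reflection.
  have hne : ∃ g : DInf, g ≠ 1 ∧ P g ≠ 0 := by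
    by_contra! h0
    have := twist_eq_of_commute hf.surjective (g := .r 1) (by decide) fun k hk _ _ => h0 k hk
    rcases this with h | h <;> cases h
  have key : (P 1).rank = 1 ∧ (P (.sr 0)).rank = 1 ∧ (P (.sr 1)).rank = 1 ∧
      (∀ k : DInf, k ≠ 1 → k ≠ .sr 0 → k ≠ .sr 1 → P k = 0) ∧
      P (.sr 0) + P (.sr 1) + P 1 = 1 := by
    obtain ⟨g, hg1, hg⟩ := hne
    have hs := h.support hg1 hg
    have t0 : DInf.twist (.sr 0) = .sr 1 := rfl
    have t1 : DInf.twist (.sr 1) = .sr 0 := rfl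
    rcases twist_eq_of_commute hf.surjective hg1 hs.2.2.2.1 with rfl | rfl
    · rwa [t0] at hs
    · rw [t1] at hs
      obtain ⟨h1, h2, h3, h4, h5⟩ := hs
      exact ⟨h1, h3, h2, fun k h6 h7 h8 => h4 k h6 h8 h7, by rw [← h5]; abel⟩
  obtain ⟨h1, h2, h3, h4, h5⟩ := key
  have n01 : (DihedralGroup.sr 0 : DInf) ≠ .sr 1 := by decide
  have n0 : (DihedralGroup.sr 0 : DInf) ≠ 1 := by decide
  have n1 : (DihedralGroup.sr 1 : DInf) ≠ 1 := by decide
  have h6 : ∀ k : DInf, k ≠ 1 → k ≠ .sr 0 → k ≠ .sr 1 → Q k = 0 := fun k k1 k2 k3 => by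
    rw [← h.mul_p, h4 k k1 k2 k3, Matrix.mul_zero]
  have z : ∀ {g k : DInf}, g ≠ k → P g * P k = 0 := fun {g k} hgk => by rw [h.pp, if_neg hgk]
  have tw : ∀ g, T * P g = P (DInf.twist g) * T := fun g => (h.mul_p g).trans (h.p_mul g).symm
  refine ⟨P (.sr 0), P (.sr 1), P 1, T, fun i j => ?_, fun i j => ?_, h.idem _, h.idem _, h.idem _,
    z n0.symm, z n1.symm, h5, h2, h3, h1, h.mul_self, hT,
    tw (.sr 0), ?_⟩
  · exact eq_single_add n01 n0 n1 fun l l1 l2 l3 => congrFun (congrFun (h4 l l1 l2 l3) i) j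
  · rw [h.mul_p, h.mul_p, h.mul_p]
    exact eq_single_add n01 n0 n1 fun l l1 l2 l3 => congrFun (congrFun (h6 l l1 l2 l3) i) j
  · rw [tw, map_one]

namespace Decomposition

variable {u : Matrix (Fin 3) (Fin 3) PolO2} {P R N T : Matrix (Fin 3) (Fin 3) ℂ}

theorem hom_mul (h : Decomposition u P R N T) (i j k l : Fin 3) :
    hom 1 (one_mul 1) (u i j * u k l) =
      lin (P i j) (R i j) (N i j) * lin (P k l) (R k l) (N k l) := by
  rw [map_mul, h.hom_one, h.hom_one]

/-- The coefficients of `u uᵀ = 1` at `st` and `ts` give `P Rᵀ = R Pᵀ = 0`; those at `s` and `t`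
give sums that left multiplication by `N` separates, so all mixed products vanish. Then `P + R + N =
1` yields `Pᵀ = P Pᵀ`, which is symmetric, and likewise for `R` and `N`. -/
theorem transpose_eq (h : Decomposition u P R N T) (ho : IsMinusOneOrthogonal u) :
    P.transpose = P ∧ R.transpose = R ∧ N.transpose = N := by
  have e : ∀ i j, ∑ k, lin (P i k) (R i k) (N i k) * lin (P j k) (R j k) (N j k) =
      if i = j then 1 else 0 := by
    intro i j
    have := congrFun (congrFun ho.mul_transpose i) j
    simp only [Matrix.mul_apply, Matrix.transpose_apply, Matrix.one_apply] at this
    simp only [← h.hom_mul, ← map_sum, this]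
    split_ifs <;> simp
  have e' : ∀ g : DInf, g ≠ 1 → ∀ i j, ∑ k, coeffLin g
      (lin (P i k) (R i k) (N i k) * lin (P j k) (R j k) (N j k)) = 0 := by
    intro g hg i j
    rw [← map_sum, e]
    split_ifs
    · rw [MonoidAlgebra.one_def, coeffLin_single, if_neg hg.symm]
    · exact map_zero _
  have pn : P * N.transpose + N * P.transpose = 0 := by
    ext i j
    simpa only [Matrix.add_apply, Matrix.mul_apply, Matrix.transpose_apply,
      (coeffLin_lin_mul_lin _ _ _ _ _ _).2.1, Finset.sum_add_distrib, Matrix.zero_apply] using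
      e' (.sr 0) (by decide) i j
  have rn : R * N.transpose + N * R.transpose = 0 := by
    ext i j
    simpa only [Matrix.add_apply, Matrix.mul_apply, Matrix.transpose_apply,
      (coeffLin_lin_mul_lin _ _ _ _ _ _).2.2.1, Finset.sum_add_distrib, Matrix.zero_apply] using
      e' (.sr 1) (by decide) i j
  have pr : P * R.transpose = 0 := by
    ext i j
    simpa only [Matrix.mul_apply, Matrix.transpose_apply,
      (coeffLin_lin_mul_lin _ _ _ _ _ _).2.2.2.1, Matrix.zero_apply] using e' (.r 1) (by decide) i j
  have rp : R * P.transpose = 0 := by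
    ext i j
    simpa only [Matrix.mul_apply, Matrix.transpose_apply,
      (coeffLin_lin_mul_lin _ _ _ _ _ _).2.2.2.2, Matrix.zero_apply] using e' (.r (-1)) (by decide) i j
  have np : N * P.transpose = 0 := by
    have := congrArg (N * ·) pn
    simpa [Matrix.mul_add, ← Matrix.mul_assoc, h.np, h.nn] using this
  have nr : N * R.transpose = 0 := by
    have := congrArg (N * ·) rn
    simpa [Matrix.mul_add, ← Matrix.mul_assoc, h.nr, h.nn] using this
  have pn' : P * N.transpose = 0 := by simpa [np] using pn
  have rn' : R * N.transpose = 0 := by simpa [nr] using rn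
  have sym : ∀ M : Matrix (Fin 3) (Fin 3) ℂ, (P + R + N) * M.transpose =
      M * M.transpose → M.transpose = M := by
    intro M hM
    rw [h.sum, Matrix.one_mul] at hM
    calc M.transpose = M * M.transpose := hM
      _ = (M * M.transpose).transpose := by simp
      _ = M := by rw [← hM, Matrix.transpose_transpose]
  exact ⟨sym P (by simp [Matrix.add_mul, rp, np]), sym R (by simp [Matrix.add_mul, pr, nr]),
    sym N (by simp [Matrix.add_mul, pn', rn'])⟩

/-- This is the coefficient of the anticommutation relation at `s`; the two sides give the same
expression with opposite signs. -/
theorem row (h : Decomposition u P R N T) (ho : IsMinusOneOrthogonal u) (i : Fin 3) {j k : Fin 3}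
    (hjk : j ≠ k) : P i j * N i k + N i j * P i k = 0 := by
  have e := congrArg (hom 1 (one_mul 1)) (ho.row i j k hjk)
  rw [map_neg, h.hom_mul, h.hom_mul] at e
  have e1 := congrArg (coeffLin (.sr 0)) e
  rw [map_neg, (coeffLin_lin_mul_lin _ _ _ _ _ _).2.1,
    (coeffLin_lin_mul_lin _ _ _ _ _ _).2.1] at e1
  linear_combination e1 / 2

/-- This is the coefficient of the commutation relation at `st`. -/
theorem comm (h : Decomposition u P R N T) (ho : IsMinusOneOrthogonal u) {i j k l : Fin 3}
    (hik : i ≠ k) (hjl : j ≠ l) : P i j * R k l = R i j * P k l := by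
  have e := congrArg (hom 1 (one_mul 1)) (ho.comm i j k l hik hjl)
  rw [h.hom_mul, h.hom_mul] at e
  have e2 := congrArg (coeffLin (.r 1)) e
  rw [(coeffLin_lin_mul_lin _ _ _ _ _ _).2.2.2.1,
    (coeffLin_lin_mul_lin _ _ _ _ _ _).2.2.2.1] at e2
  rw [e2, mul_comm]

end Decomposition

end MinusOne

namespace MinusOne

open GrpAlg

/-! ### Orthonormal bases subject to the relations -/

section Vectors

variable {v w n : Fin 3 → ℂ}
  (hs : ∀ i j, v i * v j + w i * w j + n i * n j = if i = j then 1 else 0)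
  (hn : ∑ i, n i * n i = 1)
  (hc : ∀ i k, i ≠ k → v i * w k * (v i * w k) = w i * v k * (w i * v k))
  (hr : ∀ i k, i ≠ k → v i * n i * (v i * n k + v k * n i) = 0)

-- Up to sign `n` is the cross product of `v` and `w`; its squared coordinates follow from the Gram
-- relations alone.
include hs hn in
theorem cross_sq (σ : Equiv.Perm (Fin 3)) : n (σ 2) * n (σ 2) =
    (v (σ 0) * w (σ 1) - w (σ 0) * v (σ 1)) * (v (σ 0) * w (σ 1) - w (σ 0) * v (σ 1)) := by
  have h0 := hs (σ 0) (σ 0)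
  have h1 := hs (σ 1) (σ 1)
  have h2 := hs (σ 0) (σ 1)
  rw [if_pos rfl] at h0 h1
  rw [if_neg (σ.injective.ne (by decide))] at h2
  rw [← Equiv.sum_comp σ, Fin.sum_univ_three] at hn
  linear_combination hn - (v (σ 1) * v (σ 1) + w (σ 1) * w (σ 1)) * h0 -
    (1 - n (σ 0) * n (σ 0)) * h1 +
    (v (σ 0) * v (σ 1) + w (σ 0) * w (σ 1) - n (σ 0) * n (σ 1)) * h2

-- By `hc` the two terms of the minor agree up to sign, and equality would make the minor, hence `n
-- (σ 2)`, vanish.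
include hs hn hc in
theorem cross_of_ne (σ : Equiv.Perm (Fin 3)) (h : n (σ 2) ≠ 0) :
    v (σ 0) * w (σ 1) = -(w (σ 0) * v (σ 1)) ∧ v (σ 0) * w (σ 1) ≠ 0 := by
  have h1 := cross_sq hs hn σ
  have h2 := hc (σ 0) (σ 1) (σ.injective.ne (by decide))
  have h3 : v (σ 0) * w (σ 1) - w (σ 0) * v (σ 1) ≠ 0 := by
    intro h3
    rw [h3, mul_zero] at h1
    exact h (mul_self_eq_zero.1 h1)
  have h4 : v (σ 0) * w (σ 1) = -(w (σ 0) * v (σ 1)) := by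
    apply mul_left_cancel₀ h3
    linear_combination h2
  refine ⟨h4, fun h5 => h3 ?_⟩
  linear_combination 2 * h5 - h4

-- If `n` were nonzero at both places, two minors would have opposite terms; this forces the third
-- minor to vanish, so `n (σ 1) = 0`. Then `hr` becomes a vanishing product of nonzero factors.
include hs hn hc hr in
theorem normal_eq_zero (σ : Equiv.Perm (Fin 3)) (h : n (σ 2) ≠ 0) : n (σ 0) = 0 := by
  by_contra h0
  obtain ⟨a1, a2⟩ := cross_of_ne hs hn hc σ h
  -- The rotation puts `σ 0` in the role of `σ 2`, and `σ 1, σ 2` in those of `σ 0, σ 1`.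
  obtain ⟨b1, b2⟩ := cross_of_ne hs hn hc (σ * finRotate 3) h0
  have b1 : v (σ 1) * w (σ 2) = -(w (σ 1) * v (σ 2)) := b1
  have b2 : v (σ 1) * w (σ 2) ≠ 0 := b2
  have c := cross_sq hs hn (σ * Equiv.swap 1 2)
  have c : n (σ 1) * n (σ 1) =
    (v (σ 0) * w (σ 2) - w (σ 0) * v (σ 2)) * (v (σ 0) * w (σ 2) - w (σ 0) * v (σ 2)) := c
  have d : v (σ 0) * w (σ 2) - w (σ 0) * v (σ 2) = 0 := by
    have : v (σ 1) * w (σ 1) ≠ 0 :=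
      mul_ne_zero (left_ne_zero_of_mul b2) (right_ne_zero_of_mul a2)
    apply (mul_eq_zero.1 (?_ : v (σ 1) * w (σ 1) * _ = 0)).resolve_left this
    linear_combination v (σ 1) * w (σ 2) * a1 - w (σ 0) * v (σ 1) * b1
  rw [d, mul_zero] at c
  have h1 := hr (σ 0) (σ 1) (σ.injective.ne (by decide))
  rw [mul_self_eq_zero.1 c, mul_zero, zero_add] at h1
  exact mul_ne_zero (mul_ne_zero (left_ne_zero_of_mul a2) h0)
    (mul_ne_zero (left_ne_zero_of_mul b2) h0) h1

-- Once `n` is a coordinate vector, `v` and `w` live in the other two coordinates, and `v₀w₁ =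
-- -w₀v₁` with orthonormality makes all their squares `1/2`. The sign `η` compares the two
-- coordinates of `v`; only products appear since each vector is determined up to sign.
include hs hn hc hr in
theorem exists_perm_vectors : ∃ σ : Equiv.Perm (Fin 3), ∃ η : ℂ, η * η = 1 ∧
    (∀ i j, v (σ i) * v (σ j) = !![1 / 2, η / 2, 0; η / 2, 1 / 2, 0; 0, 0, 0] i j) ∧
    (∀ i j, w (σ i) * w (σ j) = !![1 / 2, -η / 2, 0; -η / 2, 1 / 2, 0; 0, 0, 0] i j) ∧
    (∀ i j, n (σ i) * n (σ j) = !![0, 0, 0; 0, 0, 0; 0, 0, 1] i j) := by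
  obtain ⟨m, hm⟩ : ∃ m, n m ≠ 0 := by
    by_contra! h0
    simp [h0] at hn
  set σ := Equiv.swap 2 m with hσ
  have hm : n (σ 2) ≠ 0 := by rwa [hσ, Equiv.swap_apply_left]
  clear_value σ
  have n0 : n (σ 0) = 0 := normal_eq_zero hs hn hc hr σ hm
  have n1 : n (σ 1) = 0 := normal_eq_zero hs hn hc hr (σ * Equiv.swap 0 1) hm
  obtain ⟨a1, a2⟩ := cross_of_ne hs hn hc σ hm
  have n2 : n (σ 2) * n (σ 2) = 1 := by
    rw [← Equiv.sum_comp σ, Fin.sum_univ_three, n0, n1] at hn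
    linear_combination hn
  have s00 := hs (σ 0) (σ 0)
  have s11 := hs (σ 1) (σ 1)
  have s01 := hs (σ 0) (σ 1)
  have s02 := hs (σ 0) (σ 2)
  have s12 := hs (σ 1) (σ 2)
  simp only [if_true, σ.injective.eq_iff, n0, n1, mul_zero, zero_mul, add_zero,
    show (0 : Fin 3) ≠ 1 by decide, show (0 : Fin 3) ≠ 2 by decide,
    show (1 : Fin 3) ≠ 2 by decide, if_false] at s00 s11 s01 s02 s12
  have hv0 := left_ne_zero_of_mul a2
  have hw1 := right_ne_zero_of_mul a2
  have hw0 : w (σ 0) ≠ 0 := fun h0 => a2 (by rw [a1, h0]; ring)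
  have v2 : v (σ 2) = 0 := by
    apply mul_left_cancel₀ a2
    linear_combination w (σ 1) / 2 * s02 - w (σ 0) / 2 * s12 + v (σ 2) / 2 * a1
  have w2 : w (σ 2) = 0 := by
    rw [v2, mul_zero, zero_add] at s02
    exact (mul_eq_zero.1 s02).resolve_left hw0
  have v00 : v (σ 0) * v (σ 0) = 1 / 2 := by
    have : v (σ 0) * v (σ 0) = w (σ 0) * w (σ 0) := by
      apply mul_right_cancel₀ hw1
      linear_combination v (σ 0) * a1 - w (σ 0) * s01
    linear_combination this / 2 + s00 / 2
  have v11 : v (σ 1) * v (σ 1) = 1 / 2 := by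
    have : v (σ 1) * v (σ 1) = w (σ 1) * w (σ 1) := by
      apply mul_left_cancel₀ hw0
      linear_combination -w (σ 1) * s01 + v (σ 1) * a1
    linear_combination this / 2 + s11 / 2
  refine ⟨σ, 2 * (v (σ 0) * v (σ 1)), ?_, ?_, ?_, ?_⟩
  · linear_combination 4 * (v (σ 0) * v (σ 0)) * v11 + 2 * v00
  · intro i j
    fin_cases i <;> fin_cases j <;> simp [v2]
    · linear_combination v00
    · ring
    · linear_combination v11
  · intro i j
    fin_cases i <;> fin_cases j <;> simp [w2]
    · linear_combination s00 - v00
    · linear_combination s01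
    · linear_combination s01
    · linear_combination s11 - v11
  · intro i j
    fin_cases i <;> fin_cases j <;> simp [n0, n1, n2]

end Vectors

end MinusOne

/-! ### Normal form of the corepresentation and classification of the embeddings. -/

namespace MinusOne

open GrpAlg

theorem perm3_submatrix {B : Type} [Ring B] [Algebra ℂ B] {u : Matrix (Fin 3) (Fin 3) B}
    (h : IsMinusOneOrthogonal u) (σ : Equiv.Perm (Fin 3)) :
    perm3 (u.submatrix σ σ) = perm3 u := by
  rw [← rowPerm_eq h (σ 0) (σ 1) (σ 2) (σ.injective.ne (by decide)) (σ.injective.ne (by decide))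
    (σ.injective.ne (by decide)), rowPerm]
  exact Equiv.sum_comp (Equiv.mulLeft σ) fun τ => u (σ 0) (τ 0) * u (σ 1) (τ 1) * u (σ 2) (τ 2)

theorem GrpAlg.lin_eq_a (c : ℂ) : lin (c / 2) (c / 2) 0 = c • a := by
  simp [lin, a, s, t, div_eq_mul_inv]

theorem GrpAlg.lin_eq_b (c : ℂ) : lin (c / 2) (-c / 2) 0 = c • b := by
  rw [lin, b, s, t, smul_smul, smul_sub, MonoidAlgebra.smul_single, MonoidAlgebra.smul_single,
    neg_div, MonoidAlgebra.single_neg, MonoidAlgebra.single_zero, add_zero, ← sub_eq_add_neg]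
  simp [div_eq_mul_inv]

theorem GrpAlg.lin_eq_one (c : ℂ) : lin 0 0 c = c • 1 := by
  simp [lin, MonoidAlgebra.one_def]

namespace Decomposition

variable {u : Matrix (Fin 3) (Fin 3) PolO2} {P R N T : Matrix (Fin 3) (Fin 3) ℂ}

theorem exists_normal_form (h : Decomposition u P R N T) (ho : IsMinusOneOrthogonal u) :
    ∃ σ : Equiv.Perm (Fin 3), ∃ η : ℂ, η * η = 1 ∧
      P.submatrix σ σ = !![1 / 2, η / 2, 0; η / 2, 1 / 2, 0; 0, 0, 0] ∧
      R.submatrix σ σ = !![1 / 2, -η / 2, 0; -η / 2, 1 / 2, 0; 0, 0, 0] ∧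
      N.submatrix σ σ = !![0, 0, 0; 0, 0, 0; 0, 0, 1] := by
  obtain ⟨tp, tr, tn⟩ := h.transpose_eq ho
  obtain ⟨v, hv, -⟩ := exists_eq_mul_self h.pp tp h.rank_p
  obtain ⟨w, hw, -⟩ := exists_eq_mul_self h.rr tr h.rank_r
  obtain ⟨n, hn, hn1⟩ := exists_eq_mul_self h.nn tn h.rank_n
  obtain ⟨σ, η, hη, h1, h2, h3⟩ := exists_perm_vectors (v := v) (w := w) (n := n)
    (fun i j => by
      rw [← hv, ← hw, ← hn, ← Matrix.one_apply, ← h.sum, Matrix.add_apply, Matrix.add_apply])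
    hn1
    (fun i k hik => by
      have := h.comm ho hik hik
      rw [hv, hw, hv, hw] at this
      linear_combination this)
    (fun i k hik => by
      have := h.row ho i hik
      rw [hv, hn, hv, hn] at this
      linear_combination this)
  refine ⟨σ, η, hη, ?_, ?_, ?_⟩
  · ext i j; rw [Matrix.submatrix_apply, hv, h1]
  · ext i j; rw [Matrix.submatrix_apply, hw, h2]
  · ext i j; rw [Matrix.submatrix_apply, hn, h3]

/-- In the adapted basis, the matrix that exchanges the two homomorphisms is diagonal. -/
theorem exists_exchange (h : Decomposition u P R N T) {σ : Equiv.Perm (Fin 3)} {η : ℂ}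
    (hη : η * η = 1)
    (hP : P.submatrix σ σ = !![1 / 2, η / 2, 0; η / 2, 1 / 2, 0; 0, 0, 0])
    (hR : R.submatrix σ σ = !![1 / 2, -η / 2, 0; -η / 2, 1 / 2, 0; 0, 0, 0])
    (hN : N.submatrix σ σ = !![0, 0, 0; 0, 0, 0; 0, 0, 1]) :
    ∃ κ δ : ℂ, κ * κ = 1 ∧ T.submatrix σ σ = !![κ, 0, 0; 0, -κ, 0; 0, 0, δ] := by
  have hη0 : η ≠ 0 := by
    rintro rfl
    simp at hη
  have tT : T.transpose = T := by
    calc T.transpose = T * T * T.transpose := by rw [h.tt, Matrix.one_mul]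
      _ = T := by rw [Matrix.mul_assoc, h.t_orth, Matrix.mul_one]
  set S := T.submatrix σ σ with hS
  have tp : S * !![1 / 2, η / 2, 0; η / 2, 1 / 2, 0; 0, 0, 0] =
      !![1 / 2, -η / 2, 0; -η / 2, 1 / 2, 0; 0, 0, 0] * S := by
    rw [← hP, ← hR, hS, Matrix.submatrix_mul_equiv, Matrix.submatrix_mul_equiv, h.tp]
  have tn : S * !![0, 0, 0; 0, 0, 0; 0, 0, 1] = !![0, 0, 0; 0, 0, 0; 0, 0, 1] * S := by
    rw [← hN, hS, Matrix.submatrix_mul_equiv, Matrix.submatrix_mul_equiv, h.tn]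
  have tt : S * S = 1 := by
    rw [hS, Matrix.submatrix_mul_equiv, h.tt, Matrix.submatrix_one_equiv]
  have sym : ∀ i j, S i j = S j i := fun i j => congrFun (congrFun tT (σ j)) (σ i)
  have s02 : S 0 2 = 0 := by
    simpa [Matrix.mul_apply, Fin.sum_univ_three] using congrFun (congrFun tn 0) 2
  have s12 : S 1 2 = 0 := by
    simpa [Matrix.mul_apply, Fin.sum_univ_three] using congrFun (congrFun tn 1) 2
  -- With symmetry of `S`, these two entries of the exchange relation give `S 0 1 = 0` and `S 1 1 =
  -- -S 0 0`.
  have e00 := congrFun (congrFun tp 0) 0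
  have e01 := congrFun (congrFun tp 0) 1
  have f00 := congrFun (congrFun tt 0) 0
  simp [Matrix.mul_apply, Fin.sum_univ_three] at e00 e01 f00
  have s01 : S 0 1 = 0 := by
    apply mul_left_cancel₀ hη0
    rw [sym 1 0] at e00
    linear_combination e00
  have s11 : S 1 1 = -S 0 0 := by
    apply mul_left_cancel₀ hη0
    linear_combination 2 * e01
  refine ⟨S 0 0, S 2 2, ?_, ?_⟩
  · rw [s01, s02] at f00
    linear_combination f00
  · ext i j
    fin_cases i <;> fin_cases j <;>
      simp [s01, s02, s12, s11, sym 1 0, sym 2 0, sym 2 1]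

theorem hom_submatrix (h : Decomposition u P R N T) {σ : Equiv.Perm (Fin 3)} {η κ δ : ℂ}
    (hP : P.submatrix σ σ = !![1 / 2, η / 2, 0; η / 2, 1 / 2, 0; 0, 0, 0])
    (hR : R.submatrix σ σ = !![1 / 2, -η / 2, 0; -η / 2, 1 / 2, 0; 0, 0, 0])
    (hN : N.submatrix σ σ = !![0, 0, 0; 0, 0, 0; 0, 0, 1])
    (hT : T.submatrix σ σ = !![κ, 0, 0; 0, -κ, 0; 0, 0, δ]) :
    (∀ i j, hom 1 (one_mul 1) (u (σ i) (σ j)) = !![a, η • b, 0; η • b, a, 0; 0, 0, 1] i j) ∧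
    (∀ i j, hom (-1) neg_one_mul_self (u (σ i) (σ j)) =
      !![κ • a, (κ * η) • b, 0; (-(κ * η)) • b, (-κ) • a, 0; 0, 0, δ • 1] i j) := by
  have z : lin 0 0 0 = 0 := by rw [lin_eq_one, zero_smul]
  constructor
  · intro i j
    rw [h.hom_one, ← Matrix.submatrix_apply P, ← Matrix.submatrix_apply R,
      ← Matrix.submatrix_apply N, hP, hR, hN]
    fin_cases i <;> fin_cases j
    exacts [(lin_eq_a 1).trans (one_smul _ _), lin_eq_b η, z, lin_eq_b η,
      (lin_eq_a 1).trans (one_smul _ _), z, z, z, (lin_eq_one 1).trans (one_smul _ _)]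
  · intro i j
    have hm : ∀ M : Matrix (Fin 3) (Fin 3) ℂ, (T * M) (σ i) (σ j) =
        (!![κ, 0, 0; 0, -κ, 0; 0, 0, δ] * M.submatrix σ σ) i j := by
      intro M
      rw [← hT, Matrix.submatrix_mul_equiv, Matrix.submatrix_apply]
    have m1 : !![κ, 0, 0; 0, -κ, 0; 0, 0, δ] * !![1 / 2, η / 2, 0; η / 2, 1 / 2, 0; 0, 0, 0] =
        !![κ / 2, κ * η / 2, 0; -(κ * η) / 2, -κ / 2, 0; 0, 0, 0] := by
      ext i j
      fin_cases i <;> fin_cases j <;> simp [Matrix.mul_apply, Fin.sum_univ_three] <;> ring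
    have m2 : !![κ, 0, 0; 0, -κ, 0; 0, 0, δ] * !![1 / 2, -η / 2, 0; -η / 2, 1 / 2, 0; 0, 0, 0] =
        !![κ / 2, -(κ * η) / 2, 0; -(-(κ * η)) / 2, -κ / 2, 0; 0, 0, 0] := by
      ext i j
      fin_cases i <;> fin_cases j <;> simp [Matrix.mul_apply, Fin.sum_univ_three] <;> ring
    have m3 : !![κ, 0, 0; 0, -κ, 0; 0, 0, δ] * !![0, 0, 0; 0, 0, 0; 0, 0, 1] =
        !![0, 0, 0; 0, 0, 0; 0, 0, δ] := by
      ext i j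
      fin_cases i <;> fin_cases j <;> simp [Matrix.mul_apply, Fin.sum_univ_three]
    rw [h.hom_neg_one, hm, hm, hm, hP, hR, hN, m1, m2, m3]
    fin_cases i <;> fin_cases j
    exacts [lin_eq_a κ, lin_eq_b (κ * η), z, lin_eq_b (-(κ * η)), lin_eq_a (-κ), z, z, z,
      lin_eq_one δ]

end Decomposition

theorem hom_blockPerm (e : ℂ) (he : e * e = 1) (i j : Fin 3) :
    hom e he (blockPerm (Pol.gen (ORel 2)) i j) =
      !![a, b, 0; e • b, e • a, 0; 0, 0, e • 1] i j := by
  have h := fun i j => congrFun (congrFun (hom_gen e he) i) j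
  fin_cases i <;> fin_cases j
  exacts [h 0 0, h 0 1, map_zero _, h 1 0, h 1 1, map_zero _, map_zero _, map_zero _,
    hom_perm2 e he]

/-- For `η² = 1` the scalars are `dᵢdⱼ` with `d = (1, η, η)`, so this is conjugation by a diagonal
sign matrix. Joint injectivity reduces the identity to the two group algebras. -/
theorem eq_smul_blockPerm {u : Matrix (Fin 3) (Fin 3) PolO2} {σ : Equiv.Perm (Fin 3)} {η : ℂ}
    (h1 : ∀ i j, hom 1 (one_mul 1) (u (σ i) (σ j)) =
      !![a, η • b, 0; η • b, a, 0; 0, 0, 1] i j)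
    (h2 : ∀ i j, hom (-1) neg_one_mul_self (u (σ i) (σ j)) =
      !![a, η • b, 0; (-η) • b, -a, 0; 0, 0, -1] i j) (i j : Fin 3) :
    u (σ i) (σ j) = !![1, η, η; η, 1, 1; η, 1, 1] i j • blockPerm (Pol.gen (ORel 2)) i j := by
  apply hom_ext
  · rw [h1, map_smul, hom_blockPerm]
    fin_cases i <;> fin_cases j <;> simp
  · rw [h2, map_smul, hom_blockPerm]
    fin_cases i <;> fin_cases j <;> simp

theorem Decomposition.exists_eq_smul_blockPerm {u : Matrix (Fin 3) (Fin 3) PolO2}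
    {P R N T : Matrix (Fin 3) (Fin 3) ℂ} (h : Decomposition u P R N T)
    (ho : IsMinusOneOrthogonal u) (hp : perm3 u = 1) :
    ∃ σ : Equiv.Perm (Fin 3), ∃ η : ℂ, η * η = 1 ∧ ∀ i j,
      u (σ i) (σ j) = !![1, η, η; η, 1, 1; η, 1, 1] i j • blockPerm (Pol.gen (ORel 2)) i j := by
  obtain ⟨σ, η, hη, hP, hR, hN⟩ := h.exists_normal_form ho
  obtain ⟨κ, δ, hκ, hT⟩ := h.exists_exchange hη hP hR hN
  obtain ⟨u1, u2⟩ := h.hom_submatrix hP hR hN hT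
  -- In the copy with sign `-1`, the upper block has permanent `-(a² + b²) = -1`, so permanent one
  -- forces the corner to be `-1`.
  have hδ : δ = -1 := by
    have h1 := perm3_submatrix (ho.map (hom (-1) neg_one_mul_self).toRingHom) σ
    rw [perm3_map, hp, map_one, perm3_eq_perm2_mul] at h1
    · change perm2 _ * hom (-1) neg_one_mul_self (u (σ 2) (σ 2)) = 1 at h1
      have h3 : perm2 ((((u.map (hom (-1) neg_one_mul_self).toRingHom).submatrix σ σ).submatrix
          (Fin.castSucc (n := 2)) Fin.castSucc)) = (-1 : ℂ) • 1 := by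
        change hom (-1) neg_one_mul_self (u (σ 0) (σ 0)) * hom (-1) neg_one_mul_self (u (σ 1) (σ 1)) +
          hom (-1) neg_one_mul_self (u (σ 0) (σ 1)) * hom (-1) neg_one_mul_self (u (σ 1) (σ 0)) = _
        rw [u2, u2, u2, u2, ← a_sq_add_b_sq]
        have e1 : κ * -κ = -1 := by linear_combination -hκ
        have e2 : κ * η * -(κ * η) = -1 := by linear_combination -(η * η) * hκ - hη
        change κ • a * (-κ) • a + (κ * η) • b * (-(κ * η)) • b = _
        rw [smul_mul_smul_comm, smul_mul_smul_comm, e1, e2, smul_add]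
      have h4 : hom (-1) neg_one_mul_self (u (σ 2) (σ 2)) = δ • 1 := u2 2 2
      rw [h3, h4, smul_mul_smul_comm, mul_one] at h1
      have h5 := congrArg (coeffLin 1) h1
      rw [map_smul, MonoidAlgebra.one_def, coeffLin_single, if_pos rfl, smul_eq_mul] at h5
      linear_combination -h5
    · intro i hi
      fin_cases i
      exacts [u2 0 2, u2 1 2, absurd rfl hi]
    · intro i hi
      fin_cases i
      exacts [u2 2 0, u2 2 1, absurd rfl hi]
  rcases mul_self_eq_one_iff.1 hκ with rfl | rfl
  · refine ⟨σ, η, hη, eq_smul_blockPerm u1 fun i j => ?_⟩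
    rw [u2, hδ]
    fin_cases i <;> fin_cases j <;> simp
  -- Exchanging the first two coordinates reverses the sign `κ` and leaves the image under the first
  -- homomorphism unchanged.
  · refine ⟨σ * Equiv.swap 0 1, η, hη, eq_smul_blockPerm (fun i j => ?_) fun i j => ?_⟩
    · rw [Equiv.Perm.mul_apply, Equiv.Perm.mul_apply, u1]
      fin_cases i <;> fin_cases j <;> rfl
    · rw [Equiv.Perm.mul_apply, Equiv.Perm.mul_apply, u2, hδ]
      have e : Equiv.swap (0 : Fin 3) 1 2 = 2 := by decide
      fin_cases i <;> fin_cases j <;> simp [e]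

theorem IsEmbedding.exists_isStandard {f : PolSO3 →⋆ₐ[ℂ] PolO2} (hf : IsEmbedding f) :
    ∃ x, IsStandard x f := by
  obtain ⟨P, R, N, T, h⟩ := hf.exists_decomposition
  have hp : perm3 ((Pol.gen SORel).map f) = 1 := by
    have := perm3_map (f : PolSO3 →+* PolO2) (Pol.gen SORel)
    rw [SORel.perm3_gen, map_one] at this
    exact this
  obtain ⟨σ, η, hη, hu⟩ := h.exists_eq_smul_blockPerm
    (SORel.isMinusOneOrthogonal.map (f : PolSO3 →+* PolO2)) hp
  -- The permutation matrix of `σ` times `diag(1, η, η)` has permanent `η² = 1`, so it is one of the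
  -- `ρ(x)`.
  have hx : ∃ x, ∀ i j, rho x (σ i) j = if i = j then (if j = 0 then 1 else η) else 0 := by
    rcases mul_self_eq_one_iff.1 hη with rfl | rfl
    · obtain ⟨x, hx⟩ := exists_rhoInt_eq σ true
      refine ⟨x, fun i j => ?_⟩
      rw [rho_apply, hx]
      by_cases hij : i = j <;> simp [hij]
    · obtain ⟨x, hx⟩ := exists_rhoInt_eq σ false
      refine ⟨x, fun i j => ?_⟩
      rw [rho_apply, hx]
      by_cases hij : i = j
      · by_cases hj : j = 0
        · simp [hij, hj]
        · simp [hij, hj, beq_eq_false_iff_ne.2 hj]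
      · simp [hij]
  obtain ⟨x, hx⟩ := hx
  refine ⟨x, ?_⟩
  ext i j
  obtain ⟨i, rfl⟩ := σ.surjective i
  obtain ⟨j, rfl⟩ := σ.surjective j
  rw [hu, conj_rhoIn_apply]
  simp only [hx]
  fin_cases i <;> fin_cases j <;> simp [hη]

end MinusOne

theorem mainTheorem3 :
    MinusOne.copies.encard = 3 ∧
      (∀ I ∈ MinusOne.copies, ∀ J ∈ MinusOne.copies,
        ∃ (x : Equiv.Perm (Fin 4)) (θ : MinusOne.PolSO3 ≃⋆ₐ[ℂ] MinusOne.PolSO3),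
          MinusOne.IsInnerAut x θ ∧
            θ '' (I : Set MinusOne.PolSO3) = (J : Set MinusOne.PolSO3)) ∧
      (∀ f : MinusOne.PolSO3 →⋆ₐ[ℂ] MinusOne.PolO2,
        MinusOne.IsEmbedding f ↔ ∃ x : Equiv.Perm (Fin 4), MinusOne.IsStandard x f) ∧
      (∀ x : Equiv.Perm (Fin 4), ∃ f : MinusOne.PolSO3 →⋆ₐ[ℂ] MinusOne.PolO2,
        MinusOne.IsEmbedding f ∧ MinusOne.IsStandard x f) :=
  MinusOne.copies_of_classification fun _ hf => hf.exists_isStandard
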